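/- **Setting.** Let $(\mathsf X,\mathcal X)$ and $(\mathsf Y,\mathcal Y)$ be measurable spaces, $Q$ a Markov kernel on $(\mathsf X,\mathcal X)$, $\nu$ a $\sigma$-finite measure on $(\mathsf Y,\mathcal Y)$ and $g:\mathsf X\times\mathsf Y\to[0,\infty)$ a measurable function with $\int g(x,y)\,\nu(dy)=1$ for all $x$ (a hidden Markov model with transition kernel $Q$ and observation density $g$). Write $g_y=g(\cdot,y)$, $\|f\|_\infty=\sup_x|f(x)|$, $\ln^+=\max(\ln,0)$, $\ln^-=\max(-\ln,0)$, $\ln^-0=\ln^+\infty=\infty$. For $y_k,\dots,y_m\in\mathsf Y$ let $$L\langle y_{k:m}\rangle(x_k,A)=\int\cdots\int \mathbf 1_A(x_{m+1})\prod_{\ell=k}^m g(x_\ell,y_\ell)\,Q(x_\ell,dx_{\ell+1}),$$ and $L\langle y_{k:m}\rangle(x,\cdot)=\delta_x$ if $k>m$. For a probability measure $\chi$ on $\mathsf X$ define the predictor and the filter distributions $$\phi_\chi\langle y_{0:n-1}\rangle(A)=\frac{\chi L\langle y_{0:n-1}\rangle\mathbf 1_A}{\chi L\langle y_{0:n-1}\rangle\mathbf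 1_{\mathsf X}},\qquad \tilde\phi_\chi\langle y_{0:n}\rangle(A)=\frac{\phi_\chi\langle y_{0:n-1}\rangle(\mathbf 1_A\,g_{y_n})}{\phi_\chi\langle y_{0:n-1}\rangle(g_{y_n})},$$ and the asymptotic variances of the bootstrap particle predictor and of the bootstrap particle filter $$\sigma^2_\chi\langle y_{0:n-1}\rangle(h)=\sum_{k=0}^n\phi_\chi\langle y_{0:k-1}\rangle\left(\frac{L\langle y_{k:n-1}\rangle h-\phi_\chi\langle y_{0:n-1}\rangle h\cdot L\langle y_{k:n-1}\rangle\mathbf 1_{\mathsf X}}{\phi_\chi\langle y_{0:k-1}\rangle L\langle y_{k:n-1}\rangle\mathbf 1_{\mathsf X}}\right)^2,$$ $$\tilde\sigma^2_\chi\langle y_{0:n}\rangle(h)=\frac{\sigma^2_\chi\langle y_{0:n-1}\rangle\bigl(g_{y_n}\{h-\tilde\phi_\chi\langle y_{0:n}\rangle h\}\bigr)}{(\phi_\chi\langle y_{0:n-1}\rangle g_{y_n})^2}.$$ For an integer $r\ge1$, a set $C\in\mathcal X$ is *$r$-local Doeblin* if there are positive functions $\epsilon_C^-,\epsilon_C^+:\mathsf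 Y^r\to(0,\infty)$, probability measures $\lambda_C\langle z\rangle$ with $\lambda_C\langle z\rangle(C)=1$, and positive functions $\varphi_C\langle z\rangle$ on $\mathsf X$ ($z\in\mathsf Y^r$) such that for all $z\in\mathsf Y^r$, $A\in\mathcal X$, $x\in C$, $$\epsilon_C^-\langle z\rangle\varphi_C\langle z\rangle(x)\lambda_C\langle z\rangle(A)\le L\langle z\rangle(x,A\cap C)\le\epsilon_C^+\langle z\rangle\varphi_C\langle z\rangle(x)\lambda_C\langle z\rangle(A).$$ Let $(Y_n)_{n\in\mathbb N}$ be a $\mathsf Y$-valued process on a probability space $(\Omega,\mathcal A,\mathbb P)$ (it need not come from the model). **(A1)** $(Y_n)$ is strictly stationary and ergodic, and there are an integer $r\ge1$ and a set $K\in\mathcal Y^{\otimes r}$ such that: (i) the process $(Z_n)$, $Z_n=Y_{nr:(n+1)r-1}$, is ergodic and $\mathbb P(Z_0\in K)>2/3$; (ii) for every $\eta>0$ there is an $r$-local Doeblin set $C$ (with functions $\epsilon_C^\pm$) such that $\sup_{x\in C^c}L\langle z\rangle(x,\mathsf X)\le\eta\,\|L\langle z\rangle(\cdot,\mathsf X)\|_\infty<\infty$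 for all $z\in K$, and $\inf_{z\in K}\epsilon_C^-\langle z\rangle/\epsilon_C^+\langle z\rangle>0$; (iii) there is a set $D\in\mathcal X$ with $\mathbb E\bigl[\ln^-\inf_{x\in D}L\langle Y_{0:r-1}\rangle(x,D)\bigr]<\infty$. **(A2)** $g(x,y)>0$ for all $(x,y)\in\mathsf X\times\mathsf Y$, and $\mathbb E[\ln^+\|g_{Y_0}\|_\infty]<\infty$. For $r$ and $D$ as in (A1), let $\mathcal M(D,r)$ be the set of probability measures $\chi$ on $\mathsf X$ such that $\mathbb E[\ln^-\chi L\langle Y_{0:\ell-1}\rangle\mathbf 1_D]<\infty$ for all $\ell\in\{0,\dots,r\}$. **Theorem.** Assume (A1)–(A2). Then for all $\chi\in\mathcal M(D,r)$ and all bounded measurable $h:\mathsf X\to\mathbb R$, the sequence of real random variables $(\tilde\sigma^2_\chi\langle Y_{0:n}\rangle(h))_{n\ge1}$ is tight: for every $\varepsilon>0$ there is $a\in\mathbb R$ such that $\mathbb P\bigl(\tilde\sigma^2_\chi\langle Y_{0:n}\rangle(h)\notin[-a,a]\bigr)\le\varepsilon$ for all $n\ge1$. -/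

import Mathlib

open MeasureTheory ProbabilityTheory
open scoped ENNReal

noncomputable section

namespace ParticleFilter

/-- A fully dominated hidden Markov model on `(𝒳, 𝒴)`: a Markov transition kernel `Q` of the state
sequence and a transition density `g` of the observation kernel
`G(x, A) = ∫_A g(x, y) ν(dy)` with respect to a `σ`-finite measure `ν`. -/
structure HMM (𝒳 𝒴 : Type*) [MeasurableSpace 𝒳] [MeasurableSpace 𝒴] where
  /-- transition kernel of the hidden chain -/
  Q : Kernel 𝒳 𝒳
  markov : IsMarkovKernel Q
  /-- reference measure on the observation space -/
  ν : Measure 𝒴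
  sigmaFinite : SigmaFinite ν
  /-- observation density -/
  g : 𝒳 → 𝒴 → ℝ
  measurable_g : Measurable (Function.uncurry g)
  g_nonneg : ∀ x y, 0 ≤ g x y
  lintegral_g : ∀ x, ∫⁻ y, ENNReal.ofReal (g x y) ∂ν = 1

attribute [instance] HMM.markov HMM.sigmaFinite

variable {𝒳 𝒴 Ω : Type*} [MeasurableSpace 𝒳] [MeasurableSpace 𝒴] [MeasurableSpace Ω]

/-- The unnormalized kernel `L⟨y⟩(x, dx') = g(x, y) Q(x, dx')`. -/
def HMM.step (M : HMM 𝒳 𝒴) (y : 𝒴) : Kernel 𝒳 𝒳 :=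
  M.Q.withDensity (fun x _ => ENNReal.ofReal (M.g x y))

/-- The unnormalized kernel `L⟨z₀, …, z_{n-1}⟩`,
`L⟨z⟩(x₀, A) = ∫⋯∫ 1_A(x_n) ∏_{ℓ < n} g(x_ℓ, z_ℓ) Q(x_ℓ, dx_{ℓ+1})`;
for the empty record it is the identity kernel `x ↦ δ_x`. -/
def HMM.L (M : HMM 𝒳 𝒴) : (n : ℕ) → (Fin n → 𝒴) → Kernel 𝒳 𝒳
  | 0, _ => Kernel.id
  | n + 1, z => (M.L n (Fin.tail z)) ∘ₖ (M.step (z 0))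

/-- The record `y_{k:m-1} = (y_k, …, y_{m-1})`, empty if `m ≤ k`. -/
def seg (y : ℕ → 𝒴) (k m : ℕ) : Fin (m - k) → 𝒴 := fun i => y (k + i)

/-- `Lseg y k m = L⟨y_{k:m-1}⟩`. -/
def HMM.Lseg (M : HMM 𝒳 𝒴) (y : ℕ → 𝒴) (k m : ℕ) : Kernel 𝒳 𝒳 := M.L (m - k) (seg y k m)

/-- The function `K f : x ↦ ∫ f(x') K(x, dx')`. -/
def act (K : Kernel 𝒳 𝒳) (f : 𝒳 → ℝ) (x : 𝒳) : ℝ := ∫ x', f x' ∂(K x)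

/-- The predictor `φ_χ⟨y_{0:n-1}⟩ = χ L⟨y_{0:n-1}⟩ / χ L⟨y_{0:n-1}⟩ 1`. -/
def HMM.pred (M : HMM 𝒳 𝒴) (χ : Measure 𝒳) (y : ℕ → 𝒴) (n : ℕ) : Measure 𝒳 :=
  (χ.bind (M.Lseg y 0 n) Set.univ)⁻¹ • χ.bind (M.Lseg y 0 n)

/-- The updating transformation `μ ↦ g(·, y) μ / μ g(·, y)`. -/
def HMM.update (M : HMM 𝒳 𝒴) (y : 𝒴) (μ : Measure 𝒳) : Measure 𝒳 :=
  (∫⁻ x, ENNReal.ofReal (M.g x y) ∂μ)⁻¹ • μ.withDensity (fun x => ENNReal.ofReal (M.g x y))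

/-- The filter distribution given the observations `y_{0:n}`. -/
def HMM.filt (M : HMM 𝒳 𝒴) (χ : Measure 𝒳) (y : ℕ → 𝒴) (n : ℕ) : Measure 𝒳 :=
  M.update (y n) (M.pred χ y n)

/-- The asymptotic variance `σ²_χ⟨y_{0:n-1}⟩(h)` of the bootstrap particle predictor. -/
def HMM.predVar (M : HMM 𝒳 𝒴) (χ : Measure 𝒳) (y : ℕ → 𝒴) (n : ℕ) (h : 𝒳 → ℝ) : ℝ :=
  ∑ k ∈ Finset.range (n + 1),
    ∫ x, ((act (M.Lseg y k n) h x
            - (∫ x', h x' ∂(M.pred χ y n)) * act (M.Lseg y k n) (fun _ => 1) x)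
          / ∫ x', act (M.Lseg y k n) (fun _ => 1) x' ∂(M.pred χ y k)) ^ 2 ∂(M.pred χ y k)

/-- The asymptotic variance `σ̃²_χ⟨y_{0:n}⟩(h)` of the bootstrap particle filter. -/
def HMM.filtVar (M : HMM 𝒳 𝒴) (χ : Measure 𝒳) (y : ℕ → 𝒴) (n : ℕ) (h : 𝒳 → ℝ) : ℝ :=
  M.predVar χ y n (fun x => M.g x (y n) * (h x - ∫ x', h x' ∂(M.filt χ y n)))
    / (∫ x, M.g x (y n) ∂(M.pred χ y n)) ^ 2

/-- `C` is an `r`-local Doeblin set, with lower and upper functions `εl` and `εu`. -/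
def HMM.IsLocalDoeblinWith (M : HMM 𝒳 𝒴) (r : ℕ) (C : Set 𝒳) (εl εu : (Fin r → 𝒴) → ℝ) : Prop :=
  MeasurableSet C ∧ (∀ z, 0 < εl z) ∧ (∀ z, 0 < εu z) ∧
    ∃ (lam : (Fin r → 𝒴) → Measure 𝒳) (φ : (Fin r → 𝒴) → 𝒳 → ℝ),
      (∀ z, IsProbabilityMeasure (lam z)) ∧ (∀ z x, 0 < φ z x) ∧ (∀ z, lam z C = 1) ∧
      ∀ (z : Fin r → 𝒴) (A : Set 𝒳), MeasurableSet A → ∀ x ∈ C,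
        ENNReal.ofReal (εl z * φ z x) * lam z A ≤ M.L r z x (A ∩ C) ∧
        M.L r z x (A ∩ C) ≤ ENNReal.ofReal (εu z * φ z x) * lam z A

/-- `ln⁺ a = max(ln a, 0)`, with `ln⁺ ∞ = ∞`. -/
def lnPos (a : ℝ≥0∞) : ℝ≥0∞ := (ENNReal.log a).toENNReal

/-- `ln⁻ a = max(-ln a, 0)`, with `ln⁻ 0 = ∞`. -/
def lnNeg (a : ℝ≥0∞) : ℝ≥0∞ := (-ENNReal.log a).toENNReal

/-- `f` is `μ`-almost everywhere measurable and `∫ f dμ < ∞`. -/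
def FiniteMean {α : Type*} [MeasurableSpace α] (μ : Measure α) (f : α → ℝ≥0∞) : Prop :=
  AEMeasurable f μ ∧ ∫⁻ a, f a ∂μ < ∞

/-- A process is strictly stationary and ergodic: the shift preserves the law of the process
and is ergodic under this law. -/
def IsStationaryErgodic {α : Type*} [MeasurableSpace α] (P : Measure Ω) (U : ℕ → Ω → α) : Prop :=
  Ergodic (fun (u : ℕ → α) (n : ℕ) => u (n + 1)) (P.map (fun ω n => U n ω))

/-- The blocks `Z_n = Y_{nr:(n+1)r-1}`. -/
def blockProc (Y : ℕ → Ω → 𝒴) (r : ℕ) (n : ℕ) (ω : Ω) : Fin r → 𝒴 := fun i => Y (n * r + i) ω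

/-- The law of `Y_{0:ℓ-1}`. -/
def initLaw (P : Measure Ω) (Y : ℕ → Ω → 𝒴) (ℓ : ℕ) : Measure (Fin ℓ → 𝒴) :=
  P.map (fun ω (i : Fin ℓ) => Y i ω)

/-- Assumption (A1), with its integer `r ≥ 1` and its set `D`. -/
def HMM.A1 (M : HMM 𝒳 𝒴) (P : Measure Ω) (Y : ℕ → Ω → 𝒴) (r : ℕ) (D : Set 𝒳) : Prop :=
  IsStationaryErgodic P Y ∧ 1 ≤ r ∧
  ∃ K : Set (Fin r → 𝒴), MeasurableSet K ∧
    -- (i)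
    (IsStationaryErgodic P (blockProc Y r) ∧ 2 / 3 < P {ω | blockProc Y r 0 ω ∈ K}) ∧
    -- (ii)
    (∀ η : ℝ, 0 < η → ∃ (C : Set 𝒳) (εl εu : (Fin r → 𝒴) → ℝ),
      M.IsLocalDoeblinWith r C εl εu ∧
      (∀ z ∈ K,
        (⨆ x ∈ Cᶜ, M.L r z x Set.univ) ≤ ENNReal.ofReal η * (⨆ x, M.L r z x Set.univ) ∧
        (⨆ x, M.L r z x Set.univ) < ∞) ∧
      0 < ⨅ z ∈ K, ENNReal.ofReal (εl z / εu z)) ∧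
    -- (iii)
    (MeasurableSet D ∧ FiniteMean (initLaw P Y r) (fun z => lnNeg (⨅ x ∈ D, M.L r z x D)))

/-- Assumption (A2). -/
def HMM.A2 (M : HMM 𝒳 𝒴) (P : Measure Ω) (Y : ℕ → Ω → 𝒴) : Prop :=
  (∀ x y, 0 < M.g x y) ∧
  FiniteMean (P.map (Y 0)) (fun y => lnPos (⨆ x, ENNReal.ofReal (M.g x y)))

/-- The class `ℳ(D, r)` of initial distributions `χ` with `E[ln⁻ χ L⟨Y_{0:ℓ-1}⟩ 1_D] < ∞` for all
`ℓ ∈ {0, …, r}`. -/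
def HMM.initClass (M : HMM 𝒳 𝒴) (P : Measure Ω) (Y : ℕ → Ω → 𝒴) (D : Set 𝒳) (r : ℕ) :
    Set (Measure 𝒳) :=
  {χ | IsProbabilityMeasure χ ∧
    ∀ ℓ ≤ r, FiniteMean (initLaw P Y ℓ) (fun z => lnNeg (χ.bind (M.L ℓ z) D))}

/-- A family of real random variables is tight: for every `ε > 0` there is a compact interval
`[-a, a]` such that every one of their laws gives its complement mass at most `ε`. -/
def IsTightFamily {ι : Type*} (P : Measure Ω) (V : ι → Ω → ℝ) : Prop :=
  (∀ i, AEMeasurable (V i) P) ∧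
  ∀ ε : ℝ, 0 < ε → ∃ a : ℝ, ∀ i, (P.map (V i)) (Set.Icc (-a) a)ᶜ ≤ ENNReal.ofReal ε

end ParticleFilter

end

/-! Fix the observations and a bound B of |h|. The variance only sees h minus its filter mean, so h
may be replaced by the nonnegative function h + B. Put u = L⟨y_{k:n-1}⟩(g_{y_n}(h + B)), v =
L⟨y_{k:n-1}⟩ g_{y_n} = L⟨y_{k:n}⟩ 1, and let φ be the predictor at time k. The summand of index k is
the φ-mean of ((u - (φu/φv) v)/φv)². If u(x)v(x') ≤ u(x')v(x) + α v(x)v(x') + β for all x, x',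
integrating one variable against φ bounds the summand by (α sup v/φv + β/(φv)²)²
(`HMM.varTerm_le_sq`). It remains to make this geometrically small in n - k.

Forgetting is gained over pairs of consecutive blocks of length r. If both blocks lie in K, then on
C × C the comparison with λ contracts α by 1 - e², and a point off C costs a factor η = θ² in mass
(`PairBound.app_app_of_doeblin`). After m such good pairs, for every p, the bound holds with α of
order (1 - e²)^p and β of order (2θ)^m θ^{-p} times squared masses (`HMM.Record.pairBound`); p = m/2
is used. Masses are controlled by exponentials of sums of a stationary sequence a_i with mean c.

The difficulty is that e depends on C, hence on η: the rate of (1 - e²)^{m/2} may be tiny compared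
to c, so the crude exponential bound of sup v/φv is useless. But sup v/φv ≤ X R with X = 1/φ(D) and
R = sup v/inf_D v, and both X and R obey affine recursions over pairs of blocks
(`HMM.Record.upred_step`, `HMM.Record.ratioBound_step`) whose slope on a good pair is 2η times a
power of the masses. For η small compared to c these recursions contract on average, so X and R are
at most a constant times exp(O(ε(n-k) + b)) with ε as small as desired. The factor 1/φv may be
exponentially large, but it meets only β, whose rate is set by θ. The order of choices is therefore:
c, then η, then C and e, then ε, then b.

The random input is that sums of a and numbers of blocks outside K, over windows inside [j, n),
deviate from their means by at most ε(n-j) + b with probability close to one, with b independent of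
n (`exists_window_sum_bound`). An integrable function is its mean plus a bounded coboundary plus an
error small in L¹; the coboundary telescopes and the error is handled by a maximal inequality. As
fewer than a third of the blocks are bad on average, about a third of the pairs at least are good.
On this event a single constant bounds all the variances (`exists_forall_filtVar_le`), which is
tightness. -/

noncomputable section

namespace ParticleFilter

/-! ### Ergodic sums over windows with a fixed right end -/

section Ergodic

set_option linter.unusedSectionVars false

variable {α : Type*} [MeasurableSpace α] {μ : Measure α} {T : α → α}

/-- The largest sum of `w` along the orbit over a window `[j, n)`, the empty one included. -/
def windowMax (T : α → α) (w : α → ℝ) : ℕ → α → ℝ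
  | 0, _ => 0
  | n + 1, u => max 0 (windowMax T w n u + w (T^[n] u))

lemma windowMax_nonneg (w : α → ℝ) (n : ℕ) (u : α) : 0 ≤ windowMax T w n u := by
  cases n with
  | zero => exact le_rfl
  | succ n => exact le_max_left _ _

lemma sum_Ico_le_windowMax (w : α → ℝ) (u : α) (n j : ℕ) :
    ∑ i ∈ Finset.Ico j n, w (T^[i] u) ≤ windowMax T w n u := by
  induction n with
  | zero => simp [windowMax]
  | succ n ih =>
    rcases le_or_gt j n with h | h
    · rw [Finset.sum_Ico_succ_top h]
      exact le_max_of_le_right (by linarith)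
    · rw [Finset.Ico_eq_empty (by omega)]
      simpa using windowMax_nonneg w (n + 1) u

/-- A window [j, n) of the orbit of `T u` is the window [j+1, n+1) of the orbit of `u`, so the
right-hand side is a maximum over more windows. -/
lemma windowMax_comp_le (w : α → ℝ) (n : ℕ) (u : α) :
    windowMax T w n (T u) ≤ windowMax T w (n + 1) u := by
  induction n with
  | zero => simp [windowMax]
  | succ n ih =>
    have : w (T^[n] (T u)) = w (T^[n + 1] u) := by rw [Function.iterate_succ_apply]
    rw [windowMax, windowMax, this]
    gcongr

lemma measurable_windowMax (hT : Measurable T) {w : α → ℝ} (hw : Measurable w) (n : ℕ) :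
    Measurable (windowMax T w n) := by
  induction n with
  | zero => exact measurable_const
  | succ n ih => exact measurable_const.max (ih.add (hw.comp (hT.iterate n)))

lemma integrable_windowMax (hT : MeasurePreserving T μ μ) {w : α → ℝ} (hw : Integrable w μ)
    (n : ℕ) : Integrable (windowMax T w n) μ := by
  induction n with
  | zero => exact integrable_zero _ _ _
  | succ n ih =>
    exact (integrable_zero α ℝ μ).sup (ih.add ((hT.iterate n).integrable_comp_of_integrable hw))

/-- A maximal ergodic inequality for windows with a fixed right end. -/
lemma measure_window_sum_gt_le [IsProbabilityMeasure μ] (hT : MeasurePreserving T μ μ) {e : α → ℝ}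
    (hem : Measurable e) (he : Integrable e μ) (he0 : ∀ u, 0 ≤ e u) {l : ℝ} (hl : 0 < l) (n : ℕ) :
    μ {u | ∃ j ≤ n, l * (n - j : ℝ) < ∑ i ∈ Finset.Ico j n, e (T^[i] u)}
      ≤ ENNReal.ofReal ((∫ u, e u ∂μ) / l) := by
  set w : α → ℝ := fun u => e u - l with hw
  have hwm : Measurable w := hem.sub_const l
  have hwi : Integrable w μ := he.sub (integrable_const l)
  have hsub : {u | ∃ j ≤ n, l * (n - j : ℝ) < ∑ i ∈ Finset.Ico j n, e (T^[i] u)}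
      ⊆ {u | 0 < windowMax T w n u} := by
    rintro u ⟨j, hj, hu⟩
    refine lt_of_lt_of_le ?_ (sum_Ico_le_windowMax w u n j)
    simp only [hw, Finset.sum_sub_distrib, Finset.sum_const, Nat.card_Ico, nsmul_eq_mul]
    rw [Nat.cast_sub hj]
    linarith
  refine (measure_mono hsub).trans ?_
  cases n with
  | zero => simp [windowMax]
  | succ n =>
    set S := {u | 0 < windowMax T w (n + 1) u} with hS
    have hSm : MeasurableSet S :=
      measurableSet_lt measurable_const (measurable_windowMax hT.measurable hwm _)
    have hIn := integrable_windowMax hT hwi n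
    have hIn1 := integrable_windowMax hT hwi (n + 1)
    have hen : Integrable (fun u => e (T^[n] u)) μ :=
      (hT.iterate n).integrable_comp_of_integrable he
    -- By invariance the integral of the window maximum does not decrease with n.
    have h1 : ∫ u, windowMax T w n u ∂μ ≤ ∫ u, windowMax T w (n + 1) u ∂μ := by
      have : ∫ u, windowMax T w n (T u) ∂μ = ∫ u, windowMax T w n u ∂μ := by
        have := integral_map (μ := μ) (φ := T) hT.measurable.aemeasurable
          (f := windowMax T w n)
          (measurable_windowMax hT.measurable hwm n).aestronglyMeasurable
        rw [← this, hT.map_eq]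
      rw [← this]
      exact integral_mono (hT.integrable_comp_of_integrable hIn) hIn1
        (fun u => windowMax_comp_le w n u)
    -- Where the new maximum is positive, its increment is exactly `e (T^[n] u) - l`; elsewhere the
    -- new maximum is 0 and the increment is nonpositive. Integrating gives `l μ(S) ≤ ∫ e`.
    have h2 : ∫ u, windowMax T w (n + 1) u ∂μ - ∫ u, windowMax T w n u ∂μ
        ≤ ∫ u, (e (T^[n] u) - S.indicator (fun _ => l) u) ∂μ := by
      rw [← integral_sub hIn1 hIn]
      refine integral_mono (hIn1.sub hIn) (hen.sub ((integrable_const l).indicator hSm)) fun u => ?_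
      simp only
      by_cases hu : u ∈ S
      · rw [Set.indicator_of_mem hu]
        have hu' : 0 < windowMax T w (n + 1) u := hu
        rw [windowMax] at hu' ⊢
        rcases lt_max_iff.1 hu' with h | h
        · exact absurd h (lt_irrefl _)
        · rw [max_eq_right h.le]
          simp [hw]
      · rw [Set.indicator_of_notMem hu]
        have hu' : windowMax T w (n + 1) u ≤ 0 := not_lt.1 hu
        have := windowMax_nonneg (T := T) w n u
        have := he0 (T^[n] u)
        linarith
    have h3 : ∫ u, e (T^[n] u) ∂μ = ∫ u, e u ∂μ := by
      have := integral_map (μ := μ) (φ := T^[n]) (hT.iterate n).measurable.aemeasurable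
        (f := e) hem.aestronglyMeasurable
      rw [← this, (hT.iterate n).map_eq]
    rw [integral_sub hen ((integrable_const l).indicator hSm), h3, integral_indicator_const _ hSm,
      smul_eq_mul] at h2
    have h4 : μ.real S ≤ (∫ u, e u ∂μ) / l := by
      rw [le_div_iff₀ hl]; linarith
    rw [← ofReal_measureReal]
    exact ENNReal.ofReal_le_ofReal h4

lemma sum_Ico_coboundary (g : α → ℝ) (u : α) {j n : ℕ} (h : j ≤ n) :
    ∑ i ∈ Finset.Ico j n, (g (T^[i] u) - g (T (T^[i] u))) = g (T^[j] u) - g (T^[n] u) := by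
  induction n, h using Nat.le_induction with
  | base => simp
  | succ n hn ih =>
    rw [Finset.sum_Ico_succ_top hn, ih, ← Function.iterate_succ_apply' T n u]
    ring

/-- For an ergodic map a bounded function is, up to an error that is small in `L¹`, its mean plus
a coboundary of a bounded function. -/
lemma exists_coboundary_approx_of_bounded [IsProbabilityMeasure μ] (hT : Ergodic T μ) {f : α → ℝ}
    (hf : Measurable f) {B : ℝ} (hB : ∀ u, |f u| ≤ B) {δ : ℝ} (hδ : 0 < δ) :
    ∃ g : α → ℝ, Measurable g ∧ (∃ B', ∀ u, |g u| ≤ B') ∧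
      ∫ u, |f u - ∫ v, f v ∂μ - (g u - g (T u))| ∂μ ≤ δ := by
  have hTp := hT.toMeasurePreserving
  have hmem : MemLp f 2 μ := MemLp.of_bound hf.aestronglyMeasurable B (.of_forall hB)
  set U : Lp ℝ 2 μ →L[ℝ] Lp ℝ 2 μ :=
    (Lp.compMeasurePreservingₗᵢ ℝ T hTp).toContinuousLinearMap with hU
  have hU1 : ‖U‖ ≤ 1 := LinearIsometry.norm_toContinuousLinearMap_le _
  set F : Lp ℝ 2 μ := hmem.toLp f
  -- Mean ergodic theorem in L². The limit is a fixed vector, hence constant by ergodicity, and L²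
  -- closeness gives L¹ closeness on a probability space.
  have hlim := U.tendsto_birkhoffAverage_orthogonalProjection hU1 F
  set p : Lp ℝ 2 μ :=
    ((U.eqLocus (1 : Lp ℝ 2 μ →L[ℝ] Lp ℝ 2 μ)).orthogonalProjectionOnto F : Lp ℝ 2 μ)
    with hp
  have hpfix : Lp.compMeasurePreserving T hTp p = p :=
    ((U.eqLocus (1 : Lp ℝ 2 μ →L[ℝ] Lp ℝ 2 μ)).orthogonalProjectionOnto F).2
  have hiter : ∀ i, (U^[i] F : α → ℝ) =ᵐ[μ] fun u => f (T^[i] u) := by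
    intro i
    have h1 : U^[i] F = Lp.compMeasurePreserving T^[i] (hTp.iterate i) F := by
      have := Lp.compMeasurePreserving_iterate (E := ℝ) (p := 2) hTp i
      rw [← this]; rfl
    rw [h1]
    refine (Lp.coeFn_compMeasurePreserving F (hTp.iterate i)).trans ?_
    exact (hTp.iterate i).quasiMeasurePreserving.ae_eq_comp hmem.coeFn_toLp
  have hpc : ∃ c : ℝ, p =ᵐ[μ] Function.const α c := by
    refine hT.ae_eq_const_of_ae_eq_comp_ae (Lp.aestronglyMeasurable p) ?_
    have := Lp.coeFn_compMeasurePreserving p hTp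
    rw [hpfix] at this
    exact this.symm
  obtain ⟨c, hc⟩ := hpc
  obtain ⟨N, hN1, hN⟩ : ∃ N : ℕ, 1 ≤ N ∧ dist (birkhoffAverage ℝ U _root_.id N F) p < δ / 2 := by
    have h1 := (Metric.tendsto_nhds.1 hlim (δ / 2) (half_pos hδ))
    exact ((Filter.eventually_ge_atTop 1).and h1).exists
  have hN0 : (N : ℝ) ≠ 0 := by positivity
  set A : α → ℝ := fun u => (N : ℝ)⁻¹ * ∑ i ∈ Finset.range N, f (T^[i] u) with hA
  have hfi : ∀ i, Integrable (fun u => f (T^[i] u)) μ := fun i =>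
    (hTp.iterate i).integrable_comp_of_integrable (hmem.integrable (by norm_num))
  have hAi : Integrable A μ := (integrable_finsetSum _ fun i _ => hfi i).const_mul _
  have hsum : ∀ m, ⇑(birkhoffSum U _root_.id m F : Lp ℝ 2 μ)
      =ᵐ[μ] fun u => ∑ i ∈ Finset.range m, f (T^[i] u) := by
    intro m
    induction m with
    | zero =>
      simp only [birkhoffSum_zero, Finset.range_zero, Finset.sum_empty]
      exact Lp.coeFn_zero ℝ 2 μ
    | succ m ih =>
      rw [birkhoffSum_succ]
      filter_upwards [Lp.coeFn_add (birkhoffSum U _root_.id m F) (U^[m] F), ih, hiter m]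
        with u h1 h2 h3
      rw [Finset.sum_range_succ, ← h2, ← h3]
      exact h1
  have hAp : (birkhoffAverage ℝ U _root_.id N F - p : Lp ℝ 2 μ) =ᵐ[μ] fun u => A u - c := by
    filter_upwards [Lp.coeFn_sub (birkhoffAverage ℝ U _root_.id N F) p, hsum N, hc,
      Lp.coeFn_smul (N : ℝ)⁻¹ (birkhoffSum U _root_.id N F)] with u h1 h2 h3 h4
    rw [h1, Pi.sub_apply, h3, birkhoffAverage, h4, Pi.smul_apply, h2]
    rfl
  have hL1 : ∫ u, |A u - c| ∂μ ≤ δ / 2 := by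
    have h1 : eLpNorm (fun u => A u - c) 1 μ ≤ ENNReal.ofReal (δ / 2) := by
      rw [← eLpNorm_congr_ae hAp]
      refine (eLpNorm_le_eLpNorm_of_exponent_le (q := 2) (by norm_num)
        (Lp.aestronglyMeasurable _)).trans ?_
      rw [← Lp.enorm_def, ← ofReal_norm, ← dist_eq_norm]
      exact ENNReal.ofReal_le_ofReal hN.le
    have h2 : ∫ u, |A u - c| ∂μ = (eLpNorm (fun u => A u - c) 1 μ).toReal := by
      rw [eLpNorm_one_eq_lintegral_enorm]
      exact integral_norm_eq_lintegral_enorm (hAi.sub (integrable_const c)).aestronglyMeasurable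
    rw [h2]
    exact ENNReal.toReal_le_of_le_ofReal (by positivity) h1
  have hmean : ∫ u, A u ∂μ = ∫ u, f u ∂μ := by
    have h3 : ∀ i, ∫ u, f (T^[i] u) ∂μ = ∫ u, f u ∂μ := by
      intro i
      have := integral_map (μ := μ) (φ := T^[i]) (hTp.iterate i).measurable.aemeasurable
        (f := f) hf.aestronglyMeasurable
      rw [← this, (hTp.iterate i).map_eq]
    rw [hA, integral_const_mul, integral_finsetSum _ fun i _ => hfi i]
    simp [h3, hN0]
  have hcmean : |∫ u, f u ∂μ - c| ≤ δ / 2 := by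
    have h1 : ∫ u, f u ∂μ - c = ∫ u, (A u - c) ∂μ := by
      rw [integral_sub hAi (integrable_const c), hmean]; simp
    rw [h1]
    exact (abs_integral_le_integral_abs).trans hL1
  -- With S_i the i-th Birkhoff sum, S_i - S_i ∘ T = f - f ∘ T^i. Averaging over i < N shows that f
  -- minus its Birkhoff average is the coboundary of this g.
  refine ⟨fun u => (N : ℝ)⁻¹ * ∑ i ∈ Finset.range N, ∑ l ∈ Finset.range i, f (T^[l] u), ?_, ?_, ?_⟩
  · exact (Finset.measurable_fun_sum _ fun i _ => Finset.measurable_fun_sum _ fun l _ =>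
      hf.comp (hTp.measurable.iterate l)).const_mul _
  · refine ⟨(N : ℝ)⁻¹ * ∑ i ∈ Finset.range N, ∑ l ∈ Finset.range i, B, fun u => ?_⟩
    rw [abs_mul, abs_of_nonneg (by positivity)]
    gcongr
    refine (Finset.abs_sum_le_sum_abs _ _).trans (Finset.sum_le_sum fun i _ => ?_)
    exact (Finset.abs_sum_le_sum_abs _ _).trans (Finset.sum_le_sum fun l _ => hB _)
  · have hcob : ∀ u, f u - ∫ v, f v ∂μ - ((N : ℝ)⁻¹ * ∑ i ∈ Finset.range N,
        ∑ l ∈ Finset.range i, f (T^[l] u) - (N : ℝ)⁻¹ * ∑ i ∈ Finset.range N,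
        ∑ l ∈ Finset.range i, f (T^[l] (T u))) = (A u - c) - (∫ v, f v ∂μ - c) := by
      intro u
      have h1 : ∀ i, ∑ l ∈ Finset.range i, f (T^[l] u) - ∑ l ∈ Finset.range i, f (T^[l] (T u))
          = f u - f (T^[i] u) := by
        intro i
        induction i with
        | zero => simp
        | succ i ih =>
          rw [Finset.sum_range_succ, Finset.sum_range_succ, Function.iterate_succ_apply]
          linarith
      rw [← mul_sub, ← Finset.sum_sub_distrib, Finset.sum_congr rfl fun i _ => h1 i,
        Finset.sum_sub_distrib]
      simp only [Finset.sum_const, Finset.card_range, nsmul_eq_mul, mul_sub, hA]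
      rw [inv_mul_cancel_left₀ hN0]
      ring
    simp only [hcob]
    calc ∫ u, |(A u - c) - (∫ v, f v ∂μ - c)| ∂μ
        ≤ ∫ u, (|A u - c| + |∫ v, f v ∂μ - c|) ∂μ := by
          refine integral_mono ?_ ?_ fun u => abs_sub _ _
          · exact ((hAi.sub (integrable_const c)).sub (integrable_const _)).abs
          · exact (hAi.sub (integrable_const c)).abs.add (integrable_const _)
      _ = ∫ u, |A u - c| ∂μ + |∫ v, f v ∂μ - c| := by
          rw [integral_add (by exact (hAi.sub (integrable_const c)).abs) (integrable_const _)]; simp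
      _ ≤ δ := by linarith

/-- For an ergodic map an integrable function is, up to an error that is small in `L¹`, its mean
plus a coboundary of a bounded function. -/
lemma exists_coboundary_approx [IsProbabilityMeasure μ] (hT : Ergodic T μ) {f : α → ℝ}
    (hfi : Integrable f μ) {δ : ℝ} (hδ : 0 < δ) :
    ∃ g : α → ℝ, Measurable g ∧ (∃ B', ∀ u, |g u| ≤ B') ∧
      ∫ u, |f u - ∫ v, f v ∂μ - (g u - g (T u))| ∂μ ≤ δ := by
  -- A third of δ each goes to replacing f by a simple function, to the resulting change of the
  -- mean, and to the bounded case.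
  obtain ⟨f₁, hf₁, hf₁m⟩ := (memLp_one_iff_integrable.2 hfi).exists_simpleFunc_eLpNorm_sub_lt
    (by norm_num) (ε := ENNReal.ofReal (δ / 3)) (by simpa using hδ)
  obtain ⟨B, hB⟩ : ∃ B, ∀ u, |f₁ u| ≤ B := by
    obtain ⟨B, hB⟩ := (f₁.finite_range.image (fun x : ℝ => |x|)).bddAbove
    exact ⟨B, fun u => hB ⟨f₁ u, ⟨u, rfl⟩, rfl⟩⟩
  have hf₁i : Integrable f₁ μ := memLp_one_iff_integrable.1 hf₁m
  obtain ⟨g, hg, ⟨B', hB'⟩, hgδ⟩ := exists_coboundary_approx_of_bounded hT f₁.measurable hB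
    (show 0 < δ / 3 by positivity)
  refine ⟨g, hg, ⟨B', hB'⟩, ?_⟩
  have hgi : Integrable g μ := Integrable.of_bound hg.aestronglyMeasurable B' (.of_forall hB')
  have hgT : Integrable (fun u => g (T u)) μ :=
    hT.toMeasurePreserving.integrable_comp_of_integrable hgi
  have h1 : ∫ u, |f u - f₁ u| ∂μ ≤ δ / 3 := by
    have h2 : ∫ u, |f u - f₁ u| ∂μ = (eLpNorm (fun u => f u - f₁ u) 1 μ).toReal := by
      rw [eLpNorm_one_eq_lintegral_enorm]
      exact integral_norm_eq_lintegral_enorm (hfi.sub hf₁i).aestronglyMeasurable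
    rw [h2]
    exact ENNReal.toReal_le_of_le_ofReal (by positivity) hf₁.le
  have h2 : |∫ u, f u ∂μ - ∫ u, f₁ u ∂μ| ≤ δ / 3 := by
    rw [← integral_sub hfi hf₁i]
    exact abs_integral_le_integral_abs.trans h1
  have hi₁ : Integrable (fun u => |f u - f₁ u|) μ := (hfi.sub hf₁i).abs
  have hi₂ : Integrable (fun u => |f₁ u - ∫ v, f₁ v ∂μ - (g u - g (T u))|) μ :=
    ((hf₁i.sub (integrable_const _)).sub (hgi.sub hgT)).abs
  calc ∫ u, |f u - ∫ v, f v ∂μ - (g u - g (T u))| ∂μ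
      ≤ ∫ u, (|f u - f₁ u| + |f₁ u - ∫ v, f₁ v ∂μ - (g u - g (T u))|
          + |∫ u, f u ∂μ - ∫ u, f₁ u ∂μ|) ∂μ := by
        refine integral_mono ?_ ((hi₁.add hi₂).add (integrable_const _)) fun u => ?_
        · exact ((hfi.sub (integrable_const _)).sub (hgi.sub hgT)).abs
        · have e : f u - ∫ v, f v ∂μ - (g u - g (T u)) = (f u - f₁ u)
            + (f₁ u - ∫ v, f₁ v ∂μ - (g u - g (T u))) - (∫ u, f u ∂μ - ∫ u, f₁ u ∂μ) := by ring
          simp only [e]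
          exact (abs_sub _ _).trans (add_le_add_left (abs_add_le _ _) _)
    _ = ∫ u, |f u - f₁ u| ∂μ + ∫ u, |f₁ u - ∫ v, f₁ v ∂μ - (g u - g (T u))| ∂μ
          + |∫ u, f u ∂μ - ∫ u, f₁ u ∂μ| := by
        rw [integral_add (by exact hi₁.add hi₂) (integrable_const _), integral_add hi₁ hi₂]; simp
    _ ≤ δ := by linarith

/-- The ergodic theorem for windows with a fixed right end, with a bound uniform in that end. -/
theorem exists_window_sum_bound [IsProbabilityMeasure μ] (hT : Ergodic T μ) {f : α → ℝ}
    (hf : Integrable f μ) {ε θ : ℝ} (hε : 0 < ε) (hθ : 0 < θ) :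
    ∃ b : ℝ, ∀ n : ℕ, μ {u | ¬ ∀ j ≤ n,
      |∑ i ∈ Finset.Ico j n, f (T^[i] u) - (n - j) * ∫ v, f v ∂μ| ≤ ε * (n - j) + b}
      ≤ ENNReal.ofReal θ := by
  wlog hfm : Measurable f generalizing f
  · obtain ⟨b, hb⟩ := this (hf.congr hf.1.ae_eq_mk) hf.1.measurable_mk
    have h1 : ∀ᵐ u ∂μ, ∀ i, f (T^[i] u) = hf.1.mk f (T^[i] u) :=
      ae_all_iff.2 fun i =>
        (hT.toMeasurePreserving.iterate i).quasiMeasurePreserving.ae_eq_comp hf.1.ae_eq_mk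
    have h2 := integral_congr_ae hf.1.ae_eq_mk
    refine ⟨b, fun n => (measure_mono fun u hu => ?_).trans
      ((measure_union_le _ _).trans (add_le_of_le_of_nonpos (hb n) (ae_iff.1 h1).le))⟩
    by_cases hu' : ∀ i, f (T^[i] u) = hf.1.mk f (T^[i] u)
    · left
      simpa only [Set.mem_ofPred_eq, hu', h2] using hu
    · exact Or.inr hu'
  -- An L¹ error εθ makes the maximal inequality at level ε produce the probability θ. The
  -- telescoped coboundary contributes at most 2B', whatever the window.
  obtain ⟨g, hg, ⟨B', hB'⟩, hgδ⟩ := exists_coboundary_approx hT hf (mul_pos hε hθ)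
  have hgi : Integrable g μ := Integrable.of_bound hg.aestronglyMeasurable B' (.of_forall hB')
  have hgT : Integrable (fun u => g (T u)) μ :=
    hT.toMeasurePreserving.integrable_comp_of_integrable hgi
  set e : α → ℝ := fun u => |f u - ∫ v, f v ∂μ - (g u - g (T u))| with he
  have hem : Measurable e :=
    ((hfm.sub_const _).sub (hg.sub (hg.comp hT.measurable))).abs
  have hei : Integrable e μ := ((hf.sub (integrable_const _)).sub (hgi.sub hgT)).abs
  refine ⟨2 * B', fun n => ?_⟩
  refine (measure_mono ?_).trans ((measure_window_sum_gt_le hT.toMeasurePreserving hem hei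
    (fun u => abs_nonneg _) hε n).trans (ENNReal.ofReal_le_ofReal ?_))
  · intro u hu
    simp only [Set.mem_ofPred_eq, not_forall, not_le] at hu ⊢
    obtain ⟨j, hj, hu⟩ := hu
    refine ⟨j, hj, ?_⟩
    have h1 : ∑ i ∈ Finset.Ico j n, f (T^[i] u) - (n - j) * ∫ v, f v ∂μ
        = ∑ i ∈ Finset.Ico j n, (f (T^[i] u) - ∫ v, f v ∂μ - (g (T^[i] u) - g (T (T^[i] u))))
          + (g (T^[j] u) - g (T^[n] u)) := by
      rw [← sum_Ico_coboundary g u hj, ← Finset.sum_add_distrib]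
      simp [Finset.sum_sub_distrib, Nat.cast_sub hj]
    have h2 : |∑ i ∈ Finset.Ico j n, f (T^[i] u) - (n - j) * ∫ v, f v ∂μ|
        ≤ ∑ i ∈ Finset.Ico j n, e (T^[i] u) + 2 * B' := by
      rw [h1]
      refine (abs_add_le _ _).trans (add_le_add (Finset.abs_sum_le_sum_abs _ _) ?_)
      exact (abs_sub _ _).trans (by linarith [hB' (T^[j] u), hB' (T^[n] u)])
    linarith
  · rw [div_le_iff₀ hε, mul_comm θ ε]
    exact hgδ

end Ergodic

/-! ### The unnormalized kernels acting on functions -/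

section Calculus

variable {𝒳 𝒴 : Type*} [MeasurableSpace 𝒳] [MeasurableSpace 𝒴]

/-- The function `L⟨y_t, …, y_{t+l-1}⟩ F`. -/
def HMM.ev (M : HMM 𝒳 𝒴) (y : ℕ → 𝒴) (t l : ℕ) (F : 𝒳 → ℝ≥0∞) (x : 𝒳) : ℝ≥0∞ :=
  ∫⁻ x', F x' ∂(M.L l (fun i => y (t + i)) x)

lemma HMM.measurable_g_left (M : HMM 𝒳 𝒴) (y : 𝒴) : Measurable fun x => M.g x y :=
  M.measurable_g.comp (measurable_id.prodMk measurable_const)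

lemma HMM.measurable_ofReal_g (M : HMM 𝒳 𝒴) (y : 𝒴) :
    Measurable fun x => ENNReal.ofReal (M.g x y) :=
  (M.measurable_g_left y).ennreal_ofReal

lemma HMM.step_apply (M : HMM 𝒳 𝒴) (y : 𝒴) (x : 𝒳) :
    M.step y x = ENNReal.ofReal (M.g x y) • M.Q x := by
  have h : Measurable (Function.uncurry fun (x : 𝒳) (_ : 𝒳) => ENNReal.ofReal (M.g x y)) :=
    (M.measurable_ofReal_g y).comp measurable_fst
  rw [HMM.step, Kernel.withDensity_apply _ h, withDensity_const]

lemma HMM.measurable_ev (M : HMM 𝒳 𝒴) (y : ℕ → 𝒴) (t l : ℕ) {F : 𝒳 → ℝ≥0∞} (hF : Measurable F) :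
    Measurable (M.ev y t l F) :=
  hF.lintegral_kernel

lemma HMM.ev_zero (M : HMM 𝒳 𝒴) (y : ℕ → 𝒴) (t : ℕ) {F : 𝒳 → ℝ≥0∞} (hF : Measurable F) :
    M.ev y t 0 F = F := by
  ext x
  rw [HMM.ev, HMM.L, Kernel.id_apply, lintegral_dirac' _ hF]

lemma HMM.ev_succ (M : HMM 𝒳 𝒴) (y : ℕ → 𝒴) (t l : ℕ) {F : 𝒳 → ℝ≥0∞} (hF : Measurable F)
    (x : 𝒳) : M.ev y t (l + 1) F x
      = ENNReal.ofReal (M.g x (y t)) * ∫⁻ x', M.ev y (t + 1) l F x' ∂(M.Q x) := by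
  have h : Fin.tail (fun i : Fin (l + 1) => y (t + i)) = fun i : Fin l => y (t + 1 + i) := by
    ext i
    simp only [Fin.tail, Fin.val_succ]
    congr 1
    ring
  rw [HMM.ev, HMM.L, Kernel.lintegral_comp _ _ _ hF, h, M.step_apply, lintegral_smul_measure]
  simp [HMM.ev]

lemma HMM.ev_add (M : HMM 𝒳 𝒴) (y : ℕ → 𝒴) (t a b : ℕ) {F : 𝒳 → ℝ≥0∞} (hF : Measurable F) :
    M.ev y t (a + b) F = M.ev y t a (M.ev y (t + a) b F) := by
  induction a generalizing t with
  | zero => rw [M.ev_zero _ _ (M.measurable_ev _ _ _ hF)]; simp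
  | succ a ih =>
    ext x
    rw [show a + 1 + b = (a + b) + 1 by ring, M.ev_succ _ _ _ hF,
      M.ev_succ _ _ _ (M.measurable_ev _ _ _ hF), ih, show t + 1 + a = t + (a + 1) by ring]

/-- `L⟨y_{t:t+l-1}⟩ g_{y_{t+l}} = L⟨y_{t:t+l}⟩ 1`. -/
lemma HMM.ev_succ_one (M : HMM 𝒳 𝒴) (y : ℕ → 𝒴) (t l : ℕ) :
    M.ev y t (l + 1) 1 = M.ev y t l (fun x => ENNReal.ofReal (M.g x (y (t + l)))) := by
  rw [M.ev_add y t l 1 measurable_one]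
  congr 1
  ext x
  rw [show (1 : ℕ) = 0 + 1 from rfl, M.ev_succ _ _ _ measurable_one, M.ev_zero _ _ measurable_one]
  simp

lemma HMM.ev_mono (M : HMM 𝒳 𝒴) (y : ℕ → 𝒴) (t l : ℕ) {F G : 𝒳 → ℝ≥0∞} (h : ∀ x, F x ≤ G x)
    (x : 𝒳) : M.ev y t l F x ≤ M.ev y t l G x :=
  lintegral_mono h

lemma HMM.ev_const_mul (M : HMM 𝒳 𝒴) (y : ℕ → 𝒴) (t l : ℕ) {F : 𝒳 → ℝ≥0∞} (hF : Measurable F)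
    (c : ℝ≥0∞) (x : 𝒳) : M.ev y t l (fun x => c * F x) x = c * M.ev y t l F x :=
  lintegral_const_mul c hF

lemma HMM.ev_le_of_le (M : HMM 𝒳 𝒴) (y : ℕ → 𝒴) (t l : ℕ) {F : 𝒳 → ℝ≥0∞} {c : ℝ≥0∞}
    (h : ∀ x, F x ≤ c) (x : 𝒳) : M.ev y t l F x ≤ c * M.ev y t l 1 x := by
  rw [← M.ev_const_mul y t l measurable_one]
  exact M.ev_mono y t l (by simpa using h) x

/-- A lower bound for `L⟨y⟩ F` by the part of the mass on a set where `F` is bounded below. -/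
lemma HMM.mul_ev_indicator_le (M : HMM 𝒳 𝒴) (y : ℕ → 𝒴) (t l : ℕ) {F : 𝒳 → ℝ≥0∞} {c : ℝ≥0∞}
    {D : Set 𝒳} (hD : MeasurableSet D) (h : ∀ x ∈ D, c ≤ F x) (x : 𝒳) :
    c * M.ev y t l (D.indicator 1) x ≤ M.ev y t l F x := by
  rw [← M.ev_const_mul y t l (measurable_one.indicator hD)]
  refine M.ev_mono y t l (fun x => ?_) x
  by_cases hx : x ∈ D
  · simpa [hx] using h x hx
  · simp [hx]

lemma HMM.L_apply_eq_ev (M : HMM 𝒳 𝒴) (y : ℕ → 𝒴) (t l : ℕ) {A : Set 𝒳} (hA : MeasurableSet A)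
    (x : 𝒳) : M.L l (fun i => y (t + i)) x A = M.ev y t l (A.indicator 1) x :=
  (lintegral_indicator_one hA).symm

lemma HMM.L_univ_eq_ev (M : HMM 𝒳 𝒴) (y : ℕ → 𝒴) (t l : ℕ) (x : 𝒳) :
    M.L l (fun i => y (t + i)) x Set.univ = M.ev y t l 1 x :=
  lintegral_one.symm

/-- Since Q is Markov, each step multiplies the mass by at most the supremum of the density. -/
lemma HMM.ev_one_le_exp (M : HMM 𝒳 𝒴) {y : ℕ → 𝒴} {G : ℕ → ℝ}
    (hG : ∀ i x, M.g x (y i) ≤ Real.exp (G i)) (t l : ℕ) (x : 𝒳) :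
    M.ev y t l 1 x ≤ ENNReal.ofReal (Real.exp (∑ i ∈ Finset.Ico t (t + l), G i)) := by
  induction l generalizing t x with
  | zero => simp [M.ev_zero _ _ measurable_one]
  | succ l ih =>
    rw [M.ev_succ _ _ _ measurable_one, show t + (l + 1) = t + 1 + l by ring,
      Finset.sum_eq_sum_Ico_succ_bot (show t < t + 1 + l by omega), Real.exp_add,
      ENNReal.ofReal_mul (Real.exp_pos _).le]
    gcongr
    · exact hG t x
    · calc ∫⁻ x', M.ev y (t + 1) l 1 x' ∂(M.Q x)
          ≤ ∫⁻ _, ENNReal.ofReal (Real.exp (∑ i ∈ Finset.Ico (t + 1) (t + 1 + l), G i)) ∂(M.Q x) :=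
            lintegral_mono fun x' => ih (t + 1) x'
        _ = _ := by simp

lemma HMM.ev_pos (M : HMM 𝒳 𝒴) (hg : ∀ x y, 0 < M.g x y) (y : ℕ → 𝒴) (t l : ℕ) {F : 𝒳 → ℝ≥0∞}
    (hF : Measurable F) (hF0 : ∀ x, 0 < F x) (x : 𝒳) : 0 < M.ev y t l F x := by
  induction l generalizing t x with
  | zero => rw [M.ev_zero _ _ hF]; exact hF0 x
  | succ l ih =>
    rw [M.ev_succ _ _ _ hF]
    refine ENNReal.mul_pos (by simpa using hg x (y t)) (ne_of_gt ?_)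
    rw [lintegral_pos_iff_support (M.measurable_ev _ _ _ hF)]
    have : Function.support (M.ev y (t + 1) l F) = Set.univ := by
      ext x'; simpa using (ih (t + 1) x').ne'
    simp [this]

/-- Joint measurability in the observations and the state, by induction on the one-step recursion;
it is what makes the variances random variables. -/
lemma HMM.measurable_ev_prod (M : HMM 𝒳 𝒴) {β : Type*} [MeasurableSpace β] {y : β → ℕ → 𝒴}
    (hy : ∀ i, Measurable fun b => y b i) (t l : ℕ) {F : β × 𝒳 → ℝ≥0∞} (hF : Measurable F) :
    Measurable fun p : β × 𝒳 => M.ev (y p.1) t l (fun x => F (p.1, x)) p.2 := by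
  induction l generalizing t with
  | zero =>
    have : ∀ p : β × 𝒳, M.ev (y p.1) t 0 (fun x => F (p.1, x)) p.2 = F p := fun p =>
      congrFun (M.ev_zero _ _ (F := fun x => F (p.1, x)) (hF.comp measurable_prodMk_left)) _
    simpa only [this] using hF
  | succ l ih =>
    have h1 : ∀ p : β × 𝒳, M.ev (y p.1) t (l + 1) (fun x => F (p.1, x)) p.2
        = ENNReal.ofReal (M.g p.2 (y p.1 t))
          * ∫⁻ x', M.ev (y p.1) (t + 1) l (fun x => F (p.1, x)) x' ∂(M.Q p.2) := fun p =>
      M.ev_succ _ _ _ (F := fun x => F (p.1, x)) (hF.comp measurable_prodMk_left) _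
    simp only [h1]
    refine Measurable.mul ?_ ?_
    · exact (M.measurable_g.comp
        (measurable_snd.prodMk ((hy t).comp measurable_fst))).ennreal_ofReal
    · have := Measurable.lintegral_kernel_prod_right' (κ := M.Q.comap Prod.snd measurable_snd)
        (f := fun q : (β × 𝒳) × 𝒳 => M.ev (y q.1.1) (t + 1) l (fun x => F (q.1.1, x)) q.2)
        ((ih (t + 1)).comp ((measurable_fst.comp measurable_fst).prodMk measurable_snd))
      simpa [Kernel.comap_apply] using this

end Calculus

/-! ### Kernels with a Doeblin condition on a set -/

section Doeblin

set_option linter.unusedSectionVars false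

variable {𝒳 : Type*} [MeasurableSpace 𝒳]

/-- The function `x ↦ ∫ F dκ(x, ·)`. -/
def app (κ : Kernel 𝒳 𝒳) (F : 𝒳 → ℝ≥0∞) (x : 𝒳) : ℝ≥0∞ := ∫⁻ x', F x' ∂(κ x)

lemma measurable_app (κ : Kernel 𝒳 𝒳) {F : 𝒳 → ℝ≥0∞} (hF : Measurable F) :
    Measurable (app κ F) :=
  hF.lintegral_kernel

lemma app_le {κ : Kernel 𝒳 𝒳} {F : 𝒳 → ℝ≥0∞} {c : ℝ≥0∞} (h : ∀ x, F x ≤ c) (x : 𝒳) :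
    app κ F x ≤ κ x Set.univ * c := by
  refine (lintegral_mono h).trans ?_
  rw [lintegral_const, mul_comm]

lemma app_mono {κ : Kernel 𝒳 𝒳} {F G : 𝒳 → ℝ≥0∞} (h : ∀ x, F x ≤ G x) (x : 𝒳) :
    app κ F x ≤ app κ G x :=
  lintegral_mono h

lemma app_const_mul (κ : Kernel 𝒳 𝒳) {F : 𝒳 → ℝ≥0∞} (hF : Measurable F) (c : ℝ≥0∞) (x : 𝒳) :
    app κ (fun x => c * F x) x = c * app κ F x :=
  lintegral_const_mul c hF

/-- On `C`, the restriction of `κ` to `C` is comparable, up to the factor `e`, to multiples of one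
finite measure. -/
def IsDoeblinOn (κ : Kernel 𝒳 𝒳) (C : Set 𝒳) (e : ℝ≥0∞) : Prop :=
  ∃ (lam : Measure 𝒳) (c : 𝒳 → ℝ≥0∞), IsFiniteMeasure lam ∧ (∀ x, c x ≠ ∞) ∧
    ∀ x ∈ C, (e * c x) • lam ≤ (κ x).restrict C ∧ (κ x).restrict C ≤ c x • lam

/-- The masses of `κ` are at most `N`, and at most `η N` off `C`. -/
def IsSmallOff (κ : Kernel 𝒳 𝒳) (C : Set 𝒳) (η N : ℝ≥0∞) : Prop :=
  (∀ x, κ x Set.univ ≤ N) ∧ ∀ x ∉ C, κ x Set.univ ≤ η * N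

/-- Exchange of the test functions `f` and `f'` after two Doeblin steps. -/
lemma app_mul_app_swap_le {κ₀ κ₁ : Kernel 𝒳 𝒳} {C : Set 𝒳} (hC : MeasurableSet C)
    {e η N₀ N₁ : ℝ≥0∞} (he0 : e ≠ 0) (he : e ≠ ∞) (hd : IsDoeblinOn κ₀ C e)
    (h₀ : IsSmallOff κ₀ C η N₀) (h₁ : IsSmallOff κ₁ C η N₁) {f f' : 𝒳 → ℝ≥0∞} {F F' : ℝ≥0∞}
    (hF : ∀ x, f x ≤ F) (hF' : ∀ x, f' x ≤ F') (x y : 𝒳) :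
    app κ₀ (app κ₁ f) x * app κ₀ (app κ₁ f') y
      ≤ (e⁻¹) ^ 2 * (app κ₀ (app κ₁ f') x * app κ₀ (app κ₁ f) y)
        + 2 * η * (N₀ * N₁) ^ 2 * (F * F') := by
  obtain ⟨lam, c, -, -, hlam⟩ := hd
  have hw : ∀ {k : 𝒳 → ℝ≥0∞} {B : ℝ≥0∞}, (∀ x, k x ≤ B) → ∀ a, app κ₁ k a ≤ N₁ * B :=
    fun hk a => (app_le hk a).trans (mul_le_mul_left (h₁.1 a) _)
  have hall : ∀ {k : 𝒳 → ℝ≥0∞} {B : ℝ≥0∞}, (∀ x, k x ≤ B) → ∀ a,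
      app κ₀ (app κ₁ k) a ≤ N₀ * N₁ * B := fun hk a => by
    rw [mul_assoc]
    exact (app_le (hw hk) a).trans (mul_le_mul_left (h₀.1 a) _)
  have hoff : ∀ {k : 𝒳 → ℝ≥0∞} {B : ℝ≥0∞}, (∀ x, k x ≤ B) → ∀ a ∉ C,
      app κ₀ (app κ₁ k) a ≤ η * (N₀ * N₁ * B) := fun hk a ha => by
    refine (app_le (hw hk) a).trans ((mul_le_mul_left (h₀.2 a ha) _).trans (le_of_eq (by ring)))
  -- A starting point off C gives the factor η through κ₀. From a point of C the chain may still
  -- leave C under κ₀ with a mass that is not small; then κ₁ supplies η. This is why two steps are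
  -- taken.
  by_cases hx : x ∈ C
  swap
  · calc _ ≤ (η * (N₀ * N₁ * F)) * (N₀ * N₁ * F') := mul_le_mul' (hoff hF x hx) (hall hF' y)
      _ = η * (N₀ * N₁) ^ 2 * (F * F') := by ring
      _ ≤ η * (N₀ * N₁) ^ 2 * (F * F') + η * (N₀ * N₁) ^ 2 * (F * F') := le_self_add
      _ = 2 * η * (N₀ * N₁) ^ 2 * (F * F') := by ring
      _ ≤ _ := le_add_self
  by_cases hy : y ∈ C
  swap
  · calc _ ≤ (N₀ * N₁ * F) * (η * (N₀ * N₁ * F')) := mul_le_mul' (hall hF x) (hoff hF' y hy)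
      _ = η * (N₀ * N₁) ^ 2 * (F * F') := by ring
      _ ≤ η * (N₀ * N₁) ^ 2 * (F * F') + η * (N₀ * N₁) ^ 2 * (F * F') := le_self_add
      _ = 2 * η * (N₀ * N₁) ^ 2 * (F * F') := by ring
      _ ≤ _ := le_add_self
  have hsplit : ∀ (k : 𝒳 → ℝ≥0∞) (a : 𝒳), app κ₀ k a = ∫⁻ b in C, k b ∂(κ₀ a)
      + ∫⁻ b in Cᶜ, k b ∂(κ₀ a) := fun k a => (lintegral_add_compl _ hC).symm
  have hcompl : ∀ {k : 𝒳 → ℝ≥0∞} {B : ℝ≥0∞}, (∀ x, k x ≤ B) → ∀ a,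
      ∫⁻ b in Cᶜ, app κ₁ k b ∂(κ₀ a) ≤ η * (N₀ * N₁ * B) := fun {k B} hk a => by
    calc ∫⁻ b in Cᶜ, app κ₁ k b ∂(κ₀ a) ≤ ∫⁻ _ in Cᶜ, η * N₁ * B ∂(κ₀ a) :=
          setLIntegral_mono measurable_const fun b hb =>
            (app_le hk b).trans (mul_le_mul_left (h₁.2 b hb) _)
      _ = η * N₁ * B * κ₀ a Cᶜ := by rw [setLIntegral_const]
      _ ≤ η * N₁ * B * N₀ := by
          gcongr
          exact (measure_mono (Set.subset_univ _)).trans (h₀.1 a)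
      _ = η * (N₀ * N₁ * B) := by ring
  have hup : ∀ (k : 𝒳 → ℝ≥0∞), ∀ a ∈ C, ∫⁻ b in C, k b ∂(κ₀ a) ≤ c a * ∫⁻ b, k b ∂lam :=
    fun k a ha => (lintegral_mono' (hlam a ha).2 le_rfl).trans_eq (lintegral_smul_measure _ _)
  have hlow : ∀ (k : 𝒳 → ℝ≥0∞), ∀ a ∈ C, e * c a * ∫⁻ b, k b ∂lam ≤ app κ₀ k a := fun k a ha => by
    refine le_trans ?_ (setLIntegral_le_lintegral C k)
    have := lintegral_mono' (hlam a ha).1 (le_refl k)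
    rwa [lintegral_smul_measure] at this
  set w := app κ₁ f
  set w' := app κ₁ f'
  have hee : e⁻¹ * e = 1 := ENNReal.inv_mul_cancel he0 he
  -- On C × C both restricted measures are comparable to multiples of the same λ, so the two test
  -- functions can be exchanged at the cost of one factor e⁻¹ for each point.
  have hmain : (∫⁻ b in C, w b ∂(κ₀ x)) * (∫⁻ b in C, w' b ∂(κ₀ y))
      ≤ (e⁻¹) ^ 2 * (app κ₀ w' x * app κ₀ w y) := by
    calc (∫⁻ b in C, w b ∂(κ₀ x)) * (∫⁻ b in C, w' b ∂(κ₀ y))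
        ≤ (c x * ∫⁻ b, w b ∂lam) * (c y * ∫⁻ b, w' b ∂lam) := mul_le_mul' (hup w x hx) (hup w' y hy)
      _ = (e⁻¹ * e) ^ 2 * ((c x * ∫⁻ b, w b ∂lam) * (c y * ∫⁻ b, w' b ∂lam)) := by
          rw [hee, one_pow, one_mul]
      _ = (e⁻¹) ^ 2 * ((e * c x * ∫⁻ b, w' b ∂lam) * (e * c y * ∫⁻ b, w b ∂lam)) := by ring
      _ ≤ _ := by
          gcongr
          · exact hlow w' x hx
          · exact hlow w y hy
  have hx' : ∫⁻ b in C, w b ∂(κ₀ x) ≤ N₀ * N₁ * F :=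
    (setLIntegral_le_lintegral C w).trans (hall hF x)
  calc app κ₀ w x * app κ₀ w' y
      = (∫⁻ b in C, w b ∂(κ₀ x)) * (∫⁻ b in C, w' b ∂(κ₀ y))
        + (∫⁻ b in C, w b ∂(κ₀ x)) * (∫⁻ b in Cᶜ, w' b ∂(κ₀ y))
        + (∫⁻ b in Cᶜ, w b ∂(κ₀ x)) * app κ₀ w' y := by
        rw [hsplit w x, hsplit w' y]; ring
    _ ≤ (e⁻¹) ^ 2 * (app κ₀ w' x * app κ₀ w y) + (N₀ * N₁ * F) * (η * (N₀ * N₁ * F'))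
        + (η * (N₀ * N₁ * F)) * (N₀ * N₁ * F') := by
        gcongr
        · exact hcompl hF' y
        · exact hcompl hF x
        · exact hall hF' y
    _ = _ := by ring

/-- The cross products of `u` and `v` are symmetric up to an error. -/
def PairBound (u v : 𝒳 → ℝ≥0∞) (α β : ℝ≥0∞) : Prop :=
  ∀ x x', u x * v x' ≤ u x' * v x + α * (v x * v x') + β

/-- Integration of the pair inequality against m ⊗ m'. The almost-everywhere form allows
restrictions to C or its complement; with a Dirac mass and an unnormalized predictor it compares a
point with an average. -/
lemma lintegral_mul_lintegral_le {m m' : Measure 𝒳} {u v : 𝒳 → ℝ≥0∞} (hu : Measurable u)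
    (hv : Measurable v) {α β : ℝ≥0∞}
    (h : ∀ᵐ a ∂m, ∀ᵐ b ∂m', u a * v b ≤ u b * v a + α * (v a * v b) + β) :
    (∫⁻ a, u a ∂m) * (∫⁻ b, v b ∂m')
      ≤ (∫⁻ b, u b ∂m') * (∫⁻ a, v a ∂m) + α * ((∫⁻ a, v a ∂m) * (∫⁻ b, v b ∂m'))
        + β * (m Set.univ * m' Set.univ) := by
  calc (∫⁻ a, u a ∂m) * (∫⁻ b, v b ∂m')
      = ∫⁻ a, ∫⁻ b, u a * v b ∂m' ∂m := by
        rw [← lintegral_mul_const _ hu]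
        exact lintegral_congr fun a => (lintegral_const_mul _ hv).symm
    _ ≤ ∫⁻ a, ∫⁻ b, (u b * v a + α * (v a * v b) + β) ∂m' ∂m :=
        lintegral_mono_ae (h.mono fun a ha => lintegral_mono_ae ha)
    _ = ∫⁻ a, ((∫⁻ b, u b ∂m') * v a + α * (∫⁻ b, v b ∂m') * v a + β * m' Set.univ) ∂m := by
        refine lintegral_congr fun a => ?_
        rw [lintegral_add_right _ measurable_const, lintegral_add_left (hu.mul_const _),
          lintegral_mul_const _ hu, lintegral_const_mul _ (hv.const_mul _),
          lintegral_const_mul _ hv, lintegral_const]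
        ring
    _ = _ := by
        rw [lintegral_add_right _ measurable_const, lintegral_add_left (hv.const_mul _),
          lintegral_const_mul _ hv, lintegral_const_mul _ hv, lintegral_const]
        ring

lemma PairBound.app {u v : 𝒳 → ℝ≥0∞} {α β : ℝ≥0∞} (h : PairBound u v α β) (hu : Measurable u)
    (hv : Measurable v) (κ : Kernel 𝒳 𝒳) (x x' : 𝒳) :
    app κ u x * app κ v x' ≤ app κ u x' * app κ v x + α * (app κ v x * app κ v x')
      + β * (κ x Set.univ * κ x' Set.univ) :=
  lintegral_mul_lintegral_le hu hv (.of_forall fun a => .of_forall fun b => h a b)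

lemma PairBound.app_of_le {u v : 𝒳 → ℝ≥0∞} {α β N : ℝ≥0∞} (h : PairBound u v α β)
    (hu : Measurable u) (hv : Measurable v) {κ : Kernel 𝒳 𝒳} (hN : ∀ x, κ x Set.univ ≤ N) :
    PairBound (ParticleFilter.app κ u) (ParticleFilter.app κ v) α (N ^ 2 * β) := by
  intro x x'
  refine (h.app hu hv κ x x').trans ?_
  rw [mul_comm (N ^ 2), sq]
  gcongr
  · exact hN x
  · exact hN x'

lemma PairBound.mono {u v : 𝒳 → ℝ≥0∞} {α β α' β' : ℝ≥0∞} (h : PairBound u v α β) (hα : α ≤ α')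
    (hβ : β ≤ β') : PairBound u v α' β' := fun x x' =>
  (h x x').trans (by gcongr)

/-- The part of the product measure on `C × C` that couples gains the factor `1 - e²`. -/
lemma setLIntegral_mul_le_of_doeblin {C : Set 𝒳} {e ρ : ℝ≥0∞}
    (hρ : ρ + e ^ 2 = 1) {lam m m' : Measure 𝒳} [IsFiniteMeasure lam] {c c' : ℝ≥0∞} (hc : c ≠ ∞)
    (hc' : c' ≠ ∞) (hm : (e * c) • lam ≤ m.restrict C) (hm₂ : m.restrict C ≤ c • lam)
    (hm' : (e * c') • lam ≤ m'.restrict C) (hm₂' : m'.restrict C ≤ c' • lam)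
    {u v : 𝒳 → ℝ≥0∞} (hu : Measurable u) (hv : Measurable v) {V : ℝ≥0∞} (hV : V ≠ ∞)
    (hvV : ∀ x, v x ≤ V) {α β : ℝ≥0∞}
    (h : ∀ a b, u a * v b ≤ u b * v a + α * (v a * v b) + β) :
    (∫⁻ a in C, u a ∂m) * (∫⁻ b in C, v b ∂m')
      ≤ (∫⁻ b in C, u b ∂m') * (∫⁻ a in C, v a ∂m)
        + ρ * α * ((∫⁻ a in C, v a ∂m) * (∫⁻ b in C, v b ∂m')) + β * (m C * m' C) := by
  have he : e ≠ ∞ := by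
    rintro rfl
    simp at hρ
  have hfin : ∀ {d : ℝ≥0∞}, d ≠ ∞ → IsFiniteMeasure (d • lam) := fun hd => lam.smul_finite hd
  have := hfin (ENNReal.mul_ne_top he hc)
  have := hfin (ENNReal.mul_ne_top he hc')
  -- Both restrictions are split into a residual and a multiple of the common measure λ.
  set ν := (e * c) • lam with hν
  set ν' := (e * c') • lam with hν'
  set k := m.restrict C - ν
  set k' := m'.restrict C - ν'
  have hk : m.restrict C = k + ν := (Measure.sub_add_cancel_of_le hm).symm
  have hk' : m'.restrict C = k' + ν' := (Measure.sub_add_cancel_of_le hm').symm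
  have hvfin : ∫⁻ a, v a ∂lam ≠ ∞ := by
    refine ne_top_of_le_ne_top ?_ (lintegral_mono hvV)
    rw [lintegral_const]
    exact ENNReal.mul_ne_top hV (measure_ne_top _ _)
  have e1 := lintegral_mul_lintegral_le (m := k) (m' := k') hu hv
    (.of_forall fun a => .of_forall fun b => h a b)
  have e2 := lintegral_mul_lintegral_le (m := k) (m' := ν') hu hv
    (.of_forall fun a => .of_forall fun b => h a b)
  have e3 := lintegral_mul_lintegral_le (m := ν) (m' := k') hu hv
    (.of_forall fun a => .of_forall fun b => h a b)
  have hνu : ∀ f : 𝒳 → ℝ≥0∞, ∫⁻ a, f a ∂ν = e * c * ∫⁻ a, f a ∂lam := fun f =>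
    lintegral_smul_measure _ _
  have hνu' : ∀ f : 𝒳 → ℝ≥0∞, ∫⁻ a, f a ∂ν' = e * c' * ∫⁻ a, f a ∂lam := fun f =>
    lintegral_smul_measure _ _
  have hsum : ∀ f : 𝒳 → ℝ≥0∞, ∫⁻ a in C, f a ∂m = ∫⁻ a, f a ∂k + ∫⁻ a, f a ∂ν := fun f => by
    rw [hk, lintegral_add_measure]
  have hsum' : ∀ f : 𝒳 → ℝ≥0∞, ∫⁻ a in C, f a ∂m' = ∫⁻ a, f a ∂k' + ∫⁻ a, f a ∂ν' := fun f => by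
    rw [hk', lintegral_add_measure]
  have hmC : m C = k Set.univ + ν Set.univ := by
    rw [← Measure.restrict_apply_univ, hk, Measure.add_apply]
  have hmC' : m' C = k' Set.univ + ν' Set.univ := by
    rw [← Measure.restrict_apply_univ, hk', Measure.add_apply]
  -- The upper Doeblin bound gives ν ⊗ ν' at least the share e² of the integral of v ⊗ v over C × C,
  -- so the other three products have at most the share ρ = 1 - e². The subtraction needs a finite
  -- integral, whence the bound on v.
  have hT : (∫⁻ a, v a ∂k) * (∫⁻ a, v a ∂k') + (∫⁻ a, v a ∂k) * (∫⁻ a, v a ∂ν')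
      + (∫⁻ a, v a ∂ν) * (∫⁻ a, v a ∂k')
      ≤ ρ * ((∫⁻ a in C, v a ∂m) * (∫⁻ b in C, v b ∂m')) := by
    set X := (∫⁻ a in C, v a ∂m) * (∫⁻ b in C, v b ∂m') with hX
    have hS : e ^ 2 * X ≤ (∫⁻ a, v a ∂ν) * (∫⁻ a, v a ∂ν') := by
      rw [hνu, hνu']
      have h1 := lintegral_mono' hm₂ (le_refl v)
      have h2 := lintegral_mono' hm₂' (le_refl v)
      rw [lintegral_smul_measure, smul_eq_mul] at h1 h2
      calc e ^ 2 * X ≤ e ^ 2 * ((c * ∫⁻ a, v a ∂lam) * (c' * ∫⁻ a, v a ∂lam)) := by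
            rw [hX]; gcongr
        _ = _ := by ring
    have hSfin : (∫⁻ a, v a ∂ν) * (∫⁻ a, v a ∂ν') ≠ ∞ := by
      rw [hνu, hνu']
      exact ENNReal.mul_ne_top (ENNReal.mul_ne_top (ENNReal.mul_ne_top he hc) hvfin)
        (ENNReal.mul_ne_top (ENNReal.mul_ne_top he hc') hvfin)
    refine ENNReal.le_of_add_le_add_right hSfin ?_
    calc _ = X := by rw [hX, hsum, hsum']; ring
      _ = ρ * X + e ^ 2 * X := by rw [← add_mul, hρ, one_mul]
      _ ≤ _ := by gcongr
  calc (∫⁻ a in C, u a ∂m) * (∫⁻ b in C, v b ∂m')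
      = (∫⁻ a, u a ∂k) * (∫⁻ a, v a ∂k') + (∫⁻ a, u a ∂k) * (∫⁻ a, v a ∂ν')
        + (∫⁻ a, u a ∂ν) * (∫⁻ a, v a ∂k') + (∫⁻ a, u a ∂ν) * (∫⁻ a, v a ∂ν') := by
        rw [hsum, hsum']; ring
    _ ≤ ((∫⁻ b, u b ∂k') * (∫⁻ a, v a ∂k) + α * ((∫⁻ a, v a ∂k) * (∫⁻ b, v b ∂k'))
          + β * (k Set.univ * k' Set.univ))
        + ((∫⁻ b, u b ∂ν') * (∫⁻ a, v a ∂k) + α * ((∫⁻ a, v a ∂k) * (∫⁻ b, v b ∂ν'))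
          + β * (k Set.univ * ν' Set.univ))
        + ((∫⁻ b, u b ∂k') * (∫⁻ a, v a ∂ν) + α * ((∫⁻ a, v a ∂ν) * (∫⁻ b, v b ∂k'))
          + β * (ν Set.univ * k' Set.univ))
        + ((∫⁻ a, u a ∂ν') * (∫⁻ a, v a ∂ν) + β * (ν Set.univ * ν' Set.univ)) := by
        -- For ν and ν', multiples of one measure, the cross products of u and v agree exactly: this
        -- part needs no α term.
        refine add_le_add (add_le_add (add_le_add e1 e2) e3) (le_trans (le_of_eq ?_) le_self_add)
        simp only [hνu, hνu']
        ring
    _ = (∫⁻ b in C, u b ∂m') * (∫⁻ a in C, v a ∂m)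
        + α * ((∫⁻ a, v a ∂k) * (∫⁻ a, v a ∂k') + (∫⁻ a, v a ∂k) * (∫⁻ a, v a ∂ν')
          + (∫⁻ a, v a ∂ν) * (∫⁻ a, v a ∂k')) + β * (m C * m' C) := by
        rw [hsum, hsum', hmC, hmC']; ring
    _ ≤ _ := by
        rw [mul_comm ρ α, mul_assoc]
        gcongr

/-- One Doeblin step for the bound of cross products, started from two points of `C`. -/
lemma app_mul_app_le_of_doeblin {κ : Kernel 𝒳 𝒳} {C : Set 𝒳} (hC : MeasurableSet C)
    {e ρ N : ℝ≥0∞} (hρ : ρ + e ^ 2 = 1) (hd : IsDoeblinOn κ C e) (hN : ∀ x, κ x Set.univ ≤ N)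
    {u v : 𝒳 → ℝ≥0∞} (hu : Measurable u) (hv : Measurable v) {V : ℝ≥0∞} (hV : V ≠ ∞)
    (hvV : ∀ x, v x ≤ V) {α β β' : ℝ≥0∞} (h : PairBound u v α β)
    (h' : ∀ a b, ¬ (a ∈ C ∧ b ∈ C) → u a * v b ≤ u b * v a + ρ * α * (v a * v b) + β')
    {x x' : 𝒳} (hx : x ∈ C) (hx' : x' ∈ C) :
    app κ u x * app κ v x' ≤ app κ u x' * app κ v x + ρ * α * (app κ v x * app κ v x')
      + N ^ 2 * (β + β') := by
  obtain ⟨lam, c, hfin, hc, hlam⟩ := hd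
  have h1 := setLIntegral_mul_le_of_doeblin hρ (hc x) (hc x') (hlam x hx).1 (hlam x hx).2
    (hlam x' hx').1 (hlam x' hx').2 hu hv hV hvV h
  have hinC : ∀ a, ∀ᵐ b ∂(κ a).restrict C, b ∈ C := fun a => ae_restrict_mem hC
  have hinCc : ∀ a, ∀ᵐ b ∂(κ a).restrict Cᶜ, b ∈ Cᶜ := fun a => ae_restrict_mem hC.compl
  -- Pairs that land outside C × C use h', whose coefficient of v v is already ρα.
  have e1 := lintegral_mul_lintegral_le (m := (κ x).restrict C) (m' := (κ x').restrict Cᶜ) hu hv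
    (α := ρ * α) (β := β') (.of_forall fun a => (hinCc x').mono fun b hb => h' a b fun H => hb H.2)
  have e2 := lintegral_mul_lintegral_le (m := (κ x).restrict Cᶜ) (m' := κ x') hu hv
    (α := ρ * α) (β := β') ((hinCc x).mono fun a ha => .of_forall fun b => h' a b fun H => ha H.1)
  have hsplit : ∀ (k : 𝒳 → ℝ≥0∞) (a : 𝒳), ∫⁻ b, k b ∂(κ a) = ∫⁻ b in C, k b ∂(κ a)
      + ∫⁻ b in Cᶜ, k b ∂(κ a) := fun k a => (lintegral_add_compl _ hC).symm
  rw [Measure.restrict_apply_univ, Measure.restrict_apply_univ] at e1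
  rw [Measure.restrict_apply_univ] at e2
  have hmass : ∀ a, κ a Set.univ = κ a C + κ a Cᶜ := fun a => (measure_add_measure_compl hC).symm
  simp only [app]
  calc (∫⁻ a, u a ∂(κ x)) * (∫⁻ b, v b ∂(κ x'))
      = (∫⁻ a in C, u a ∂(κ x)) * (∫⁻ b in C, v b ∂(κ x'))
        + (∫⁻ a in C, u a ∂(κ x)) * (∫⁻ b in Cᶜ, v b ∂(κ x'))
        + (∫⁻ a in Cᶜ, u a ∂(κ x)) * (∫⁻ b, v b ∂(κ x')) := by
        rw [hsplit u x, hsplit v x']; ring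
    _ ≤ _ := add_le_add (add_le_add h1 e1) e2
    _ = (∫⁻ b, u b ∂(κ x')) * (∫⁻ a, v a ∂(κ x))
        + ρ * α * ((∫⁻ a, v a ∂(κ x)) * (∫⁻ b, v b ∂(κ x'))) + β * (κ x C * κ x' C)
        + β' * (κ x C * κ x' Cᶜ + κ x Cᶜ * κ x' Set.univ) := by
        rw [hsplit u x', hsplit v x, hsplit v x']; ring
    _ ≤ (∫⁻ b, u b ∂(κ x')) * (∫⁻ a, v a ∂(κ x))
        + ρ * α * ((∫⁻ a, v a ∂(κ x)) * (∫⁻ b, v b ∂(κ x')))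
        + β * (κ x Set.univ * κ x' Set.univ) + β' * (κ x Set.univ * κ x' Set.univ) := by
        gcongr
        · exact Set.subset_univ _
        · exact Set.subset_univ _
        · rw [hmass x, add_mul]
          gcongr
          exact Set.subset_univ _
    _ = (∫⁻ b, u b ∂(κ x')) * (∫⁻ a, v a ∂(κ x))
        + ρ * α * ((∫⁻ a, v a ∂(κ x)) * (∫⁻ b, v b ∂(κ x')))
        + (κ x Set.univ * κ x' Set.univ) * (β + β') := by ring
    _ ≤ _ := by
        rw [sq]
        gcongr
        · exact hN x
        · exact hN x'

/-- Two Doeblin steps for the bound of cross products. -/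
lemma PairBound.app_app_of_doeblin {κ₀ κ₁ : Kernel 𝒳 𝒳} {C : Set 𝒳} (hC : MeasurableSet C)
    {e η ρ N₀ N₁ : ℝ≥0∞} (hρ : ρ + e ^ 2 = 1) (hd : IsDoeblinOn κ₀ C e)
    (h₀ : IsSmallOff κ₀ C η N₀) (h₁ : IsSmallOff κ₁ C η N₁) (hN₁ : N₁ ≠ ∞)
    {u v : 𝒳 → ℝ≥0∞} (hu : Measurable u) (hv : Measurable v) {V : ℝ≥0∞} (hV : V ≠ ∞)
    (hvV : ∀ x, v x ≤ V) {α β β' : ℝ≥0∞} (h : PairBound u v α β) (h' : PairBound u v (ρ * α) β') :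
    PairBound (ParticleFilter.app κ₀ (ParticleFilter.app κ₁ u))
      (ParticleFilter.app κ₀ (ParticleFilter.app κ₁ v)) (ρ * α)
      ((N₀ * N₁) ^ 2 * (β + η * β')) := by
  have hoff : ∀ {κ : Kernel 𝒳 𝒳} {N : ℝ≥0∞}, IsSmallOff κ C η N → ∀ a b, ¬ (a ∈ C ∧ b ∈ C) →
      κ a Set.univ * κ b Set.univ ≤ η * N ^ 2 := by
    intro κ N hκ a b hab
    by_cases ha : a ∈ C
    · have hb : b ∉ C := fun hb => hab ⟨ha, hb⟩
      calc _ ≤ N * (η * N) := mul_le_mul' (hκ.1 a) (hκ.2 b hb)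
        _ = _ := by ring
    · calc _ ≤ (η * N) * N := mul_le_mul' (hκ.2 a ha) (hκ.1 b)
        _ = _ := by ring
  have hu' := measurable_app κ₁ hu
  have hv' := measurable_app κ₁ hv
  intro x x'
  -- From C × C the coarser bound h is contracted, and h' is used only where κ₁ starts off C and its
  -- error gains η. From outside C × C only h' is used, and κ₀ provides η.
  by_cases hxx : x ∈ C ∧ x' ∈ C
  · have := app_mul_app_le_of_doeblin hC hρ hd h₀.1 hu' hv' (ENNReal.mul_ne_top hN₁ hV)
      (fun x => (app_le hvV x).trans (mul_le_mul_left (h₁.1 x) V)) (h.app_of_le hu hv h₁.1)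
      (β' := N₁ ^ 2 * (η * β')) (fun a b hab => (h'.app hu hv κ₁ a b).trans (by
        refine add_le_add_right (le_trans (mul_le_mul_right (hoff h₁ a b hab) β') ?_) _
        exact le_of_eq (by ring))) hxx.1 hxx.2
    refine this.trans (le_of_eq ?_)
    ring
  · refine ((h'.app_of_le hu hv h₁.1).app hu' hv' κ₀ x x').trans ?_
    refine add_le_add_right ?_ _
    calc N₁ ^ 2 * β' * (κ₀ x Set.univ * κ₀ x' Set.univ) ≤ N₁ ^ 2 * β' * (η * N₀ ^ 2) :=
          mul_le_mul_right (hoff h₀ x x' hxx) _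
      _ = (N₀ * N₁) ^ 2 * (η * β') := by ring
      _ ≤ _ := mul_le_mul_right le_add_self _

/-- The ratio of `⨆ v` to `⨅ v` over `D` is at most `R`. -/
def RatioBound (D : Set 𝒳) (v : 𝒳 → ℝ≥0∞) (R : ℝ≥0∞) : Prop :=
  ∀ x, ∀ y ∈ D, v x ≤ R * v y

/-- On D the function v is at least its supremum divided by R, so the mass that returns to D carries
the supremum of v back to y. -/
lemma RatioBound.iSup_mul_le {D : Set 𝒳} (hD : MeasurableSet D) {v : 𝒳 → ℝ≥0∞} {R : ℝ≥0∞}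
    (h : RatioBound D v R) (hv : Measurable v) {κ₀ κ₁ : Kernel 𝒳 𝒳} {d : ℝ≥0∞} {y : 𝒳}
    (hd : d ≤ app κ₀ (app κ₁ (D.indicator 1)) y) :
    (⨆ x, v x) * d ≤ R * app κ₀ (app κ₁ v) y := by
  have h1 : ∀ a, (⨆ x, v x) * app κ₁ (D.indicator 1) a ≤ R * app κ₁ v a := fun a => by
    rw [← app_const_mul _ (measurable_one.indicator hD), ← app_const_mul _ hv]
    refine app_mono (fun x => ?_) a
    by_cases hx : x ∈ D
    · simpa [hx] using fun a => h a x hx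
    · simp [hx]
  calc (⨆ x, v x) * d ≤ (⨆ x, v x) * app κ₀ (app κ₁ (D.indicator 1)) y := by gcongr
    _ = app κ₀ (fun a => (⨆ x, v x) * app κ₁ (D.indicator 1) a) y :=
        (app_const_mul _ (measurable_app _ (measurable_one.indicator hD)) _ _).symm
    _ ≤ app κ₀ (fun a => R * app κ₁ v a) y := app_mono h1 y
    _ = _ := app_const_mul _ (measurable_app _ hv) _ _

variable {κ₀ κ₁ : Kernel 𝒳 𝒳} {C D : Set 𝒳} {e η N₀ N₁ d q : ℝ≥0∞}

lemma app_app_le (h₀ : ∀ x, κ₀ x Set.univ ≤ N₀) (h₁ : ∀ x, κ₁ x Set.univ ≤ N₁)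
    (hq : N₀ * N₁ ≤ q) {f : 𝒳 → ℝ≥0∞} {F : ℝ≥0∞} (hF : ∀ x, f x ≤ F) (x : 𝒳) :
    app κ₀ (app κ₁ f) x ≤ q * F := by
  have h2 : ∀ a, app κ₁ f a ≤ N₁ * F := fun a => (app_le hF a).trans (mul_le_mul_left (h₁ a) _)
  refine (app_le h2 x).trans ((mul_le_mul_left (h₀ x) _).trans ?_)
  rw [← mul_assoc]
  gcongr

/-- Two steps without any assumption but bounds of the masses. -/
lemma RatioBound.app_app (hD : MeasurableSet D) {v : 𝒳 → ℝ≥0∞} {R : ℝ≥0∞} (h : RatioBound D v R)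
    (hv : Measurable v) (h₀ : ∀ x, κ₀ x Set.univ ≤ N₀) (h₁ : ∀ x, κ₁ x Set.univ ≤ N₁)
    (hq : N₀ * N₁ ≤ q) (hdq : 1 ≤ d * q) (hd : ∀ y ∈ D, d ≤ app κ₀ (app κ₁ (D.indicator 1)) y) :
    RatioBound D (app κ₀ (app κ₁ v)) (q ^ 2 * R) := by
  intro x y hy
  calc app κ₀ (app κ₁ v) x ≤ q * (⨆ x, v x) := app_app_le h₀ h₁ hq (le_iSup v) x
    _ = q * (⨆ x, v x) * 1 := (mul_one _).symm
    _ ≤ q * (⨆ x, v x) * (d * q) := by gcongr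
    _ = q ^ 2 * ((⨆ x, v x) * d) := by ring
    _ ≤ q ^ 2 * (R * app κ₀ (app κ₁ v) y) :=
        mul_le_mul_right (h.iSup_mul_le hD hv (hd y hy)) _
    _ = _ := by ring

/-- Two Doeblin steps contract the bound of the ratio, up to a constant. -/
lemma RatioBound.app_app_of_doeblin (hC : MeasurableSet C) (hD : MeasurableSet D)
    (he0 : e ≠ 0) (he : e ≠ ∞) (hdo : IsDoeblinOn κ₀ C e)
    (h₀ : IsSmallOff κ₀ C η N₀) (h₁ : IsSmallOff κ₁ C η N₁)
    {v : 𝒳 → ℝ≥0∞} {R : ℝ≥0∞} (h : RatioBound D v R) (hv : Measurable v)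
    (hq : N₀ * N₁ ≤ q) (hdq : 1 ≤ d * q) (hd : ∀ y ∈ D, d ≤ app κ₀ (app κ₁ (D.indicator 1)) y) :
    RatioBound D (app κ₀ (app κ₁ v)) ((e⁻¹) ^ 2 * q ^ 2 + 2 * η * q ^ 4 * R) := by
  intro x y hy
  -- Exchanging v and 1 between x and y leaves a ratio of total masses, bounded by q and d, plus an
  -- error with sup v. The error is brought back to w y by the return to D; each division by d costs
  -- a factor q.
  have hsw := app_mul_app_swap_le hC he0 he hdo h₀ h₁ (f := v) (f' := 1) (le_iSup v)
    (fun _ => le_refl (1 : ℝ≥0∞)) x y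
  have hone : d ≤ app κ₀ (app κ₁ 1) y := (hd y hy).trans
    (app_mono (app_mono (Set.indicator_le_self' fun _ _ => zero_le_one)) y)
  have hone' : app κ₀ (app κ₁ 1) x ≤ q := by
    simpa using app_app_le h₀.1 h₁.1 hq (f := 1) (fun _ => le_refl (1 : ℝ≥0∞)) x
  have hs := h.iSup_mul_le hD hv (hd y hy)
  set S := ⨆ x, v x
  set w := app κ₀ (app κ₁ v)
  calc w x = w x * 1 := (mul_one _).symm
    _ ≤ w x * (d * q) := by gcongr
    _ ≤ w x * (app κ₀ (app κ₁ 1) y * q) := by gcongr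
    _ = q * (w x * app κ₀ (app κ₁ 1) y) := by ring
    _ ≤ q * ((e⁻¹) ^ 2 * (app κ₀ (app κ₁ 1) x * w y) + 2 * η * (N₀ * N₁) ^ 2 * (S * 1)) := by
        gcongr
    _ ≤ q * ((e⁻¹) ^ 2 * (q * w y) + 2 * η * q ^ 2 * (S * 1)) := by gcongr
    _ = (e⁻¹) ^ 2 * q ^ 2 * w y + 2 * η * q ^ 3 * (S * 1) := by ring
    _ ≤ (e⁻¹) ^ 2 * q ^ 2 * w y + 2 * η * q ^ 3 * (S * (d * q)) := by gcongr
    _ = (e⁻¹) ^ 2 * q ^ 2 * w y + 2 * η * q ^ 4 * (S * d) := by ring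
    _ ≤ (e⁻¹) ^ 2 * q ^ 2 * w y + 2 * η * q ^ 4 * (R * w y) := by gcongr
    _ = _ := by ring

lemma mul_measure_le_lintegral (hD : MeasurableSet D) {μ : Measure 𝒳}
    (hd : ∀ y ∈ D, d ≤ app κ₀ (app κ₁ (D.indicator 1)) y) :
    d * μ D ≤ ∫⁻ x, app κ₀ (app κ₁ (D.indicator 1)) x ∂μ := by
  rw [← setLIntegral_const]
  refine le_trans (setLIntegral_mono_ae' hD (.of_forall hd)) (setLIntegral_le_lintegral _ _)

/-- Two steps for the inverse mass of `D` under the normalized measures. -/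
lemma lintegral_app_app_le (hD : MeasurableSet D) {μ : Measure 𝒳} {X : ℝ≥0∞}
    (h : μ Set.univ ≤ X * μ D) (h₀ : ∀ x, κ₀ x Set.univ ≤ N₀) (h₁ : ∀ x, κ₁ x Set.univ ≤ N₁)
    (hq : N₀ * N₁ ≤ q) (hdq : 1 ≤ d * q) (hd : ∀ y ∈ D, d ≤ app κ₀ (app κ₁ (D.indicator 1)) y) :
    ∫⁻ x, app κ₀ (app κ₁ 1) x ∂μ
      ≤ q ^ 2 * X * ∫⁻ x, app κ₀ (app κ₁ (D.indicator 1)) x ∂μ := by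
  have hone : ∀ x, app κ₀ (app κ₁ 1) x ≤ q := fun x => by
    simpa using app_app_le h₀ h₁ hq (f := 1) (fun _ => le_refl (1 : ℝ≥0∞)) x
  calc ∫⁻ x, app κ₀ (app κ₁ 1) x ∂μ ≤ ∫⁻ _, q ∂μ := lintegral_mono hone
    _ = q * μ Set.univ := lintegral_const _
    _ ≤ q * (X * μ D) * 1 := by rw [mul_one]; gcongr
    _ ≤ q * (X * μ D) * (d * q) := by gcongr
    _ = q ^ 2 * X * (d * μ D) := by ring
    _ ≤ _ := by gcongr; exact mul_measure_le_lintegral hD hd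

/-- Two Doeblin steps for the inverse mass of `D` under the normalized measures. -/
lemma lintegral_app_app_le_of_doeblin (hC : MeasurableSet C) (hD : MeasurableSet D)
    (hDne : D.Nonempty) (he0 : e ≠ 0) (he : e ≠ ∞) (hdo : IsDoeblinOn κ₀ C e)
    (h₀ : IsSmallOff κ₀ C η N₀) (h₁ : IsSmallOff κ₁ C η N₁)
    {μ : Measure 𝒳} {X : ℝ≥0∞} (h : μ Set.univ ≤ X * μ D)
    (hq : N₀ * N₁ ≤ q) (hdq : 1 ≤ d * q) (hd : ∀ y ∈ D, d ≤ app κ₀ (app κ₁ (D.indicator 1)) y) :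
    ∫⁻ x, app κ₀ (app κ₁ 1) x ∂μ
      ≤ ((e⁻¹) ^ 2 * q ^ 2 + 2 * η * q ^ 4 * X)
        * ∫⁻ x, app κ₀ (app κ₁ (D.indicator 1)) x ∂μ := by
  obtain ⟨y, hy⟩ := hDne
  have hm1 : Measurable (app κ₀ (app κ₁ (1 : 𝒳 → ℝ≥0∞))) :=
    measurable_app _ (measurable_app _ measurable_one)
  have hmD : Measurable (app κ₀ (app κ₁ (D.indicator (1 : 𝒳 → ℝ≥0∞)))) :=
    measurable_app _ (measurable_app _ (measurable_one.indicator hD))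
  have hone : app κ₀ (app κ₁ 1) y ≤ q := by
    simpa using app_app_le h₀.1 h₁.1 hq (f := 1) (fun _ => le_refl (1 : ℝ≥0∞)) y
  -- The roles are now played by 1 and the indicator of D, with a fixed reference point y of D whose
  -- mass returning to D is at least d. Integrating over x gives the claim for μ.
  have hsw : ∀ x, q * d * app κ₀ (app κ₁ 1) x
      ≤ (e⁻¹) ^ 2 * q ^ 2 * app κ₀ (app κ₁ (D.indicator 1)) x + 2 * η * q ^ 3 := fun x => by
    have := app_mul_app_swap_le hC he0 he hdo h₀ h₁ (f := 1) (f' := D.indicator 1)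
      (fun _ => le_refl (1 : ℝ≥0∞)) (fun a => Set.indicator_le_self' (fun _ _ => zero_le_one) a) x y
    calc q * d * app κ₀ (app κ₁ 1) x
        ≤ q * app κ₀ (app κ₁ (D.indicator 1)) y * app κ₀ (app κ₁ 1) x := by
          gcongr; exact hd y hy
      _ = q * (app κ₀ (app κ₁ 1) x * app κ₀ (app κ₁ (D.indicator 1)) y) := by ring
      _ ≤ q * ((e⁻¹) ^ 2 * (app κ₀ (app κ₁ (D.indicator 1)) x * app κ₀ (app κ₁ 1) y)
            + 2 * η * (N₀ * N₁) ^ 2 * (1 * 1)) := by gcongr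
      _ ≤ q * ((e⁻¹) ^ 2 * (app κ₀ (app κ₁ (D.indicator 1)) x * q)
            + 2 * η * q ^ 2 * (1 * 1)) := by gcongr
      _ = _ := by ring
  calc ∫⁻ x, app κ₀ (app κ₁ 1) x ∂μ = 1 * ∫⁻ x, app κ₀ (app κ₁ 1) x ∂μ := (one_mul _).symm
    _ ≤ (q * d) * ∫⁻ x, app κ₀ (app κ₁ 1) x ∂μ := by rw [mul_comm q d]; gcongr
    _ = ∫⁻ x, q * d * app κ₀ (app κ₁ 1) x ∂μ := (lintegral_const_mul _ hm1).symm
    _ ≤ ∫⁻ x, ((e⁻¹) ^ 2 * q ^ 2 * app κ₀ (app κ₁ (D.indicator 1)) x + 2 * η * q ^ 3) ∂μ :=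
        lintegral_mono hsw
    _ = (e⁻¹) ^ 2 * q ^ 2 * ∫⁻ x, app κ₀ (app κ₁ (D.indicator 1)) x ∂μ
        + 2 * η * q ^ 3 * μ Set.univ := by
        rw [lintegral_add_right _ measurable_const, lintegral_const_mul _ hmD, lintegral_const]
    _ ≤ (e⁻¹) ^ 2 * q ^ 2 * ∫⁻ x, app κ₀ (app κ₁ (D.indicator 1)) x ∂μ
        + 2 * η * q ^ 3 * (X * μ D) * 1 := by rw [mul_one]; gcongr
    _ ≤ (e⁻¹) ^ 2 * q ^ 2 * ∫⁻ x, app κ₀ (app κ₁ (D.indicator 1)) x ∂μ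
        + 2 * η * q ^ 3 * (X * μ D) * (d * q) := by gcongr
    _ = (e⁻¹) ^ 2 * q ^ 2 * ∫⁻ x, app κ₀ (app κ₁ (D.indicator 1)) x ∂μ
        + 2 * η * q ^ 4 * X * (d * μ D) := by ring
    _ ≤ (e⁻¹) ^ 2 * q ^ 2 * ∫⁻ x, app κ₀ (app κ₁ (D.indicator 1)) x ∂μ
        + 2 * η * q ^ 4 * X * ∫⁻ x, app κ₀ (app κ₁ (D.indicator 1)) x ∂μ := by
        gcongr; exact mul_measure_le_lintegral hD hd
    _ = _ := by ring

end Doeblin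

/-! ### Forgetting along a fixed record -/

section Record

variable {𝒳 𝒴 : Type*} [MeasurableSpace 𝒳] [MeasurableSpace 𝒴]

/-- The kernel of the block of length `r` that starts at time `i`. -/
def HMM.block (M : HMM 𝒳 𝒴) (y : ℕ → 𝒴) (r i : ℕ) : Kernel 𝒳 𝒳 := M.L r (fun j => y (i + j))

/-- Bounds for the densities and kernels along a record `y`: `a` bounds the logarithms of the
densities from above and of the return masses to `D` from below, and the blocks that start at a
time of `S` satisfy the Doeblin condition on `C` with ratio `e` and are small off `C`. -/
structure HMM.Record (M : HMM 𝒳 𝒴) (y : ℕ → 𝒴) (r : ℕ) (C D : Set 𝒳) (e η : ℝ≥0∞) (a : ℕ → ℝ)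
    (S : Set ℕ) : Prop where
  measC : MeasurableSet C
  measD : MeasurableSet D
  nonempty : D.Nonempty
  one_le : 1 ≤ r
  nonneg : ∀ i, 0 ≤ a i
  g_le : ∀ i x, M.g x (y i) ≤ Real.exp (a i)
  le_return : ∀ i, ∀ x ∈ D, ENNReal.ofReal (Real.exp (-a i)) ≤ M.ev y i r (D.indicator 1) x
  doeblin : ∀ i ∈ S, IsDoeblinOn (M.block y r i) C e
  small : ∀ i ∈ S, ∀ x ∉ C, M.block y r i x Set.univ
    ≤ η * ENNReal.ofReal (Real.exp (∑ j ∈ Finset.Ico i (i + r), a j))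

/-- `exp (∑_{i=t}^{s-1} a_i)`. -/
def expSum (a : ℕ → ℝ) (t s : ℕ) : ℝ := Real.exp (∑ i ∈ Finset.Ico t s, a i)

lemma expSum_pos (a : ℕ → ℝ) (t s : ℕ) : 0 < expSum a t s := Real.exp_pos _

lemma expSum_mul (a : ℕ → ℝ) {t s m : ℕ} (h : t ≤ s) (h' : s ≤ m) :
    expSum a t s * expSum a s m = expSum a t m := by
  rw [expSum, expSum, expSum, ← Real.exp_add, Finset.sum_Ico_consecutive _ h h']

variable {M : HMM 𝒳 𝒴} {y : ℕ → 𝒴} {r : ℕ} {C D : Set 𝒳} {e η : ℝ≥0∞} {a : ℕ → ℝ} {S : Set ℕ}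

lemma HMM.ev_two_mul (M : HMM 𝒳 𝒴) (y : ℕ → 𝒴) (r t : ℕ) {F : 𝒳 → ℝ≥0∞} (hF : Measurable F) :
    M.ev y t (2 * r) F = app (M.block y r t) (app (M.block y r (t + r)) F) := by
  rw [two_mul, M.ev_add _ _ _ _ hF]
  rfl

lemma HMM.Record.one_le_expSum (h : M.Record y r C D e η a S) (t s : ℕ) : 1 ≤ expSum a t s :=
  Real.one_le_exp (Finset.sum_nonneg fun i _ => h.nonneg i)

lemma HMM.Record.ev_one_le (h : M.Record y r C D e η a S) (t l : ℕ) (x : 𝒳) :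
    M.ev y t l 1 x ≤ ENNReal.ofReal (expSum a t (t + l)) :=
  M.ev_one_le_exp h.g_le t l x

lemma HMM.Record.block_univ_le (h : M.Record y r C D e η a S) (t : ℕ) (x : 𝒳) :
    M.block y r t x Set.univ ≤ ENNReal.ofReal (expSum a t (t + r)) :=
  (M.L_univ_eq_ev y t r x).trans_le (h.ev_one_le t r x)

lemma HMM.Record.isSmallOff (h : M.Record y r C D e η a S) {t : ℕ} (ht : t ∈ S) :
    IsSmallOff (M.block y r t) C η (ENNReal.ofReal (expSum a t (t + r))) :=
  ⟨h.block_univ_le t, h.small t ht⟩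

lemma ofReal_expSum_mul (a : ℕ → ℝ) {t s m : ℕ} (h : t ≤ s) (h' : s ≤ m) :
    ENNReal.ofReal (expSum a t s) * ENNReal.ofReal (expSum a s m)
      = ENNReal.ofReal (expSum a t m) := by
  rw [← ENNReal.ofReal_mul (expSum_pos _ _ _).le, expSum_mul a h h']

lemma HMM.Record.mass_mul (r t : ℕ) (a : ℕ → ℝ) :
    ENNReal.ofReal (expSum a t (t + r)) * ENNReal.ofReal (expSum a (t + r) (t + r + r))
      = ENNReal.ofReal (expSum a t (t + 2 * r)) := by
  rw [ofReal_expSum_mul a (by omega) (by omega), two_mul, add_assoc]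

/-- The mass that returns to `D` in two blocks. -/
lemma HMM.Record.le_return_two (h : M.Record y r C D e η a S) (t : ℕ) {x : 𝒳} (hx : x ∈ D) :
    ENNReal.ofReal (Real.exp (-a t - a (t + r)))
      ≤ app (M.block y r t) (app (M.block y r (t + r)) (D.indicator 1)) x := by
  have := M.mul_ev_indicator_le y t r h.measD (h.le_return (t + r)) x
  refine le_trans ?_ this
  rw [show -a t - a (t + r) = -a (t + r) + -a t by ring, Real.exp_add,
    ENNReal.ofReal_mul (Real.exp_pos _).le]
  gcongr
  exact h.le_return t x hx

lemma HMM.Record.one_le_return_mul (h : M.Record y r C D e η a S) (t : ℕ) :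
    1 ≤ ENNReal.ofReal (Real.exp (-a t - a (t + r)))
      * ENNReal.ofReal (expSum a t (t + 2 * r)) := by
  have hr := h.one_le
  rw [← ENNReal.ofReal_mul (Real.exp_pos _).le, expSum, ← Real.exp_add, ← ENNReal.ofReal_one]
  refine ENNReal.ofReal_le_ofReal (Real.one_le_exp ?_)
  have : a t + a (t + r) ≤ ∑ i ∈ Finset.Ico t (t + 2 * r), a i := by
    rw [← Finset.sum_pair (f := a) (show t ≠ t + r by omega)]
    refine Finset.sum_le_sum_of_subset_of_nonneg (fun i hi => ?_) fun i _ _ => h.nonneg i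
    simp only [Finset.mem_insert, Finset.mem_singleton] at hi
    rw [Finset.mem_Ico]
    omega
  linarith

/-- The coefficient gained by a pair of blocks. -/
def pairCoeff (S : Set ℕ) (r : ℕ) (η : ℝ) (t : ℕ) : ℝ :=
  open Classical in if t ∈ S ∧ t + r ∈ S then 2 * η else 1

/-- Good and other pairs are put into one affine recursion with slope `pairCoeff` times E⁴. On a
pair that is not good the slope E² would do, but E ≥ 1. The recursion runs backwards in time, as v
does. -/
lemma HMM.Record.ratioBound_step {e η : ℝ} (he : 0 < e) (hη : 0 < η)
    (h : M.Record y r C D (ENNReal.ofReal e) (ENNReal.ofReal η) a S) (t : ℕ) {v : 𝒳 → ℝ≥0∞}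
    (hv : Measurable v) {R : ℝ} (hR : 0 ≤ R) (hvR : RatioBound D v (ENNReal.ofReal R)) :
    RatioBound D (M.ev y t (2 * r) v) (ENNReal.ofReal ((e⁻¹) ^ 2 * expSum a t (t + 2 * r) ^ 2
      + pairCoeff S r η t * expSum a t (t + 2 * r) ^ 4 * R)) := by
  have hE := h.one_le_expSum t (t + 2 * r)
  rw [M.ev_two_mul y r t hv]
  by_cases hS : t ∈ S ∧ t + r ∈ S
  · have := RatioBound.app_app_of_doeblin h.measC h.measD (by simpa using he)
      ENNReal.ofReal_ne_top (h.doeblin t hS.1) (h.isSmallOff hS.1) (h.isSmallOff hS.2) hvR hv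
      (HMM.Record.mass_mul r t a).le (h.one_le_return_mul t) (fun y hy => h.le_return_two t hy)
    rw [pairCoeff, if_pos hS, ENNReal.ofReal_add (by positivity) (by positivity),
      ENNReal.ofReal_mul (by positivity), ENNReal.ofReal_mul (by positivity),
      ENNReal.ofReal_mul (by positivity), ENNReal.ofReal_mul (by positivity),
      ENNReal.ofReal_pow (by positivity), ENNReal.ofReal_pow (by positivity),
      ENNReal.ofReal_pow (by positivity), ENNReal.ofReal_inv_of_pos he]
    simpa using this
  · have := RatioBound.app_app h.measD hvR hv (h.block_univ_le t) (h.block_univ_le (t + r))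
      (HMM.Record.mass_mul r t a).le (h.one_le_return_mul t) (fun y hy => h.le_return_two t hy)
    intro x y hy
    refine (this x y hy).trans (mul_le_mul_left ?_ _)
    rw [← ENNReal.ofReal_pow (by positivity), ← ENNReal.ofReal_mul (by positivity),
      pairCoeff, if_neg hS, one_mul]
    refine ENNReal.ofReal_le_ofReal ?_
    have h2 : expSum a t (t + 2 * r) ^ 2 ≤ expSum a t (t + 2 * r) ^ 4 :=
      pow_le_pow_right₀ hE (by norm_num)
    have : 0 ≤ (e⁻¹) ^ 2 * expSum a t (t + 2 * r) ^ 2 := by positivity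
    nlinarith [mul_le_mul_of_nonneg_right h2 hR]

/-- The unnormalized predictor applied to a function. -/
def HMM.upred (M : HMM 𝒳 𝒴) (χ : Measure 𝒳) (y : ℕ → 𝒴) (k : ℕ) (F : 𝒳 → ℝ≥0∞) : ℝ≥0∞ :=
  ∫⁻ x, M.ev y 0 k F x ∂χ

lemma HMM.lintegral_bind (M : HMM 𝒳 𝒴) (χ : Measure 𝒳) (y : ℕ → 𝒴) (k : ℕ) {F : 𝒳 → ℝ≥0∞}
    (hF : Measurable F) : ∫⁻ x, F x ∂(χ.bind (M.Lseg y 0 k)) = M.upred χ y k F := by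
  rw [Measure.lintegral_bind (Kernel.aemeasurable _) hF.aemeasurable]
  rfl

lemma HMM.upred_add (M : HMM 𝒳 𝒴) (χ : Measure 𝒳) (y : ℕ → 𝒴) (k l : ℕ) {F : 𝒳 → ℝ≥0∞}
    (hF : Measurable F) : M.upred χ y (k + l) F = M.upred χ y k (M.ev y k l F) := by
  rw [HMM.upred, M.ev_add _ _ _ _ hF, zero_add, HMM.upred]

/-- The dual of `HMM.Record.ratioBound_step`: the same affine recursion, now forwards in time, for
the inverse mass that the predictor gives to D. -/
lemma HMM.Record.upred_step {e η : ℝ} (he : 0 < e) (hη : 0 < η)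
    (h : M.Record y r C D (ENNReal.ofReal e) (ENNReal.ofReal η) a S) (χ : Measure 𝒳) (t : ℕ)
    {X : ℝ} (hX : 0 ≤ X)
    (hvX : M.upred χ y t 1 ≤ ENNReal.ofReal X * M.upred χ y t (D.indicator 1)) :
    M.upred χ y (t + 2 * r) 1 ≤ (ENNReal.ofReal ((e⁻¹) ^ 2 * expSum a t (t + 2 * r) ^ 2
      + pairCoeff S r η t * expSum a t (t + 2 * r) ^ 4 * X))
      * M.upred χ y (t + 2 * r) (D.indicator 1) := by
  have hE := h.one_le_expSum t (t + 2 * r)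
  have hmD : Measurable (D.indicator (1 : 𝒳 → ℝ≥0∞)) := measurable_one.indicator h.measD
  have hb : ∀ {F : 𝒳 → ℝ≥0∞}, Measurable F → M.upred χ y (t + 2 * r) F
      = ∫⁻ x, app (M.block y r t) (app (M.block y r (t + r)) F) x
        ∂(χ.bind (M.Lseg y 0 t)) := fun hF => by
    rw [M.upred_add _ _ _ _ hF, M.ev_two_mul _ _ _ hF,
      M.lintegral_bind _ _ _ (measurable_app _ (measurable_app _ hF))]
  have hX' : (χ.bind (M.Lseg y 0 t)) Set.univ
      ≤ ENNReal.ofReal X * (χ.bind (M.Lseg y 0 t)) D := by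
    rw [← M.lintegral_bind _ _ _ measurable_one, ← M.lintegral_bind _ _ _ hmD,
      lintegral_indicator_one h.measD] at hvX
    simpa using hvX
  rw [hb measurable_one, hb hmD]
  by_cases hS : t ∈ S ∧ t + r ∈ S
  · have := lintegral_app_app_le_of_doeblin h.measC h.measD h.nonempty (by simpa using he)
      ENNReal.ofReal_ne_top (h.doeblin t hS.1) (h.isSmallOff hS.1) (h.isSmallOff hS.2) hX'
      (HMM.Record.mass_mul r t a).le (h.one_le_return_mul t) (fun y hy => h.le_return_two t hy)
    rw [pairCoeff, if_pos hS, ENNReal.ofReal_add (by positivity) (by positivity),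
      ENNReal.ofReal_mul (by positivity), ENNReal.ofReal_mul (by positivity),
      ENNReal.ofReal_mul (by positivity), ENNReal.ofReal_mul (by positivity),
      ENNReal.ofReal_pow (by positivity), ENNReal.ofReal_pow (by positivity),
      ENNReal.ofReal_pow (by positivity), ENNReal.ofReal_inv_of_pos he]
    simpa using this
  · have := lintegral_app_app_le h.measD hX' (h.block_univ_le t) (h.block_univ_le (t + r))
      (HMM.Record.mass_mul r t a).le (h.one_le_return_mul t) (fun y hy => h.le_return_two t hy)
    refine this.trans (mul_le_mul_left ?_ _)
    rw [← ENNReal.ofReal_pow (by positivity), ← ENNReal.ofReal_mul (by positivity),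
      pairCoeff, if_neg hS, one_mul]
    refine ENNReal.ofReal_le_ofReal ?_
    have h2 : expSum a t (t + 2 * r) ^ 2 ≤ expSum a t (t + 2 * r) ^ 4 :=
      pow_le_pow_right₀ hE (by norm_num)
    have : 0 ≤ (e⁻¹) ^ 2 * expSum a t (t + 2 * r) ^ 2 := by positivity
    nlinarith [mul_le_mul_of_nonneg_right h2 hX]

/-- The number of pairs of blocks, among the first `N` after time `t`, with both starting times
in `S`. -/
def goodPairs (S : Set ℕ) (r t N : ℕ) : ℕ :=
  open Classical in ∑ l ∈ Finset.range N, if t + 2 * r * l ∈ S ∧ t + 2 * r * l + r ∈ S then 1 else 0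

lemma goodPairs_succ (S : Set ℕ) (r t N : ℕ) : goodPairs S r t (N + 1)
    = goodPairs S r (t + 2 * r) N + open Classical in if t ∈ S ∧ t + r ∈ S then 1 else 0 := by
  rw [goodPairs, Finset.sum_range_succ', goodPairs]
  congr 1
  refine Finset.sum_congr rfl fun l _ => ?_
  rw [show t + 2 * r * (l + 1) = t + 2 * r + 2 * r * l by ring]

/-- Forgetting of the initial state over `N` pairs of blocks. -/
lemma HMM.Record.pairBound {θ ρ B V : ℝ≥0∞} (h : M.Record y r C D e (θ ^ 2) a S)
    (hρ : ρ + e ^ 2 = 1) (hθ0 : θ ≠ 0) (hθ : θ ≤ 1) (hV : V ≠ ∞) {u v : 𝒳 → ℝ≥0∞}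
    (hu : Measurable u) (hv : Measurable v) (huv : ∀ x, u x ≤ B * v x) (hvV : ∀ x, v x ≤ V)
    (N t p : ℕ) :
    PairBound (M.ev y t (2 * r * N) u) (M.ev y t (2 * r * N) v) (B * ρ ^ p)
      (B * ((2 * θ) ^ goodPairs S r t N * (θ⁻¹) ^ p
        * (ENNReal.ofReal (expSum a t (t + 2 * r * N)) * V) ^ 2)) := by
  have hθt : θ ≠ ∞ := ne_top_of_le_ne_top ENNReal.one_ne_top hθ
  have hθ1 : 1 ≤ θ⁻¹ := ENNReal.one_le_inv.2 hθ
  induction N generalizing t p with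
  -- With no block left the whole product goes into the error term.
  | zero =>
    intro x x'
    rw [mul_zero, M.ev_zero _ _ hu, M.ev_zero _ _ hv]
    refine le_trans ?_ le_add_self
    calc u x * v x' ≤ B * V * V := by
          gcongr
          · exact (huv x).trans (by gcongr; exact hvV x)
          · exact hvV x'
      _ = B * (1 * 1 * (1 * V) ^ 2) := by ring
      _ ≤ _ := by
          gcongr
          · simp [goodPairs]
          · exact one_le_pow₀ hθ1
          · rw [← ENNReal.ofReal_one]
            exact ENNReal.ofReal_le_ofReal (h.one_le_expSum _ _)
  | succ N ih =>
    set s := t + 2 * r with hs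
    have hmu := M.measurable_ev y s (2 * r * N) hu
    have hmv := M.measurable_ev y s (2 * r * N) hv
    have hev : ∀ {F : 𝒳 → ℝ≥0∞}, Measurable F → M.ev y t (2 * r * (N + 1)) F
        = app (M.block y r t) (app (M.block y r (t + r)) (M.ev y s (2 * r * N) F)) := fun hF => by
      rw [show 2 * r * (N + 1) = 2 * r + 2 * r * N by ring, M.ev_add _ _ _ _ hF,
        M.ev_two_mul _ _ _ (M.measurable_ev _ _ _ hF)]
    have hE : ENNReal.ofReal (expSum a t (t + 2 * r * (N + 1)))
        = ENNReal.ofReal (expSum a t s) * ENNReal.ofReal (expSum a s (s + 2 * r * N)) := by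
      rw [ofReal_expSum_mul a (by omega) (by omega), hs]
      congr 2
      ring
    rw [hev hu, hev hv, hE, goodPairs_succ]
    by_cases hS : t ∈ S ∧ t + r ∈ S
    swap
    -- Nothing is gained here: the coefficient of v v is kept and the error is multiplied by the
    -- squared mass of the pair.
    · rw [if_neg hS, add_zero]
      refine (((ih s p).app_of_le hmu hmv (h.block_univ_le (t + r))).app_of_le
        (measurable_app _ hmu) (measurable_app _ hmv) (h.block_univ_le t)).mono le_rfl ?_
      rw [hs, ← HMM.Record.mass_mul r t a]
      exact le_of_eq (by ring)
    · rw [if_pos hS]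
      cases p with
      | zero =>
        -- Without contraction the coefficient B is trivial, because u ≤ B v is preserved by the
        -- kernels.
        intro x x'
        have huv' : ∀ x, app (M.block y r t) (app (M.block y r (t + r)) (M.ev y s (2 * r * N) u)) x
            ≤ B * app (M.block y r t) (app (M.block y r (t + r)) (M.ev y s (2 * r * N) v)) x := by
          intro x
          rw [← hev hu, ← hev hv, ← M.ev_const_mul _ _ _ hv]
          exact M.ev_mono _ _ _ huv x
        refine le_trans (le_trans ?_ le_add_self) le_self_add
        rw [pow_zero, mul_one, ← mul_assoc]
        gcongr
        exact huv' x
      | succ p =>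
        have hVs : ∀ x, M.ev y s (2 * r * N) v x
            ≤ V * ENNReal.ofReal (expSum a s (s + 2 * r * N)) := fun x =>
          (M.ev_le_of_le y s _ hvV x).trans (by gcongr; exact h.ev_one_le _ _ _)
        have e1 : B * ρ ^ (p + 1) = ρ * (B * ρ ^ p) := by ring
        -- The induction hypotheses with p and p + 1 contractions are combined: the first is
        -- contracted on C × C, the second is used off it with the factor θ².
        have hmain := PairBound.app_app_of_doeblin h.measC hρ (h.doeblin t hS.1)
          (h.isSmallOff hS.1) (h.isSmallOff hS.2) ENNReal.ofReal_ne_top hmu hmv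
          (ENNReal.mul_ne_top hV ENNReal.ofReal_ne_top) hVs (ih s p) (e1 ▸ ih s (p + 1))
        rw [e1]
        refine hmain.mono le_rfl ?_
        rw [HMM.Record.mass_mul r t a, ← hs]
        set W := ENNReal.ofReal (expSum a s (s + 2 * r * N)) * V
        set E := ENNReal.ofReal (expSum a t s)
        set m := goodPairs S r s N
        have hc : θ * θ⁻¹ = 1 := ENNReal.mul_inv_cancel hθ0 hθt
        -- The weight θ^{m-p} balances the two errors: θ² θ^{-(p+1)} ≤ θ^{-p}, so their sum is at
        -- most twice the first, and this 2 enters (2θ)^{m+1}.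
        calc E ^ 2 * (B * ((2 * θ) ^ m * (θ⁻¹) ^ p * W ^ 2)
              + θ ^ 2 * (B * ((2 * θ) ^ m * (θ⁻¹) ^ (p + 1) * W ^ 2)))
            = B * ((2 * θ) ^ m * (θ⁻¹) ^ p * (E * W) ^ 2) * (1 + θ * (θ * θ⁻¹)) := by ring
          _ ≤ B * ((2 * θ) ^ m * (θ⁻¹) ^ p * (E * W) ^ 2) * 2 := by
              gcongr
              rw [hc, mul_one, ← one_add_one_eq_two]
              gcongr
          _ = B * ((2 * θ) ^ m * (θ⁻¹) ^ p * (E * W) ^ 2) * 2 * (θ * θ⁻¹) := by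
              rw [hc, mul_one]
          _ = B * ((2 * θ) ^ (m + 1) * (θ⁻¹) ^ (p + 1) * (E * W) ^ 2) := by ring
          _ = _ := by ring

end Record

/-! ### Solution of the recursions -/

section Recursion

/-- A bound for a quantity given by an affine recursion whose coefficients decay on average. -/
lemma exists_bound_of_affine_recursion {P : ℕ → ℝ → Prop} {α β : ℕ → ℝ} {N : ℕ} {x H τ : ℝ}
    (hα : ∀ i, 0 ≤ α i) (hβ : ∀ i, 0 ≤ β i)
    (step : ∀ i < N, ∀ x, 0 ≤ x → P (i + 1) x → P i (α i + β i * x))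
    (hx : 0 ≤ x) (hP : P N x) (hτ0 : 0 ≤ τ) (hτ : τ < 1) (hH : 0 ≤ H)
    (h1 : ∀ i < N, (∏ l ∈ Finset.range i, β l) * α i ≤ H * τ ^ i)
    (h2 : (∏ l ∈ Finset.range N, β l) * x ≤ H * τ ^ N) :
    ∃ x', 0 ≤ x' ∧ x' ≤ H / (1 - τ) ∧ P 0 x' := by
  -- Descending from N, the value at i times the product of the first i slopes is bounded by the
  -- part of the geometric series from i to N.
  have key : ∀ j i, i + j = N → ∃ x', 0 ≤ x' ∧ P i x' ∧
      (∏ l ∈ Finset.range i, β l) * x' ≤ H * ∑ l ∈ Finset.Ico i (N + 1), τ ^ l := by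
    intro j
    induction j with
    | zero =>
      intro i hi
      obtain rfl : i = N := by omega
      exact ⟨x, hx, hP, by simpa using h2⟩
    | succ j ih =>
      intro i hi
      obtain ⟨x', hx', hPx, hb⟩ := ih (i + 1) (by omega)
      refine ⟨α i + β i * x', add_nonneg (hα i) (mul_nonneg (hβ i) hx'),
        step i (by omega) x' hx' hPx, ?_⟩
      rw [Finset.sum_eq_sum_Ico_succ_bot (show i < N + 1 by omega)]
      rw [Finset.prod_range_succ] at hb
      have := h1 i (by omega)
      linarith
  obtain ⟨x', hx', hPx, hb⟩ := key N 0 (by omega)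
  refine ⟨x', hx', ?_, hPx⟩
  rw [Finset.prod_range_zero, one_mul, ← Finset.range_eq_Ico] at hb
  refine hb.trans ?_
  rw [div_eq_mul_inv, ← tsum_geometric_of_lt_one hτ0 hτ]
  exact mul_le_mul_of_nonneg_left ((summable_geometric_of_lt_one hτ0 hτ).sum_le_tsum _
    fun i _ => pow_nonneg hτ0 i) hH

/-- Bounds for the sums of `a` and for the number of exceptional blocks over windows `[j, ·)` below
the time `n`. -/
structure WindowBound (r n : ℕ) (c ε b : ℝ) (a : ℕ → ℝ) (S : Set ℕ) : Prop where
  sum_le : ∀ j k, j ≤ k → k ≤ n → ∑ i ∈ Finset.Ico j k, a i ≤ c * (k - j) + ε * (n - j) + b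
  bad_le : ∀ j N, j + N * r ≤ n →
    (∑ i ∈ Finset.range N, open Classical in if j + i * r ∈ S then (0 : ℝ) else 1)
      ≤ N / 3 + ε * (n - j) + b

variable {r n : ℕ} {c ε b : ℝ} {a : ℕ → ℝ} {S : Set ℕ}

/-- Every pair that fails contains at least one exceptional block. -/
lemma sub_bad_le_goodPairs (S : Set ℕ) (r t N : ℕ) : (N : ℝ)
    - (∑ i ∈ Finset.range (2 * N), open Classical in if t + i * r ∈ S then (0 : ℝ) else 1)
      ≤ goodPairs S r t N := by
  classical
  induction N generalizing t with
  | zero => simp [goodPairs]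
  | succ N ih =>
    rw [goodPairs_succ, show 2 * (N + 1) = 2 * N + 1 + 1 by ring, Finset.sum_range_succ',
      Finset.sum_range_succ']
    have hsum : (∑ i ∈ Finset.range (2 * N), if t + (i + 1 + 1) * r ∈ S then (0 : ℝ) else 1)
        = ∑ i ∈ Finset.range (2 * N), if t + 2 * r + i * r ∈ S then (0 : ℝ) else 1 :=
      Finset.sum_congr rfl fun i _ => by rw [show t + (i + 1 + 1) * r = t + 2 * r + i * r by ring]
    rw [hsum]
    have := ih (t + 2 * r)
    have e0 : t + 0 * r = t := by ring
    have e1 : t + (0 + 1) * r = t + r := by ring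
    rw [e0, e1]
    push_cast
    by_cases h0 : t ∈ S <;> by_cases h1 : t + r ∈ S <;> simp [h0, h1] <;> linarith

/-- Among 2N blocks at most 2N/3 are exceptional, up to the error of the window; N/3 good pairs
remain. This is where the constant 2/3 in (A1) matters. -/
lemma WindowBound.goodPairs_ge (h : WindowBound r n c ε b a S) {t N : ℕ} (htN : t + 2 * r * N ≤ n) :
    (N : ℝ) / 3 - (ε * (n - t) + b) ≤ goodPairs S r t N := by
  have h1 := h.bad_le t (2 * N) (by nlinarith)
  have h2 := sub_bad_le_goodPairs S r t N
  push_cast at h1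
  linarith

lemma WindowBound.expSum_le (h : WindowBound r n c ε b a S) {j k : ℕ} (hjk : j ≤ k) (hk : k ≤ n) :
    expSum a j k ≤ Real.exp (c * (k - j) + ε * (n - j) + b) :=
  Real.exp_le_exp.2 (h.sum_le j k hjk hk)

lemma prod_pairCoeff {η : ℝ} (S : Set ℕ) (r t N : ℕ) :
    ∏ l ∈ Finset.range N, pairCoeff S r η (t + 2 * r * l) = (2 * η) ^ goodPairs S r t N := by
  classical
  rw [goodPairs, ← Finset.prod_pow_eq_pow_sum]
  refine Finset.prod_congr rfl fun l _ => ?_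
  rw [pairCoeff]
  split_ifs <;> simp

lemma prod_expSum (a : ℕ → ℝ) (r t N : ℕ) :
    ∏ l ∈ Finset.range N, expSum a (t + 2 * r * l) (t + 2 * r * l + 2 * r)
      = expSum a t (t + 2 * r * N) := by
  induction N with
  | zero => simp [expSum]
  | succ N ih =>
    rw [Finset.prod_range_succ, ih, expSum_mul a (by omega) (by omega)]
    congr 1
    ring

/-- The product of the coefficients of the recursions over `N` pairs of blocks. -/
lemma WindowBound.prod_coeff_le (h : WindowBound r n c ε b a S) {η Λ : ℝ} (hη : 0 < η)
    (hΛ : Λ = -Real.log (2 * η)) (hΛc : 3 * (8 * r * c + 1) ≤ Λ) (hc : 0 ≤ c)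
    {t N : ℕ} (htN : t + 2 * r * N ≤ n) :
    ∏ l ∈ Finset.range N, (pairCoeff S r η (t + 2 * r * l)
        * expSum a (t + 2 * r * l) (t + 2 * r * l + 2 * r) ^ 4)
      ≤ Real.exp (-N + (Λ + 4) * (ε * (n - t) + b)) := by
  rw [Finset.prod_mul_distrib, prod_pairCoeff, Finset.prod_pow, prod_expSum]
  have h1 := h.goodPairs_ge htN
  have h2 := h.expSum_le (show t ≤ t + 2 * r * N by omega) htN
  have h3 : (2 * η) ^ goodPairs S r t N = Real.exp (-Λ * goodPairs S r t N) := by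
    rw [hΛ, neg_neg, mul_comm (Real.log _), Real.exp_nat_mul, Real.exp_log (by positivity)]
  have hΛ0 : 0 ≤ Λ := le_trans (by positivity) hΛc
  rw [h3]
  calc Real.exp (-Λ * goodPairs S r t N) * expSum a t (t + 2 * r * N) ^ 4
      ≤ Real.exp (-Λ * goodPairs S r t N)
        * Real.exp (c * ((t + 2 * r * N : ℕ) - t) + ε * (n - t) + b) ^ 4 := by
        have := expSum_pos a t (t + 2 * r * N)
        gcongr
    _ = Real.exp (-Λ * goodPairs S r t N + 4 * (c * (2 * r * N) + (ε * (n - t) + b))) := by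
        rw [← Real.exp_nat_mul, ← Real.exp_add]
        congr 1
        push_cast
        ring
    _ ≤ _ := by
        refine Real.exp_le_exp.2 ?_
        -- The N/3 good pairs give exp(-ΛN/3), the masses to the fourth power over 2rN times give
        -- exp(8rcN); the condition on Λ leaves exp(-N).
        have h4 : Λ * (N / 3 - (ε * (n - t) + b)) ≤ Λ * goodPairs S r t N :=
          mul_le_mul_of_nonneg_left h1 hΛ0
        have h5 : 3 * (8 * r * c + 1) * (N / 3 : ℝ) ≤ Λ * (N / 3) := by gcongr
        nlinarith

end Recursion

/-! ### Subexponential bounds for the ratios of `L⟨y_{k:n}⟩ 1` and for the predictor mass of D -/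

section Bounds

variable {𝒳 𝒴 : Type*} [MeasurableSpace 𝒳] [MeasurableSpace 𝒴]
variable {M : HMM 𝒳 𝒴} {y : ℕ → 𝒴} {r : ℕ} {C D : Set 𝒳} {e η : ℝ} {a : ℕ → ℝ} {S : Set ℕ}
  {n : ℕ} {c ε b Λ : ℝ}

/-- The ratio of the extreme values of `L⟨y_{k:n}⟩ 1`, for a record with fewer than two blocks. -/
lemma HMM.Record.ratioBound_last
    (h : M.Record y r C D (ENNReal.ofReal e) (ENNReal.ofReal η) a S) {t l : ℕ} (hl : l ≤ 2 * r) :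
    RatioBound D (M.ev y t l 1) (ENNReal.ofReal (expSum a t (t + 2 * r) ^ 2)) := by
  intro x y' hy'
  have h1 : ENNReal.ofReal (Real.exp (-a t - a (t + r)))
      ≤ M.ev y t l 1 y' * ENNReal.ofReal (expSum a (t + l) (t + 2 * r)) := by
    calc _ ≤ app (M.block y r t) (app (M.block y r (t + r)) (D.indicator 1)) y' :=
          h.le_return_two t hy'
      _ ≤ M.ev y t (2 * r) 1 y' := by
          rw [← M.ev_two_mul y r t (measurable_one.indicator h.measD)]
          exact M.ev_mono _ _ _ (Set.indicator_le_self' fun _ _ => zero_le_one) _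
      _ = M.ev y t l (M.ev y (t + l) (2 * r - l) 1) y' := by
          rw [← M.ev_add _ _ _ _ measurable_one]
          congr 1
          omega
      _ ≤ _ := by
          rw [mul_comm (M.ev y t l 1 y')]
          refine M.ev_le_of_le _ _ _ (fun x => (h.ev_one_le _ _ x).trans_eq ?_) _
          congr 2
          omega
  calc M.ev y t l 1 x ≤ ENNReal.ofReal (expSum a t (t + l)) * 1 := by
        rw [mul_one]; exact h.ev_one_le _ _ _
    _ ≤ ENNReal.ofReal (expSum a t (t + l)) * (ENNReal.ofReal (Real.exp (-a t - a (t + r)))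
        * ENNReal.ofReal (expSum a t (t + 2 * r))) := by gcongr; exact h.one_le_return_mul t
    _ ≤ ENNReal.ofReal (expSum a t (t + l)) * (M.ev y t l 1 y'
        * ENNReal.ofReal (expSum a (t + l) (t + 2 * r))
        * ENNReal.ofReal (expSum a t (t + 2 * r))) := by gcongr
    _ = (ENNReal.ofReal (expSum a t (t + l)) * ENNReal.ofReal (expSum a (t + l) (t + 2 * r)))
        * ENNReal.ofReal (expSum a t (t + 2 * r)) * M.ev y t l 1 y' := by ring
    _ = _ := by
        rw [ofReal_expSum_mul a (by omega) (by omega), sq,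
          ENNReal.ofReal_mul (expSum_pos _ _ _).le]

/-- The constant in the bounds of the ratios. -/
def ratioConst (r : ℕ) (c e : ℝ) : ℝ :=
  (e⁻¹) ^ 2 * Real.exp (4 * r * c + 1) / (1 - Real.exp (-(1 / 2)))

lemma exp_neg_half_lt_one : Real.exp (-(1 / 2)) < 1 := by
  rw [Real.exp_lt_one_iff]
  norm_num

/-- A bound for the ratio of the extreme values of `L⟨y_{k:k+2rN+l-1}⟩ 1`. -/
lemma HMM.Record.exists_ratioBound
    (h : M.Record y r C D (ENNReal.ofReal e) (ENNReal.ofReal η) a S)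
    (hw : WindowBound r n c ε b a S) (he : 0 < e) (he1 : e ≤ 1) (hη : 0 < η)
    (hΛ : Λ = -Real.log (2 * η)) (hΛc : 3 * (8 * r * c + 1) ≤ Λ) (hc : 0 ≤ c) (hε : 0 ≤ ε)
    (hb : 0 ≤ b) {k N l : ℕ} (hl : l ≤ 2 * r) (hkn : k + 2 * r * N + 2 * r ≤ n) :
    RatioBound D (M.ev y k (2 * r * N + l) 1)
      (ENNReal.ofReal (ratioConst r c e * Real.exp ((Λ + 6) * (ε * (n - k) + b)))) := by
  set W := ε * (n - k) + b with hW
  have hkn' : (k : ℝ) ≤ n := by exact_mod_cast (by omega : k ≤ n)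
  have hW0 : 0 ≤ W := by
    have : 0 ≤ ε * (n - k) := mul_nonneg hε (by linarith)
    linarith
  have hΛ0 : 0 ≤ Λ := le_trans (by positivity) hΛc
  have hE : ∀ i ≤ N, expSum a (k + 2 * r * i) (k + 2 * r * i + 2 * r) ^ 2
      ≤ Real.exp (4 * r * c + 2 * W) := by
    intro i hi
    have hi' : 2 * r * i ≤ 2 * r * N := Nat.mul_le_mul_left _ hi
    have h1 := hw.expSum_le (show k + 2 * r * i ≤ k + 2 * r * i + 2 * r by omega) (by omega)
    calc _ ≤ Real.exp _ ^ 2 := pow_le_pow_left₀ (expSum_pos _ _ _).le h1 2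
      _ ≤ _ := by
        rw [← Real.exp_nat_mul]
        refine Real.exp_le_exp.2 ?_
        push_cast
        have : 0 ≤ ε * (2 * r * i) := by positivity
        nlinarith
  have hee : 1 ≤ (e⁻¹) ^ 2 := one_le_pow₀ ((one_le_inv₀ he).2 he1)
  obtain ⟨x, hx0, hx, hP⟩ := exists_bound_of_affine_recursion
    (P := fun i x => RatioBound D (M.ev y (k + 2 * r * i) (2 * r * (N - i) + l) 1)
      (ENNReal.ofReal x))
    (α := fun i => (e⁻¹) ^ 2 * expSum a (k + 2 * r * i) (k + 2 * r * i + 2 * r) ^ 2)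
    (β := fun i => pairCoeff S r η (k + 2 * r * i)
      * expSum a (k + 2 * r * i) (k + 2 * r * i + 2 * r) ^ 4)
    (N := N) (x := expSum a (k + 2 * r * N) (k + 2 * r * N + 2 * r) ^ 2)
    (H := (e⁻¹) ^ 2 * Real.exp (4 * r * c + (Λ + 6) * W)) (τ := Real.exp (-(1 / 2)))
    (fun i => by positivity)
    (fun i => mul_nonneg (by unfold pairCoeff; split_ifs <;> positivity) (by positivity))
    (fun i hi x hx hP => by
      have := h.ratioBound_step he hη (k + 2 * r * i) (M.measurable_ev _ _ _ measurable_one) hx hP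
      rw [show k + 2 * r * (i + 1) = k + 2 * r * i + 2 * r by ring,
        ← M.ev_add _ _ _ _ measurable_one] at this
      convert this using 2
      obtain ⟨j, rfl⟩ : ∃ j, N = i + 1 + j := ⟨N - (i + 1), by omega⟩
      rw [show i + 1 + j - i = j + 1 by omega, show i + 1 + j - (i + 1) = j by omega]
      ring)
    (by positivity) (by simpa using h.ratioBound_last hl) (Real.exp_pos _).le exp_neg_half_lt_one
    (by positivity)
    (fun i hi => by
      have h1 := hw.prod_coeff_le hη hΛ hΛc hc (t := k) (N := i)
        (by have : 2 * r * i ≤ 2 * r * N := Nat.mul_le_mul_left _ hi.le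
            omega)
      calc _ ≤ Real.exp (-i + (Λ + 4) * W) * ((e⁻¹) ^ 2 * Real.exp (4 * r * c + 2 * W)) := by
            gcongr
            exact hE i hi.le
        _ = (e⁻¹) ^ 2 * Real.exp (4 * r * c + (Λ + 6) * W - i) := by
            rw [mul_left_comm, ← Real.exp_add]; congr 2; ring
        _ ≤ (e⁻¹) ^ 2 * Real.exp (4 * r * c + (Λ + 6) * W + i * (-(1 / 2))) := by
            gcongr
            have : (0 : ℝ) ≤ i := by positivity
            linarith
        _ = _ := by rw [Real.exp_add, Real.exp_nat_mul, ← mul_assoc])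
    (by
      have h1 := hw.prod_coeff_le hη hΛ hΛc hc (t := k) (N := N) (by omega)
      calc _ ≤ Real.exp (-N + (Λ + 4) * W) * (1 * Real.exp (4 * r * c + 2 * W)) := by
            rw [one_mul]
            gcongr
            exact hE N le_rfl
        _ ≤ Real.exp (-N + (Λ + 4) * W) * ((e⁻¹) ^ 2 * Real.exp (4 * r * c + 2 * W)) := by
            gcongr
        _ = (e⁻¹) ^ 2 * Real.exp (4 * r * c + (Λ + 6) * W - N) := by
            rw [mul_left_comm, ← Real.exp_add]; congr 2; ring
        _ ≤ (e⁻¹) ^ 2 * Real.exp (4 * r * c + (Λ + 6) * W + N * (-(1 / 2))) := by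
            gcongr
            have : (0 : ℝ) ≤ N := by positivity
            linarith
        _ = _ := by rw [Real.exp_add, Real.exp_nat_mul, ← mul_assoc])
  intro x' y' hy'
  have h3 := hP x' y' hy'
  simp only [mul_zero, add_zero, Nat.sub_zero] at h3
  refine h3.trans (mul_le_mul_left (ENNReal.ofReal_le_ofReal (hx.trans ?_)) _)
  rw [ratioConst, div_mul_eq_mul_div, mul_assoc (_ ^ 2), ← Real.exp_add]
  have := sub_pos.2 exp_neg_half_lt_one
  gcongr
  linarith

/-- A bound for the inverse mass of `D` under the predictors. -/
lemma HMM.Record.upred_one_le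
    (h : M.Record y r C D (ENNReal.ofReal e) (ENNReal.ofReal η) a S)
    (hw : WindowBound r n c ε b a S) (he : 0 < e) (he1 : e ≤ 1) (hη : 0 < η)
    (hΛ : Λ = -Real.log (2 * η)) (hΛc : 3 * (8 * r * c + 1) ≤ Λ) (hc : 0 ≤ c) (hε : 0 ≤ ε)
    (hεΛ : (Λ + 6) * (2 * r * ε) ≤ 1 / 2) (hb : 0 ≤ b) {χ : Measure 𝒳}
    (hχ : ∀ s < 2 * r, M.upred χ y s 1
      ≤ ENNReal.ofReal (Real.exp b) * M.upred χ y s (D.indicator 1)) {k : ℕ} (hkn : k ≤ n) :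
    M.upred χ y k 1 ≤ ENNReal.ofReal (ratioConst r c e * Real.exp ((Λ + 6) * (ε * (n - k) + b)))
      * M.upred χ y k (D.indicator 1) := by
  have hr := h.one_le
  set N := k / (2 * r) with hN
  have hdm : 2 * r * N + k % (2 * r) = k := Nat.div_add_mod k (2 * r)
  have hmod : k % (2 * r) < 2 * r := Nat.mod_lt _ (by omega)
  set s := k % (2 * r) with hs
  set W := ε * (n - k) + b with hW
  have hkn' : (k : ℝ) ≤ n := by exact_mod_cast hkn
  have hbW : b ≤ W := by
    have : 0 ≤ ε * (n - k) := mul_nonneg hε (by linarith)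
    linarith
  have hW0 : 0 ≤ W := hb.trans hbW
  have hΛ0 : 0 ≤ Λ := le_trans (by positivity) hΛc
  have hee : 1 ≤ (e⁻¹) ^ 2 := one_le_pow₀ ((one_le_inv₀ he).2 he1)
  -- Here i counts pairs backwards from k. The windows start at k - 2ri, so their error exceeds W by
  -- 2rεi; this growth is why ε must be small compared to 1/Λ.
  have hprod : ∀ i ≤ N, ∏ l ∈ Finset.range i, (pairCoeff S r η (s + 2 * r * (N - 1 - l))
      * expSum a (s + 2 * r * (N - 1 - l)) (s + 2 * r * (N - 1 - l) + 2 * r) ^ 4)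
      ≤ Real.exp (-i + (Λ + 4) * (W + 2 * r * ε * i)) := by
    intro i hi
    have hi' : 2 * r * i ≤ 2 * r * N := Nat.mul_le_mul_left _ hi
    have ht : s + 2 * r * (N - i) + 2 * r * i = k := by
      rw [add_assoc, ← Nat.mul_add, Nat.sub_add_cancel hi]; omega
    have h1 := hw.prod_coeff_le hη hΛ hΛc hc (t := s + 2 * r * (N - i)) (N := i) (by omega)
    rw [← Finset.prod_range_reflect] at h1
    have hcast : (((s + 2 * r * (N - i) : ℕ) : ℝ)) = k - 2 * r * i := by
      rw [← ht]; push_cast; ring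
    rw [hcast] at h1
    refine le_trans (le_of_eq ?_) (h1.trans_eq ?_)
    · refine Finset.prod_congr rfl fun l hl => ?_
      have hl := Finset.mem_range.1 hl
      have : s + 2 * r * (N - i) + 2 * r * (i - 1 - l) = s + 2 * r * (N - 1 - l) := by
        rw [add_assoc, ← Nat.mul_add]
        congr 2
        omega
      rw [this]
    · congr 1
      rw [hW]; ring
  -- The recursion ends at s = k mod 2r, where `hχ` applies. Half of the decay exp(-i) pays for the
  -- growing window errors, which leaves τ = exp(-1/2); the 1 in H absorbs the remaining 4rε.
  obtain ⟨x, hx0, hx, hP⟩ := exists_bound_of_affine_recursion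
    (P := fun i x => M.upred χ y (s + 2 * r * (N - i)) 1
      ≤ ENNReal.ofReal x * M.upred χ y (s + 2 * r * (N - i)) (D.indicator 1))
    (α := fun i => (e⁻¹) ^ 2
      * expSum a (s + 2 * r * (N - 1 - i)) (s + 2 * r * (N - 1 - i) + 2 * r) ^ 2)
    (β := fun i => pairCoeff S r η (s + 2 * r * (N - 1 - i))
      * expSum a (s + 2 * r * (N - 1 - i)) (s + 2 * r * (N - 1 - i) + 2 * r) ^ 4)
    (N := N) (x := Real.exp b)
    (H := (e⁻¹) ^ 2 * Real.exp (4 * r * c + 1 + (Λ + 6) * W)) (τ := Real.exp (-(1 / 2)))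
    (fun i => by positivity)
    (fun i => mul_nonneg (by unfold pairCoeff; split_ifs <;> positivity) (by positivity))
    (fun i hi x hx hP => by
      rw [show N - (i + 1) = N - 1 - i by omega] at hP
      have := h.upred_step he hη χ _ hx hP
      rwa [show s + 2 * r * (N - 1 - i) + 2 * r = s + 2 * r * (N - i) by
        rw [show N - i = N - 1 - i + 1 by omega]; ring] at this ⊢)
    (Real.exp_pos _).le (by simpa using hχ s hmod) (Real.exp_pos _).le exp_neg_half_lt_one
    (by positivity)
    (fun i hi => by
      have h1 := hprod i hi.le
      have ht : s + 2 * r * (N - 1 - i) + 2 * r * (i + 1) = k := by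
        rw [add_assoc, ← Nat.mul_add, show N - 1 - i + (i + 1) = N by omega]; omega
      have h2 := hw.expSum_le (j := s + 2 * r * (N - 1 - i))
        (k := s + 2 * r * (N - 1 - i) + 2 * r) (by omega) (by nlinarith)
      have hcast : (((s + 2 * r * (N - 1 - i) : ℕ) : ℝ)) = k - 2 * r * (i + 1) := by
        rw [← ht]; push_cast; ring
      have h3 : expSum a (s + 2 * r * (N - 1 - i)) (s + 2 * r * (N - 1 - i) + 2 * r) ^ 2
          ≤ Real.exp (4 * r * c + 2 * (W + 2 * r * ε * (i + 1))) := by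
        refine (pow_le_pow_left₀ (expSum_pos _ _ _).le h2 2).trans (le_of_eq ?_)
        rw [← Real.exp_nat_mul, Nat.cast_add, hcast, hW]
        congr 1
        push_cast
        ring
      have hi0 : (0 : ℝ) ≤ i := by positivity
      calc _ ≤ Real.exp (-i + (Λ + 4) * (W + 2 * r * ε * i))
            * ((e⁻¹) ^ 2 * Real.exp (4 * r * c + 2 * (W + 2 * r * ε * (i + 1)))) := by gcongr
        _ = (e⁻¹) ^ 2 * Real.exp (4 * r * c + (Λ + 6) * W - i + (Λ + 6) * (2 * r * ε) * i
              + 2 * (2 * r * ε)) := by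
            rw [mul_left_comm, ← Real.exp_add]; congr 2; ring
        _ ≤ (e⁻¹) ^ 2 * Real.exp (4 * r * c + 1 + (Λ + 6) * W + i * (-(1 / 2))) := by
            refine mul_le_mul_of_nonneg_left (Real.exp_le_exp.2 ?_) (by positivity)
            have h5 := mul_le_mul_of_nonneg_right hεΛ hi0
            have h6 : 0 ≤ 2 * r * ε := by positivity
            nlinarith
        _ = _ := by rw [Real.exp_add, Real.exp_nat_mul, ← mul_assoc])
    (by
      have h1 := hprod N le_rfl
      have hi0 : (0 : ℝ) ≤ N := by positivity
      calc _ ≤ Real.exp (-N + (Λ + 4) * (W + 2 * r * ε * N)) * (1 * Real.exp b) := by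
            rw [one_mul]; gcongr
        _ ≤ Real.exp (-N + (Λ + 4) * (W + 2 * r * ε * N)) * ((e⁻¹) ^ 2 * Real.exp b) := by gcongr
        _ = (e⁻¹) ^ 2 * Real.exp (-N + (Λ + 4) * (W + 2 * r * ε * N) + b) := by
            rw [mul_left_comm, ← Real.exp_add]
        _ ≤ (e⁻¹) ^ 2 * Real.exp (4 * r * c + 1 + (Λ + 6) * W + N * (-(1 / 2))) := by
            refine mul_le_mul_of_nonneg_left (Real.exp_le_exp.2 ?_) (by positivity)
            have h5 := mul_le_mul_of_nonneg_right hεΛ hi0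
            have h6 : 0 ≤ r * ε * N := by positivity
            have h7 : 0 ≤ r * c := by positivity
            nlinarith
        _ = _ := by rw [Real.exp_add, Real.exp_nat_mul, ← mul_assoc])
  have hsk : s + 2 * r * (N - 0) = k := by rw [Nat.sub_zero]; omega
  rw [hsk] at hP
  refine hP.trans (mul_le_mul_left (ENNReal.ofReal_le_ofReal (hx.trans_eq ?_)) _)
  rw [ratioConst, div_mul_eq_mul_div, mul_assoc (_ ^ 2), ← Real.exp_add]

end Bounds

/-! ### The asymptotic variance in terms of the unnormalized kernels -/

section Variance

variable {𝒳 𝒴 : Type*} [MeasurableSpace 𝒳] [MeasurableSpace 𝒴]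
variable (M : HMM 𝒳 𝒴) (χ : Measure 𝒳) (y : ℕ → 𝒴)

/-- The density `g(·, y_n)`. -/
def HMM.dens (n : ℕ) (x : 𝒳) : ℝ≥0∞ := ENNReal.ofReal (M.g x (y n))

/-- The function `g(·, y_n) (h + B)`. -/
def HMM.densMul (n : ℕ) (h : 𝒳 → ℝ) (B : ℝ) (x : 𝒳) : ℝ≥0∞ :=
  ENNReal.ofReal (M.g x (y n) * (h x + B))

lemma HMM.measurable_dens (n : ℕ) : Measurable (M.dens y n) := M.measurable_ofReal_g _

lemma HMM.measurable_densMul (n : ℕ) {h : 𝒳 → ℝ} (hh : Measurable h) (B : ℝ) :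
    Measurable (M.densMul y n h B) :=
  ((M.measurable_g_left _).mul (hh.add_const B)).ennreal_ofReal

lemma HMM.densMul_le (n : ℕ) {h : 𝒳 → ℝ} {B : ℝ} (hB : ∀ x, |h x| ≤ B) (x : 𝒳) :
    M.densMul y n h B x ≤ ENNReal.ofReal (2 * B) * M.dens y n x := by
  have h1 := abs_le.1 (hB x)
  rw [HMM.densMul, HMM.dens, ← ENNReal.ofReal_mul (by linarith), mul_comm]
  refine ENNReal.ofReal_le_ofReal (mul_le_mul_of_nonneg_right (by linarith) (M.g_nonneg _ _))

/-- The summand of index `k` of the asymptotic variance of the filter. -/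
def HMM.varTerm (n : ℕ) (h : 𝒳 → ℝ) (B : ℝ) (k : ℕ) : ℝ :=
  ((M.upred χ y k 1)⁻¹ * M.upred χ y k fun x => ENNReal.ofReal
    ((((M.ev y k (n - k) (M.densMul y n h B) x).toReal
      - (M.upred χ y n (M.densMul y n h B)).toReal / (M.upred χ y n (M.dens y n)).toReal
        * (M.ev y k (n - k) (M.dens y n) x).toReal)
      / ((M.upred χ y n (M.dens y n)).toReal / (M.upred χ y k 1).toReal)) ^ 2)).toReal

variable {M χ y}

lemma HMM.lintegral_pred (k : ℕ) {F : 𝒳 → ℝ≥0∞} (hF : Measurable F) :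
    ∫⁻ x, F x ∂(M.pred χ y k) = (M.upred χ y k 1)⁻¹ * M.upred χ y k F := by
  rw [HMM.pred, lintegral_smul_measure, M.lintegral_bind _ _ _ hF, ← M.lintegral_bind _ _ _
    measurable_one]
  simp

lemma HMM.upred_mono (k : ℕ) {F F' : 𝒳 → ℝ≥0∞} (h : ∀ x, F x ≤ F' x) :
    M.upred χ y k F ≤ M.upred χ y k F' :=
  lintegral_mono fun x => M.ev_mono y 0 k h x

lemma HMM.upred_const_mul (k : ℕ) {F : 𝒳 → ℝ≥0∞} (hF : Measurable F) (c : ℝ≥0∞) :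
    M.upred χ y k (fun x => c * F x) = c * M.upred χ y k F := by
  rw [HMM.upred, lintegral_congr fun x => M.ev_const_mul y 0 k hF c x,
    lintegral_const_mul _ (M.measurable_ev _ _ _ hF), HMM.upred]

lemma HMM.integral_toReal_pred (k : ℕ) {F : 𝒳 → ℝ≥0∞} (hF : Measurable F)
    {c : ℝ≥0∞} (hc : c ≠ ∞) (hFc : ∀ x, F x ≤ c) :
    ∫ x, (F x).toReal ∂(M.pred χ y k) = (M.upred χ y k F).toReal / (M.upred χ y k 1).toReal := by
  rw [integral_toReal hF.aemeasurable (.of_forall fun x => (hFc x).trans_lt hc.lt_top),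
    HMM.lintegral_pred k hF, ENNReal.toReal_mul, ENNReal.toReal_inv, mul_comm, div_eq_mul_inv]

variable [IsProbabilityMeasure χ]

lemma HMM.upred_ne_zero (hg : ∀ x y, 0 < M.g x y) (k : ℕ) {F : 𝒳 → ℝ≥0∞} (hF : Measurable F)
    (hF0 : ∀ x, 0 < F x) : M.upred χ y k F ≠ 0 := by
  refine ne_of_gt ?_
  rw [HMM.upred, lintegral_pos_iff_support (M.measurable_ev _ _ _ hF)]
  have : Function.support (M.ev y 0 k F) = Set.univ := by
    ext x'; simpa using (M.ev_pos hg y 0 k hF hF0 x').ne'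
  simp [this]

lemma HMM.upred_one_ne_top {G : ℕ → ℝ} (hG : ∀ i x, M.g x (y i) ≤ Real.exp (G i)) (k : ℕ) :
    M.upred χ y k 1 ≠ ∞ := by
  refine ne_top_of_le_ne_top ?_ (lintegral_mono fun x => M.ev_one_le_exp hG 0 k x)
  rw [lintegral_const, measure_univ, mul_one]
  exact ENNReal.ofReal_ne_top

lemma HMM.upred_ne_top {G : ℕ → ℝ} (hG : ∀ i x, M.g x (y i) ≤ Real.exp (G i)) (k : ℕ)
    {F : 𝒳 → ℝ≥0∞} {c : ℝ≥0∞} (hc : c ≠ ∞) (hF : ∀ x, F x ≤ c) : M.upred χ y k F ≠ ∞ := by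
  refine ne_top_of_le_ne_top (ENNReal.mul_ne_top hc (HMM.upred_one_ne_top (χ := χ) hG k)) ?_
  rw [← HMM.upred_const_mul k measurable_one]
  exact HMM.upred_mono k (by simpa using hF)

lemma HMM.isProbabilityMeasure_pred (hg : ∀ x y, 0 < M.g x y) {G : ℕ → ℝ}
    (hG : ∀ i x, M.g x (y i) ≤ Real.exp (G i)) (k : ℕ) :
    IsProbabilityMeasure (M.pred χ y k) := by
  refine ⟨?_⟩
  have h := HMM.lintegral_pred (M := M) (χ := χ) (y := y) k (F := 1) measurable_one
  rw [ENNReal.inv_mul_cancel (HMM.upred_ne_zero hg k measurable_one fun _ => by simp)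
    (HMM.upred_one_ne_top hG k)] at h
  simpa using h

lemma HMM.dens_le {G : ℕ → ℝ} (hG : ∀ i x, M.g x (y i) ≤ Real.exp (G i)) (n : ℕ) (x : 𝒳) :
    M.dens y n x ≤ ENNReal.ofReal (Real.exp (G n)) :=
  ENNReal.ofReal_le_ofReal (hG n x)

/-- The integral of a bounded function under the filter distribution. -/
lemma HMM.integral_filt_add (hg : ∀ x y, 0 < M.g x y) {G : ℕ → ℝ}
    (hG : ∀ i x, M.g x (y i) ≤ Real.exp (G i)) (n : ℕ) {h : 𝒳 → ℝ} (hh : Measurable h) {B : ℝ}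
    (hB : ∀ x, |h x| ≤ B) :
    ∫ x, h x ∂(M.filt χ y n) + B = (M.upred χ y n (M.densMul y n h B)).toReal
      / (M.upred χ y n (M.dens y n)).toReal := by
  have hZ0 : M.upred χ y n 1 ≠ 0 := HMM.upred_ne_zero hg n measurable_one fun _ => by simp
  have hZt : M.upred χ y n 1 ≠ ∞ := HMM.upred_one_ne_top hG n
  have hd0 : M.upred χ y n (M.dens y n) ≠ 0 :=
    HMM.upred_ne_zero hg n (M.measurable_dens y n) fun x => by simpa [HMM.dens] using hg x (y n)
  have hdt : M.upred χ y n (M.dens y n) ≠ ∞ :=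
    HMM.upred_ne_top hG n ENNReal.ofReal_ne_top (HMM.dens_le hG n)
  have hFint : ∀ {F : 𝒳 → ℝ≥0∞}, Measurable F → ∫⁻ x, F x ∂(M.filt χ y n)
      = (M.upred χ y n (M.dens y n))⁻¹ * M.upred χ y n (fun x => M.dens y n x * F x) := by
    intro F hF
    have hm := (M.measurable_dens y n).mul hF
    rw [HMM.filt, HMM.update, lintegral_smul_measure,
      lintegral_withDensity_eq_lintegral_mul _ (M.measurable_ofReal_g (y n)) hF]
    have e1 := HMM.lintegral_pred (M := M) (χ := χ) (y := y) n (M.measurable_dens y n)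
    have e2 := HMM.lintegral_pred (M := M) (χ := χ) (y := y) n hm
    change ∫⁻ x, ENNReal.ofReal (M.g x (y n)) ∂_ = _ at e1
    change ∫⁻ x, ((fun x => ENNReal.ofReal (M.g x (y n))) * F) x ∂_ = _ at e2
    rw [e1, e2, smul_eq_mul, ENNReal.mul_inv (Or.inr hdt) (Or.inr hd0), inv_inv]
    calc M.upred χ y n 1 * (M.upred χ y n (M.dens y n))⁻¹
          * ((M.upred χ y n 1)⁻¹ * M.upred χ y n (fun x => M.dens y n x * F x))
        = (M.upred χ y n 1 * (M.upred χ y n 1)⁻¹) * ((M.upred χ y n (M.dens y n))⁻¹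
          * M.upred χ y n (fun x => M.dens y n x * F x)) := by ring
      _ = _ := by rw [ENNReal.mul_inv_cancel hZ0 hZt, one_mul]
  have hprob : IsProbabilityMeasure (M.filt χ y n) := by
    refine ⟨?_⟩
    have := hFint (F := 1) measurable_one
    simp only [Pi.one_apply, mul_one, lintegral_one] at this
    rw [this]
    exact ENNReal.inv_mul_cancel hd0 hdt
  have hi : Integrable h (M.filt χ y n) :=
    Integrable.of_bound hh.aestronglyMeasurable B (.of_forall hB)
  have h1 : ∫ x, h x ∂(M.filt χ y n) + B = ∫ x, (h x + B) ∂(M.filt χ y n) := by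
    rw [integral_add hi (integrable_const B)]; simp
  have h0 : ∀ x, 0 ≤ h x + B := fun x => by linarith [(abs_le.1 (hB x)).1]
  rw [h1, integral_eq_lintegral_of_nonneg_ae (.of_forall h0)
    (hh.add_const B).aestronglyMeasurable, hFint (hh.add_const B).ennreal_ofReal,
    ENNReal.toReal_mul, ENNReal.toReal_inv, mul_comm, div_eq_mul_inv]
  congr 3
  ext x
  rw [HMM.densMul, HMM.dens, ENNReal.ofReal_mul (M.g_nonneg _ _)]

/-- The asymptotic variance of the filter in terms of the unnormalized kernels. -/
theorem HMM.filtVar_eq (hg : ∀ x y, 0 < M.g x y) {G : ℕ → ℝ}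
    (hG : ∀ i x, M.g x (y i) ≤ Real.exp (G i)) (n : ℕ) {h : 𝒳 → ℝ} (hh : Measurable h) {B : ℝ}
    (hB : ∀ x, |h x| ≤ B) :
    M.filtVar χ y n h = ∑ k ∈ Finset.range (n + 1), M.varTerm χ y n h B k := by
  set c := ∫ x, h x ∂(M.filt χ y n) with hc
  set U := M.upred χ y n (M.densMul y n h B) with hU
  set V := M.upred χ y n (M.dens y n) with hV
  have hcB : c + B = U.toReal / V.toReal := HMM.integral_filt_add hg hG n hh hB
  have hmd := M.measurable_dens y n
  have hmm := M.measurable_densMul y n hh B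
  have hdle := HMM.dens_le hG n
  have hmle : ∀ x, M.densMul y n h B x
      ≤ ENNReal.ofReal (2 * B) * ENNReal.ofReal (Real.exp (G n)) := fun x =>
    (M.densMul_le y n hB x).trans (mul_le_mul_right (hdle x) _)
  have hmt : ENNReal.ofReal (2 * B) * ENNReal.ofReal (Real.exp (G n)) ≠ ∞ :=
    ENNReal.mul_ne_top ENNReal.ofReal_ne_top ENNReal.ofReal_ne_top
  have hV0 : V ≠ 0 :=
    HMM.upred_ne_zero hg n hmd fun x => by simpa [HMM.dens] using hg x (y n)
  have hVt : V ≠ ∞ := HMM.upred_ne_top hG n ENNReal.ofReal_ne_top hdle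
  have hVr : V.toReal ≠ 0 := (ENNReal.toReal_pos hV0 hVt).ne'
  have hZr : ∀ k, (M.upred χ y k 1).toReal ≠ 0 := fun k =>
    (ENNReal.toReal_pos (HMM.upred_ne_zero hg k measurable_one fun _ => by simp)
      (HMM.upred_one_ne_top hG k)).ne'
  have h0 : ∀ x, 0 ≤ h x + B := fun x => by linarith [(abs_le.1 (hB x)).1]
  -- The shift by B cancels, because the filter mean is shifted by B too; both functions on the
  -- right are nonnegative.
  have hdm : ∀ x, M.g x (y n) * (h x - c)
      = (M.densMul y n h B x).toReal - U.toReal / V.toReal * (M.dens y n x).toReal := fun x => by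
    rw [HMM.densMul, HMM.dens, ENNReal.toReal_ofReal (mul_nonneg (M.g_nonneg _ _) (h0 x)),
      ENNReal.toReal_ofReal (M.g_nonneg _ _), ← hcB]
    ring
  have hgr : ∀ x, M.g x (y n) = (M.dens y n x).toReal := fun x =>
    (ENNReal.toReal_ofReal (M.g_nonneg _ _)).symm
  have hFint : ∀ (μ : Measure 𝒳) [IsFiniteMeasure μ] {F : 𝒳 → ℝ≥0∞} {d : ℝ≥0∞}, Measurable F →
      d ≠ ∞ → (∀ x, F x ≤ d) → Integrable (fun x => (F x).toReal) μ := fun μ _ F d hF hd hFd => by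
    refine Integrable.of_bound hF.ennreal_toReal.aestronglyMeasurable d.toReal
      (.of_forall fun x => ?_)
    rw [Real.norm_of_nonneg ENNReal.toReal_nonneg]
    exact ENNReal.toReal_mono hd (hFd x)
  have hpred : ∫ x, M.g x (y n) ∂(M.pred χ y n) = V.toReal / (M.upred χ y n 1).toReal := by
    simp only [hgr]
    exact HMM.integral_toReal_pred n hmd ENNReal.ofReal_ne_top hdle
  -- The centering at the filter mean makes the predictor mean vanish, so the subtracted term in the
  -- predictor variance disappears.
  have hzero : ∫ x, M.g x (y n) * (h x - c) ∂(M.pred χ y n) = 0 := by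
    have := HMM.isProbabilityMeasure_pred (χ := χ) hg hG n
    simp only [hdm]
    rw [integral_sub (hFint _ hmm hmt hmle) ((hFint _ hmd ENNReal.ofReal_ne_top hdle).const_mul _),
      integral_const_mul, HMM.integral_toReal_pred n hmm hmt hmle,
      HMM.integral_toReal_pred n hmd ENNReal.ofReal_ne_top hdle, ← hU, ← hV]
    field_simp
    ring
  have hact : ∀ k x, act (M.Lseg y k n) (fun x => M.g x (y n) * (h x - c)) x
      = (M.ev y k (n - k) (M.densMul y n h B) x).toReal
        - U.toReal / V.toReal * (M.ev y k (n - k) (M.dens y n) x).toReal := by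
    intro k x
    have hfin : IsFiniteMeasure (M.Lseg y k n x) := ⟨by
      have := M.ev_one_le_exp hG k (n - k) x
      rw [← M.L_univ_eq_ev] at this
      exact this.trans_lt ENNReal.ofReal_lt_top⟩
    have hev : ∀ {F : 𝒳 → ℝ≥0∞} {d : ℝ≥0∞}, Measurable F → d ≠ ∞ → (∀ x, F x ≤ d) →
        ∫ x', (F x').toReal ∂(M.Lseg y k n x) = (M.ev y k (n - k) F x).toReal :=
      fun hF hd hFd => integral_toReal hF.aemeasurable
        (.of_forall fun x => (hFd x).trans_lt hd.lt_top)
    rw [act]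
    simp only [hdm]
    rw [integral_sub (hFint _ hmm hmt hmle) ((hFint _ hmd ENNReal.ofReal_ne_top hdle).const_mul _),
      integral_const_mul, hev hmm hmt hmle, hev hmd ENNReal.ofReal_ne_top hdle]
  have hone : ∀ k ≤ n, ∫ x', act (M.Lseg y k n) (fun _ => 1) x' ∂(M.pred χ y k)
      = (M.upred χ y n 1).toReal / (M.upred χ y k 1).toReal := by
    intro k hk
    have : ∀ x, act (M.Lseg y k n) (fun _ => 1) x = (M.ev y k (n - k) 1 x).toReal := fun x => by
      rw [act, integral_const, smul_eq_mul, mul_one, ← M.L_univ_eq_ev]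
      rfl
    simp only [this]
    rw [HMM.integral_toReal_pred k (M.measurable_ev _ _ _ measurable_one)
      ENNReal.ofReal_ne_top (M.ev_one_le_exp hG k (n - k)), ← M.upred_add _ _ _ _ measurable_one,
      Nat.add_sub_cancel' hk]
  rw [HMM.filtVar, HMM.predVar, ← hc, hzero, hpred, Finset.sum_div]
  refine Finset.sum_congr rfl fun k hk => ?_
  have hk : k ≤ n := Nat.lt_succ_iff.1 (Finset.mem_range.1 hk)
  rw [hone k hk, ← integral_div, HMM.varTerm, ← hU, ← hV]
  have hmeas : Measurable fun x =>
      (((M.ev y k (n - k) (M.densMul y n h B) x).toReal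
      - U.toReal / V.toReal * (M.ev y k (n - k) (M.dens y n) x).toReal)
      / (V.toReal / (M.upred χ y k 1).toReal)) ^ 2 :=
    (((M.measurable_ev _ _ _ hmm).ennreal_toReal.sub
      ((M.measurable_ev _ _ _ hmd).ennreal_toReal.const_mul _)).div_const _).pow_const 2
  rw [← HMM.lintegral_pred k hmeas.ennreal_ofReal,
    ← integral_eq_lintegral_of_nonneg_ae (.of_forall fun x => sq_nonneg _)
    hmeas.aestronglyMeasurable]
  refine integral_congr_ae (.of_forall fun x => ?_)
  simp only
  -- The normalizations combine: with Z_k the predictor normalizer, (Z_n/Z_k)(V/Z_n) = V/Z_k.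
  rw [hact, zero_mul, sub_zero, ← div_pow, div_div]
  congr 2
  have := hZr n
  have := hZr k
  field_simp

end Variance

/-! ### Bounds for the asymptotic variance along a fixed record -/

section VarianceBound

variable {𝒳 𝒴 : Type*} [MeasurableSpace 𝒳] [MeasurableSpace 𝒴]
variable {M : HMM 𝒳 𝒴} {χ : Measure 𝒳} {y : ℕ → 𝒴}

lemma HMM.varTerm_nonneg (n : ℕ) (h : 𝒳 → ℝ) (B : ℝ) (k : ℕ) : 0 ≤ M.varTerm χ y n h B k :=
  ENNReal.toReal_nonneg

lemma HMM.ev_dens {k n : ℕ} (hk : k ≤ n) :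
    M.ev y k (n - k) (M.dens y n) = M.ev y k (n - k + 1) 1 := by
  rw [M.ev_succ_one, Nat.add_sub_cancel' hk]
  rfl

/-- Integrating the pair inequality in either variable against the unnormalized predictor bounds
|u(x) Pv - Pu v(x)| by α v(x) Pv + β P1, where Pf is the predictor integral of f. Dividing by Pv²/P1
gives a bound uniform in x, hence one for the mean of the square. -/
lemma HMM.varTerm_le_sq [IsProbabilityMeasure χ] (hg : ∀ x y, 0 < M.g x y) {G : ℕ → ℝ}
    (hG : ∀ i x, M.g x (y i) ≤ Real.exp (G i)) {k n : ℕ} (hk : k ≤ n) {h : 𝒳 → ℝ}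
    (hh : Measurable h) {B : ℝ} (hB : ∀ x, |h x| ≤ B) {α β R T : ℝ} (hα : 0 ≤ α) (hβ : 0 ≤ β)
    (hR : 0 ≤ R) (hT : 0 ≤ T)
    (hp : PairBound (M.ev y k (n - k) (M.densMul y n h B)) (M.ev y k (n - k) (M.dens y n))
      (ENNReal.ofReal α) (ENNReal.ofReal β))
    (hvR : ∀ x, M.ev y k (n - k) (M.dens y n) x * M.upred χ y k 1
      ≤ ENNReal.ofReal R * M.upred χ y k (M.ev y k (n - k) (M.dens y n)))
    (hvT : M.upred χ y k 1 ≤ ENNReal.ofReal T * M.upred χ y k (M.ev y k (n - k) (M.dens y n))) :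
    M.varTerm χ y n h B k ≤ (α * R + β * T ^ 2) ^ 2 := by
  have hmd := M.measurable_dens y n
  have hmm := M.measurable_densMul y n hh B
  have hdle := HMM.dens_le hG n
  have hmle : ∀ x, M.densMul y n h B x
      ≤ ENNReal.ofReal (2 * B) * ENNReal.ofReal (Real.exp (G n)) := fun x =>
    (M.densMul_le y n hB x).trans (mul_le_mul_right (hdle x) _)
  have hmt : ENNReal.ofReal (2 * B) * ENNReal.ofReal (Real.exp (G n)) ≠ ∞ :=
    ENNReal.mul_ne_top ENNReal.ofReal_ne_top ENNReal.ofReal_ne_top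
  have hevt : ∀ {F : 𝒳 → ℝ≥0∞} {d : ℝ≥0∞}, d ≠ ∞ → (∀ x, F x ≤ d) → ∀ x,
      M.ev y k (n - k) F x ≠ ∞ := fun hd hF x =>
    ne_top_of_le_ne_top (ENNReal.mul_ne_top hd (ne_top_of_le_ne_top ENNReal.ofReal_ne_top
      (M.ev_one_le_exp hG k (n - k) x))) (M.ev_le_of_le y k _ hF x)
  have hUk : M.upred χ y n (M.densMul y n h B)
      = M.upred χ y k (M.ev y k (n - k) (M.densMul y n h B)) := by
    rw [← M.upred_add _ _ _ _ hmm, Nat.add_sub_cancel' hk]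
  have hVk : M.upred χ y n (M.dens y n) = M.upred χ y k (M.ev y k (n - k) (M.dens y n)) := by
    rw [← M.upred_add _ _ _ _ hmd, Nat.add_sub_cancel' hk]
  have hPu : M.upred χ y n (M.densMul y n h B) ≠ ∞ := HMM.upred_ne_top hG n hmt hmle
  have hPv : M.upred χ y n (M.dens y n) ≠ ∞ := HMM.upred_ne_top hG n ENNReal.ofReal_ne_top hdle
  have hPv0 : M.upred χ y n (M.dens y n) ≠ 0 :=
    HMM.upred_ne_zero hg n hmd fun x => by simpa [HMM.dens] using hg x (y n)
  have hP1 : M.upred χ y k 1 ≠ ∞ := HMM.upred_one_ne_top hG k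
  have hP10 : M.upred χ y k 1 ≠ 0 := HMM.upred_ne_zero hg k measurable_one fun _ => by simp
  have hmu := M.measurable_ev y k (n - k) hmm
  have hmv := M.measurable_ev y k (n - k) hmd
  set u := M.ev y k (n - k) (M.densMul y n h B) with hu
  set v := M.ev y k (n - k) (M.dens y n) with hv
  have hbind1 : (χ.bind (M.Lseg y 0 k)) Set.univ = M.upred χ y k 1 := by
    rw [← M.lintegral_bind _ _ _ measurable_one]; simp
  have hpt : ∀ x, ((((u x).toReal - (M.upred χ y n (M.densMul y n h B)).toReal
        / (M.upred χ y n (M.dens y n)).toReal * (v x).toReal)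
      / ((M.upred χ y n (M.dens y n)).toReal / (M.upred χ y k 1).toReal)) ^ 2)
      ≤ (α * R + β * T ^ 2) ^ 2 := by
    intro x
    have i1 := lintegral_mul_lintegral_le (m := Measure.dirac x) (m' := χ.bind (M.Lseg y 0 k))
      hmu hmv (.of_forall fun a => .of_forall fun b => hp a b)
    have i2 := lintegral_mul_lintegral_le (m := χ.bind (M.Lseg y 0 k)) (m' := Measure.dirac x)
      hmu hmv (.of_forall fun a => .of_forall fun b => hp a b)
    rw [lintegral_dirac' _ hmu, lintegral_dirac' _ hmv, M.lintegral_bind _ _ _ hmu,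
      M.lintegral_bind _ _ _ hmv, hbind1, ← hUk, ← hVk] at i1 i2
    have i3 := hvR x
    rw [← hVk] at i3 hvT
    simp only [measure_univ, one_mul, mul_one] at i1 i2
    lift u x to NNReal using hevt hmt hmle x with ux
    lift v x to NNReal using hevt ENNReal.ofReal_ne_top hdle x with vx
    lift M.upred χ y n (M.densMul y n h B) to NNReal using hPu with Pu
    lift M.upred χ y n (M.dens y n) to NNReal using hPv with Pv
    lift M.upred χ y k 1 to NNReal using hP1 with P1
    simp only [ENNReal.ofReal] at i1 i2 i3 hvT
    norm_cast at i1 i2 i3 hvT hPv0 hP10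
    have j1 := NNReal.coe_le_coe.2 i1
    have j2 := NNReal.coe_le_coe.2 i2
    have j3 := NNReal.coe_le_coe.2 i3
    have j4 := NNReal.coe_le_coe.2 hvT
    push_cast [Real.coe_toNNReal _ hα, Real.coe_toNNReal _ hβ, Real.coe_toNNReal _ hR,
      Real.coe_toNNReal _ hT] at j1 j2 j3 j4
    have hPvp : (0 : ℝ) < Pv := NNReal.coe_pos.2 (pos_iff_ne_zero.2 hPv0)
    have hP1p : (0 : ℝ) < P1 := NNReal.coe_pos.2 (pos_iff_ne_zero.2 hP10)
    have hvx : (0 : ℝ) ≤ vx := vx.2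
    simp only [ENNReal.coe_toReal]
    rw [← sq_abs]
    refine pow_le_pow_left₀ (abs_nonneg _) ?_ 2
    have e1 : ((ux : ℝ) - Pu / Pv * vx) / (Pv / P1) = (ux * Pv - Pu * vx) * P1 / Pv ^ 2 := by
      field_simp
    have hab : |(ux : ℝ) * Pv - Pu * vx| ≤ α * (vx * Pv) + β * P1 := by
      rw [abs_le]; constructor <;> nlinarith
    rw [e1, abs_div, abs_mul, abs_of_pos hP1p, abs_of_pos (pow_pos hPvp 2),
      div_le_iff₀ (pow_pos hPvp 2)]
    have k1 : (vx : ℝ) * P1 * (α * Pv) ≤ R * Pv * (α * Pv) :=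
      mul_le_mul_of_nonneg_right j3 (by positivity)
    have k2 : (P1 : ℝ) ^ 2 ≤ (T * Pv) ^ 2 := pow_le_pow_left₀ hP1p.le j4 2
    calc |(ux : ℝ) * Pv - Pu * vx| * P1 ≤ (α * (vx * Pv) + β * P1) * P1 := by gcongr
      _ = vx * P1 * (α * Pv) + β * P1 ^ 2 := by ring
      _ ≤ R * Pv * (α * Pv) + β * (T * Pv) ^ 2 := by gcongr
      _ = _ := by ring
  rw [HMM.varTerm]
  refine ENNReal.toReal_le_of_le_ofReal (sq_nonneg _) ?_
  calc _ ≤ (M.upred χ y k 1)⁻¹ * (ENNReal.ofReal ((α * R + β * T ^ 2) ^ 2) * M.upred χ y k 1) := by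
        rw [← HMM.upred_const_mul k measurable_one]
        refine mul_le_mul_right (HMM.upred_mono k fun x => ?_) _
        rw [Pi.one_apply, mul_one]
        exact ENNReal.ofReal_le_ofReal (hpt x)
    _ = ((M.upred χ y k 1)⁻¹ * M.upred χ y k 1) * ENNReal.ofReal ((α * R + β * T ^ 2) ^ 2) := by
        ring
    _ = _ := by rw [ENNReal.inv_mul_cancel hP10 hP1, one_mul]

variable {r : ℕ} {C D : Set 𝒳} {e η : ℝ≥0∞} {a : ℕ → ℝ} {S : Set ℕ}

lemma HMM.Record.le_return_pairs (h : M.Record y r C D e η a S) (N k : ℕ) {x : 𝒳} (hx : x ∈ D) :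
    ENNReal.ofReal (expSum a k (k + 2 * r * N))⁻¹ ≤ M.ev y k (2 * r * N) (D.indicator 1) x := by
  have hmD : Measurable (D.indicator (1 : 𝒳 → ℝ≥0∞)) := measurable_one.indicator h.measD
  induction N generalizing k x with
  | zero => simp [M.ev_zero _ _ hmD, hx, expSum]
  | succ N ih =>
    rw [show 2 * r * (N + 1) = 2 * r + 2 * r * N by ring, M.ev_add _ _ _ _ hmD]
    refine le_trans ?_ (M.mul_ev_indicator_le y k (2 * r) h.measD (fun x hx => ih (k + 2 * r) hx) x)
    rw [M.ev_two_mul _ _ _ hmD]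
    refine le_trans ?_ (mul_le_mul_right (h.le_return_two k hx) _)
    rw [← add_assoc, ← expSum_mul a (show k ≤ k + 2 * r by omega) (by omega), mul_inv, mul_comm,
      ENNReal.ofReal_mul (inv_nonneg.2 (expSum_pos _ _ _).le)]
    refine mul_le_mul_right ?_ _
    have h1 := h.one_le_return_mul k
    rw [ENNReal.ofReal_inv_of_pos (expSum_pos _ _ _)]
    exact ENNReal.inv_le_iff_le_mul (fun h => absurd h ENNReal.ofReal_ne_top)
      (fun h => absurd h ENNReal.ofReal_ne_top) |>.2 (by rwa [mul_comm] at h1)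

/-- Mass at least 1/E is back in D after N pairs of blocks, and the steps after time k + l can have
increased it at most by the factor E. -/
lemma HMM.Record.one_le_mul_ev (h : M.Record y r C D e η a S) {N k l : ℕ} (hl : l ≤ 2 * r * N)
    {x : 𝒳} (hx : x ∈ D) :
    1 ≤ ENNReal.ofReal (expSum a k (k + 2 * r * N) ^ 2) * M.ev y k l 1 x := by
  set E := expSum a k (k + 2 * r * N) with hE
  have hE0 : 0 < E := expSum_pos _ _ _
  have h1 : M.ev y k (2 * r * N) (D.indicator 1) x ≤ ENNReal.ofReal E * M.ev y k l 1 x := by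
    calc _ ≤ M.ev y k (2 * r * N) 1 x :=
          M.ev_mono _ _ _ (Set.indicator_le_self' fun _ _ => zero_le_one) x
      _ = M.ev y k l (M.ev y (k + l) (2 * r * N - l) 1) x := by
          rw [← M.ev_add _ _ _ _ measurable_one, Nat.add_sub_cancel' hl]
      _ ≤ _ := by
          refine M.ev_le_of_le _ _ _ (fun x => (h.ev_one_le _ _ x).trans ?_) _
          refine ENNReal.ofReal_le_ofReal ?_
          rw [hE, ← expSum_mul a (show k ≤ k + l by omega) (show k + l ≤ k + 2 * r * N by omega),
            show k + l + (2 * r * N - l) = k + 2 * r * N by omega]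
          exact le_mul_of_one_le_left (expSum_pos _ _ _).le (h.one_le_expSum _ _)
  calc (1 : ℝ≥0∞) = ENNReal.ofReal E * ENNReal.ofReal E⁻¹ := by
        rw [← ENNReal.ofReal_mul hE0.le, mul_inv_cancel₀ hE0.ne', ENNReal.ofReal_one]
    _ ≤ ENNReal.ofReal E * (ENNReal.ofReal E * M.ev y k l 1 x) := by
        gcongr
        exact (h.le_return_pairs N k hx).trans h1
    _ = _ := by rw [sq, ENNReal.ofReal_mul hE0.le, mul_assoc]

/-- The predictor gives D at least the share 1/X, and there F ≥ c. -/
lemma HMM.mul_upred_one_le (hD : MeasurableSet D) {k : ℕ} {X c : ℝ≥0∞}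
    (hX : M.upred χ y k 1 ≤ X * M.upred χ y k (D.indicator 1)) {F : 𝒳 → ℝ≥0∞}
    (hF : ∀ x ∈ D, c ≤ F x) : c * M.upred χ y k 1 ≤ X * M.upred χ y k F := by
  calc c * M.upred χ y k 1 ≤ c * (X * M.upred χ y k (D.indicator 1)) := by gcongr
    _ = X * (c * M.upred χ y k (D.indicator 1)) := by ring
    _ = X * M.upred χ y k (fun x => c * D.indicator 1 x) := by
        rw [HMM.upred_const_mul k (measurable_one.indicator hD)]
    _ ≤ _ := by
        refine mul_le_mul_right (HMM.upred_mono k fun x => ?_) _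
        by_cases hx : x ∈ D
        · simpa [hx] using hF x hx
        · simp [hx]

/-- The bound of one summand of the asymptotic variance in terms of the bounds `X` and `R`. -/
lemma HMM.Record.varTerm_le [IsProbabilityMeasure χ] (hg : ∀ x y, 0 < M.g x y) {e θ : ℝ}
    (he1 : e ≤ 1) (he : 0 < e) (hθ : 0 < θ) (hθ1 : θ ≤ 1)
    (h : M.Record y r C D (ENNReal.ofReal e) (ENNReal.ofReal (θ ^ 2)) a S)
    {k n N l : ℕ} (hkn : k ≤ n) (hl : l < 2 * r) (hN : n = k + 2 * r * N + l) {f : 𝒳 → ℝ}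
    (hf : Measurable f) {B : ℝ} (hB : ∀ x, |f x| ≤ B) {X R : ℝ} (hX : 0 ≤ X) (hR : 0 ≤ R)
    (hXk : M.upred χ y k 1 ≤ ENNReal.ofReal X * M.upred χ y k (D.indicator 1))
    (hRk : RatioBound D (M.ev y k (n - k + 1) 1) (ENNReal.ofReal R)) (p : ℕ) :
    M.varTerm χ y n f B k ≤ (2 * B * ((1 - e ^ 2) ^ p * (X * R)
      + (2 * θ) ^ goodPairs S r k N * (θ⁻¹) ^ p
        * (X * expSum a k (k + 2 * r * (N + 1)) ^ 3) ^ 2)) ^ 2 := by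
  set E := expSum a k (k + 2 * r * (N + 1)) with hE
  have hE0 : 0 < E := expSum_pos _ _ _
  have hmd := M.measurable_dens y n
  have hmm := M.measurable_densMul y n hf B
  obtain ⟨x₀, -⟩ := h.nonempty
  have hB0 : 0 ≤ B := (abs_nonneg _).trans (hB x₀)
  have he2 : 0 ≤ 1 - e ^ 2 := by nlinarith
  set q := k + 2 * r * N with hq
  have hnk : n - k = 2 * r * N + l := by omega
  -- The last l < 2r steps do not fill a pair; they are absorbed into the terminal functions.
  have hev : ∀ {F : 𝒳 → ℝ≥0∞}, Measurable F →
      M.ev y k (n - k) F = M.ev y k (2 * r * N) (M.ev y q l F) := fun hF => by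
    rw [hnk, M.ev_add _ _ _ _ hF]
  have hrec : M.Record y r C D (ENNReal.ofReal e) (ENNReal.ofReal θ ^ 2) a S := by
    rwa [← ENNReal.ofReal_pow hθ.le]
  have hpair := hrec.pairBound (ρ := ENNReal.ofReal (1 - e ^ 2)) (B := ENNReal.ofReal (2 * B))
    (V := ENNReal.ofReal (expSum a q (n + 1)))
    (by
      rw [← ENNReal.ofReal_pow he.le, ← ENNReal.ofReal_add he2 (by positivity)]
      simp)
    (by simpa using hθ) (by simpa using hθ1) ENNReal.ofReal_ne_top
    (M.measurable_ev y q l hmm) (M.measurable_ev y q l hmd)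
    (fun x => by
      rw [← M.ev_const_mul _ _ _ hmd]
      exact M.ev_mono _ _ _ (M.densMul_le y n hB) x)
    (fun x => by
      have : M.ev y q l (M.dens y n) = M.ev y q (l + 1) 1 := by
        rw [M.ev_succ_one, hN]; rfl
      rw [this]
      refine (h.ev_one_le q (l + 1) x).trans_eq ?_
      congr 2
      omega)
    N k p
  rw [← hev hmm, ← hev hmd, ← hq, ofReal_expSum_mul a (by omega) (by omega)] at hpair
  have hEn : expSum a k (n + 1) ≤ E := by
    rw [hE, ← expSum_mul a (show k ≤ n + 1 by omega)
      (show n + 1 ≤ k + 2 * r * (N + 1) by rw [Nat.mul_add]; omega)]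
    exact le_mul_of_one_le_right (expSum_pos _ _ _).le (h.one_le_expSum _ _)
  have hp' : PairBound (M.ev y k (n - k) (M.densMul y n f B)) (M.ev y k (n - k) (M.dens y n))
      (ENNReal.ofReal (2 * B * (1 - e ^ 2) ^ p))
      (ENNReal.ofReal (2 * B * ((2 * θ) ^ goodPairs S r k N * (θ⁻¹) ^ p * E ^ 2))) := by
    refine hpair.mono (le_of_eq ?_) ?_
    · rw [← ENNReal.ofReal_pow he2, ← ENNReal.ofReal_mul (by positivity)]
    · have e2 : (2 : ℝ≥0∞) * ENNReal.ofReal θ = ENNReal.ofReal (2 * θ) := by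
        rw [ENNReal.ofReal_mul (by norm_num)]; simp
      rw [e2, ← ENNReal.ofReal_inv_of_pos hθ, ← ENNReal.ofReal_pow (by positivity),
        ← ENNReal.ofReal_pow (by positivity), ← ENNReal.ofReal_pow (expSum_pos _ _ _).le,
        ← ENNReal.ofReal_mul (by positivity), ← ENNReal.ofReal_mul (by positivity),
        ← ENNReal.ofReal_mul (by positivity)]
      refine ENNReal.ofReal_le_ofReal ?_
      have := (expSum_pos a k (n + 1)).le
      gcongr
  have hv := HMM.ev_dens (M := M) (y := y) hkn
  -- T = X E² since v ≥ E⁻² on D. With the E² inside β this produces (X E³)².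
  have hmain := HMM.varTerm_le_sq (χ := χ) hg h.g_le hkn hf hB (α := 2 * B * (1 - e ^ 2) ^ p)
    (β := 2 * B * ((2 * θ) ^ goodPairs S r k N * (θ⁻¹) ^ p * E ^ 2)) (R := X * R)
    (T := X * E ^ 2) (by positivity) (by positivity) (by positivity) (by positivity) hp'
    (fun x => by
      rw [hv]
      refine (HMM.mul_upred_one_le h.measD hXk (fun b hb => hRk x b hb)).trans_eq ?_
      rw [HMM.upred_const_mul k (M.measurable_ev _ _ _ measurable_one),
        ENNReal.ofReal_mul hX, mul_assoc])
    (by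
      rw [hv]
      refine (one_mul (M.upred χ y k 1)).symm.trans_le ?_
      refine (HMM.mul_upred_one_le h.measD hXk (fun b hb =>
        h.one_le_mul_ev (N := N + 1) (k := k) (l := n - k + 1) (by rw [Nat.mul_add]; omega)
          hb)).trans_eq ?_
      rw [HMM.upred_const_mul k (M.measurable_ev _ _ _ measurable_one),
        ENNReal.ofReal_mul hX, mul_assoc (ENNReal.ofReal X)])
  refine hmain.trans_eq ?_
  ring

end VarianceBound

/-! ### A bound of the asymptotic variance that is uniform in the length of the record -/

section UniformBound

/-- The number p = m/2 of contractions is at least about j/(12r), of total rate l/(12r). Half of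
this rate pays for the terms in ε that come from W; hence ε is small relative to l, that is, to e.
-/
lemma exp_mixed_term_le {r N j m p : ℕ} {c W ρ l q : ℝ} (hr : 1 ≤ r) (hρ : ρ = Real.exp (-l))
    (hl : 0 ≤ l) (hN : j < 2 * r * (N + 1)) (hm : (N : ℝ) / 3 - W ≤ m) (hp : p = m / 2)
    {ε b : ℝ} (hW : W = ε * j + b) (hε : ε * (l / 2 + 2 * q) ≤ l / (24 * r)) :
    ρ ^ p * (c * Real.exp (q * W) * (c * Real.exp (q * W)))
      ≤ c ^ 2 * Real.exp (l + (l / 2 + 2 * q) * b) * Real.exp (-(l / (24 * r)) * j) := by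
  have hr' : (0 : ℝ) < r := by exact_mod_cast hr
  have hNj : (j : ℝ) / (2 * r) ≤ N + 1 := by
    rw [div_le_iff₀ (by positivity)]
    have : (j : ℝ) ≤ 2 * r * (N + 1) := by exact_mod_cast hN.le
    linarith
  have hpm : (m : ℝ) ≤ 2 * p + 1 := by exact_mod_cast (by omega : m ≤ 2 * p + 1)
  have hpl : (j : ℝ) / (12 * r) - W / 2 - 1 ≤ p := by
    have : (j : ℝ) / (12 * r) = (j : ℝ) / (2 * r) / 6 := by field_simp; ring
    linarith
  have e1 : l * ((j : ℝ) / (12 * r) - W / 2 - 1) ≤ l * p := mul_le_mul_of_nonneg_left hpl hl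
  have e2 : ε * (l / 2 + 2 * q) * j ≤ l / (24 * r) * j :=
    mul_le_mul_of_nonneg_right hε (Nat.cast_nonneg _)
  have e3 : l * ((j : ℝ) / (12 * r)) = 2 * (l / (24 * r) * j) := by field_simp; ring
  rw [hρ, ← Real.exp_nat_mul]
  calc Real.exp (p * -l) * (c * Real.exp (q * W) * (c * Real.exp (q * W)))
      = c ^ 2 * Real.exp (p * -l + q * W + q * W) := by rw [Real.exp_add, Real.exp_add]; ring
    _ ≤ c ^ 2 * Real.exp (l + (l / 2 + 2 * q) * b + -(l / (24 * r)) * j) := by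
        refine mul_le_mul_of_nonneg_left (Real.exp_le_exp.2 ?_) (sq_nonneg c)
        subst hW
        nlinarith
    _ = _ := by rw [Real.exp_add]; ring

/-- With p = m/2, (2θ)^m θ^{-p} ≤ exp(m(1 - Θ/2)) ≤ exp(-3vm), about exp(-vN) as m is about N/3. The
sixth power of the masses is about exp(12rcN), so v = 12rc + 1 leaves exp(-N). -/
lemma exp_small_term_le {r N j m p : ℕ} {c d W θ Θ v q E : ℝ} (hr : 1 ≤ r)
    (hθ : θ = Real.exp (-Θ)) (hv : v = 12 * r * c + 1) (hv0 : 0 ≤ v) (hΘ : 2 * (1 + 3 * v) ≤ Θ)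
    (hN : j < 2 * r * (N + 1)) (hm : (N : ℝ) / 3 - W ≤ m) (hp : p = m / 2)
    (hE0 : 0 ≤ E) (hE : E ≤ Real.exp (2 * r * c * (N + 1) + W))
    {ε b : ℝ} (hW : W = ε * j + b) (hε : ε * (3 * v + 2 * q + 6) ≤ 1 / (4 * r)) :
    (2 * θ) ^ m * (θ⁻¹) ^ p * (d * Real.exp (q * W) * E ^ 3) ^ 2
      ≤ d ^ 2 * Real.exp (12 * r * c + 1 + (3 * v + 2 * q + 6) * b)
        * Real.exp (-(1 / (4 * r)) * j) := by
  have hr' : (0 : ℝ) < r := by exact_mod_cast hr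
  have hNj : (j : ℝ) / (2 * r) ≤ N + 1 := by
    rw [div_le_iff₀ (by positivity)]
    have : (j : ℝ) ≤ 2 * r * (N + 1) := by exact_mod_cast hN.le
    linarith
  have hpm : (2 : ℝ) * p ≤ m := by exact_mod_cast (by omega : 2 * p ≤ m)
  have h2 : (2 : ℝ) ≤ Real.exp 1 := by
    have := Real.add_one_le_exp 1
    linarith
  have hm0 : (0 : ℝ) ≤ m := Nat.cast_nonneg _
  have e0 : (2 * θ) ^ m * (θ⁻¹) ^ p ≤ Real.exp (-v * N + 3 * v * W) := by
    have : 2 * θ ≤ Real.exp (1 + -Θ) := by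
      rw [Real.exp_add, ← hθ]
      exact mul_le_mul_of_nonneg_right h2 (hθ ▸ (Real.exp_pos _).le)
    have hθ0 : 0 < θ := hθ ▸ Real.exp_pos _
    have hi : θ⁻¹ = Real.exp Θ := by rw [hθ, Real.exp_neg, inv_inv]
    calc (2 * θ) ^ m * (θ⁻¹) ^ p ≤ Real.exp (1 + -Θ) ^ m * (θ⁻¹) ^ p := by gcongr
      _ = Real.exp (m * (1 + -Θ) + p * Θ) := by
          rw [hi, ← Real.exp_nat_mul, ← Real.exp_nat_mul, ← Real.exp_add]
      _ ≤ _ := by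
          refine Real.exp_le_exp.2 ?_
          have f1 : 2 * p * Θ ≤ m * Θ := mul_le_mul_of_nonneg_right hpm (by linarith)
          have f2 : m * (2 * (1 + 3 * v)) ≤ m * Θ := mul_le_mul_of_nonneg_left hΘ hm0
          have f3 : v * ((N : ℝ) / 3 - W) ≤ v * m := mul_le_mul_of_nonneg_left hm hv0
          linarith
  have e1 : ε * (3 * v + 2 * q + 6) * j ≤ 1 / (4 * r) * j :=
    mul_le_mul_of_nonneg_right hε (Nat.cast_nonneg _)
  have e2 : (j : ℝ) / (2 * r) = 2 * (1 / (4 * r) * j) := by field_simp; ring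
  have e3 : E ^ 6 ≤ Real.exp (2 * r * c * (N + 1) + W) ^ 6 := pow_le_pow_left₀ hE0 hE 6
  calc (2 * θ) ^ m * (θ⁻¹) ^ p * (d * Real.exp (q * W) * E ^ 3) ^ 2
      = (2 * θ) ^ m * (θ⁻¹) ^ p * (d ^ 2 * Real.exp (q * W) ^ 2) * E ^ 6 := by ring
    _ ≤ Real.exp (-v * N + 3 * v * W) * (d ^ 2 * Real.exp (q * W) ^ 2)
          * Real.exp (2 * r * c * (N + 1) + W) ^ 6 := by gcongr
    _ = d ^ 2 * Real.exp (-v * N + 3 * v * W + 2 * (q * W) + 6 * (2 * r * c * (N + 1) + W)) := by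
        rw [← Real.exp_nat_mul, ← Real.exp_nat_mul, Real.exp_add _ (6 * _), Real.exp_add _ (2 * _)]
        push_cast
        ring
    _ ≤ d ^ 2 * Real.exp (12 * r * c + 1 + (3 * v + 2 * q + 6) * b + -(1 / (4 * r)) * j) := by
        refine mul_le_mul_of_nonneg_left (Real.exp_le_exp.2 ?_) (sq_nonneg d)
        subst hW hv
        nlinarith
    _ = _ := by rw [Real.exp_add]; ring

variable {𝒳 𝒴 : Type*} [MeasurableSpace 𝒳] [MeasurableSpace 𝒴]

lemma exists_pos_mul_le {A B d₁ d₂ d₃ A' : ℝ} (h1 : 0 < d₁) (h2 : 0 < d₂) (h3 : 0 < d₃)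
    (hA : 0 ≤ A) (hB : 0 ≤ B) (hA' : 0 ≤ A') :
    ∃ ε : ℝ, 0 < ε ∧ A * ε ≤ d₁ ∧ B * ε ≤ d₂ ∧ A' * ε ≤ d₃ := by
  have key : ∀ {A d ε : ℝ}, 0 ≤ A → 0 < d → 0 < ε → ε ≤ d / (A + 1) → A * ε ≤ d := by
    intro A d ε hA hd hε h
    rw [le_div_iff₀ (by linarith)] at h
    nlinarith
  have hpos : 0 < min (d₁ / (A + 1)) (min (d₂ / (B + 1)) (d₃ / (A' + 1))) := by positivity
  exact ⟨_, hpos, key hA h1 hpos (min_le_left _ _),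
    key hB h2 hpos ((min_le_right _ _).trans (min_le_left _ _)),
    key hA' h3 hpos ((min_le_right _ _).trans (min_le_right _ _))⟩

/-- If `θ = exp (-Θ)` is small compared to the mean `c`, the asymptotic variances along all records
with the same window bounds are bounded by the same constant. -/
lemma exists_forall_filtVar_le (M : HMM 𝒳 𝒴) (hg : ∀ x y, 0 < M.g x y) {r : ℕ} (hr : 1 ≤ r)
    {c e Θ : ℝ} (hc : 0 ≤ c) (he : 0 < e) (he1 : e < 1)
    (hΘ : 2 * (1 + 3 * (12 * r * c + 1)) ≤ Θ) (C D : Set 𝒳) :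
    ∃ ε : ℝ, 0 < ε ∧ ∀ b : ℝ, 0 ≤ b → ∀ B : ℝ, ∃ V : ℝ, ∀ (χ : Measure 𝒳)
      [IsProbabilityMeasure χ] (y : ℕ → 𝒴) (a : ℕ → ℝ) (S : Set ℕ) (n : ℕ) (f : 𝒳 → ℝ),
      M.Record y r C D (ENNReal.ofReal e) (ENNReal.ofReal (Real.exp (-Θ) ^ 2)) a S →
      WindowBound r (n + 2 * r) c ε b a S →
      (∀ s < 2 * r, M.upred χ y s 1
        ≤ ENNReal.ofReal (Real.exp b) * M.upred χ y s (D.indicator 1)) →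
      Measurable f → (∀ x, |f x| ≤ B) → |M.filtVar χ y n f| ≤ V := by
  have hr' : (0 : ℝ) < r := by exact_mod_cast hr
  set v : ℝ := 12 * r * c + 1 with hv
  have hv0 : 0 ≤ v := by positivity
  set Λ : ℝ := -Real.log (2 * Real.exp (-Θ) ^ 2) with hΛ
  have hΛ' : Λ = 2 * Θ - Real.log 2 := by
    rw [hΛ, Real.log_mul (by norm_num) (by positivity), Real.log_pow, Real.log_exp]
    push_cast
    ring
  have hlog2 : Real.log 2 ≤ 1 := by
    have := Real.log_le_sub_one_of_pos (show (0 : ℝ) < 2 by norm_num)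
    linarith
  have hrc : 0 ≤ r * c := by positivity
  have hΛc : 3 * (8 * r * c + 1) ≤ Λ := by rw [hΛ', hv] at *; linarith
  have hΛ0 : 0 ≤ Λ := le_trans (by positivity) hΛc
  set q := Λ + 6 with hq
  have hρ0 : 0 < 1 - e ^ 2 := by nlinarith
  set l := -Real.log (1 - e ^ 2) with hl
  have hl0 : 0 < l := by
    rw [hl, neg_pos]
    exact Real.log_neg hρ0 (by nlinarith)
  have hρ : 1 - e ^ 2 = Real.exp (-l) := by rw [hl, neg_neg, Real.exp_log hρ0]
  -- Three requirements on ε: the predictor recursion, the mixed term and the small term. None of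
  -- them involves b.
  obtain ⟨ε, hε, hε1, hε2, hε3⟩ := exists_pos_mul_le (A := q * (2 * r)) (B := l / 2 + 2 * q)
    (A' := 3 * v + 2 * q + 6) (d₁ := 1 / 2) (d₂ := l / (24 * r)) (d₃ := 1 / (4 * r))
    (by norm_num) (by positivity) (by positivity) (by positivity) (by positivity) (by positivity)
  refine ⟨ε, hε, fun b hb B => ?_⟩
  -- Completing the last pair overshoots n by at most 2r, so window errors are measured from n + 2r;
  -- the excess is put into b'.
  set b' := ε * (2 * r) + b with hb'
  set d := ratioConst r c e with hd
  have hd0 : 0 ≤ d := by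
    have := sub_pos.2 exp_neg_half_lt_one
    rw [hd, ratioConst]
    positivity
  set γ := min (l / (24 * r)) (1 / (4 * r)) with hγ
  have hγ0 : 0 < γ := by positivity
  set H := 2 * B * (d ^ 2 * Real.exp (l + (l / 2 + 2 * q) * b')
    + d ^ 2 * Real.exp (12 * r * c + 1 + (3 * v + 2 * q + 6) * b')) with hH
  have hτ1 : Real.exp (-(2 * γ)) < 1 := Real.exp_lt_one_iff.2 (by linarith)
  refine ⟨H ^ 2 * (1 - Real.exp (-(2 * γ)))⁻¹, fun χ _ y a S n f h hw hχ hf hB => ?_⟩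
  obtain ⟨x₀, -⟩ := h.nonempty
  have hB0 : 0 ≤ B := (abs_nonneg _).trans (hB x₀)
  rw [HMM.filtVar_eq hg h.g_le n hf hB, abs_of_nonneg (Finset.sum_nonneg fun k _ =>
    HMM.varTerm_nonneg _ _ _ _)]
  have hterm : ∀ k ∈ Finset.range (n + 1),
      M.varTerm χ y n f B k ≤ H ^ 2 * Real.exp (-(2 * γ)) ^ (n - k) := by
    intro k hk
    have hk : k ≤ n := by simpa [Nat.lt_succ_iff] using hk
    set j := n - k with hj
    set N := j / (2 * r) with hN
    have hdm : 2 * r * N + j % (2 * r) = j := Nat.div_add_mod j (2 * r)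
    have hmod : j % (2 * r) < 2 * r := Nat.mod_lt _ (by omega)
    have hNj : j < 2 * r * (N + 1) := by rw [Nat.mul_add]; omega
    have hW : ε * (((n + 2 * r : ℕ) : ℝ) - k) + b = ε * j + b' := by
      rw [hb', hj, Nat.cast_sub hk]
      push_cast
      ring
    have hX := h.upred_one_le hw he he1.le (by positivity) hΛ hΛc hc hε.le
      (by linarith) hb hχ (k := k) (by omega)
    have hR := h.exists_ratioBound hw he he1.le (by positivity) hΛ hΛc hc hε.le hb (k := k) (N := N)
      (l := j % (2 * r) + 1) (by omega) (by omega)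
    have hm := hw.goodPairs_ge (t := k) (N := N) (by omega)
    have hE := hw.expSum_le (j := k) (k := k + 2 * r * (N + 1)) (by omega)
      (by rw [Nat.mul_add]; omega)
    rw [hW] at hX hR hm
    rw [add_assoc (c * _), hW] at hE
    have hm' : (N : ℝ) / 3 - (ε * j + b') ≤ goodPairs S r k N := hm
    set m := goodPairs S r k N with hmdef
    rw [← add_assoc, hdm] at hR
    have hmain := h.varTerm_le (χ := χ) hg he1.le he (Real.exp_pos _)
      (Real.exp_le_one_iff.2 (by linarith)) hk hmod (N := N) (by omega) hf hB
      (X := d * Real.exp (q * (ε * j + b'))) (R := d * Real.exp (q * (ε * j + b')))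
      -- Half of the good pairs are used as contractions; the other half keeps the error term small.
      (by positivity) (by positivity) hX hR (m / 2)
    refine hmain.trans ?_
    have t1 := exp_mixed_term_le (c := d) (q := q) hr hρ hl0.le hNj hm' rfl rfl (by linarith)
    have t2 := exp_small_term_le (d := d) (q := q) hr rfl hv hv0 hΘ hNj hm' rfl
      (expSum_pos a k (k + 2 * r * (N + 1))).le
      (hE.trans_eq (by push_cast; ring_nf)) rfl (by linarith)
    have g1 : Real.exp (-(l / (24 * r)) * j) ≤ Real.exp (-γ * j) :=
      Real.exp_le_exp.2 (mul_le_mul_of_nonneg_right (neg_le_neg (min_le_left _ _))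
        (Nat.cast_nonneg _))
    have g2 : Real.exp (-(1 / (4 * r)) * j) ≤ Real.exp (-γ * j) :=
      Real.exp_le_exp.2 (mul_le_mul_of_nonneg_right (neg_le_neg (min_le_right _ _))
        (Nat.cast_nonneg _))
    have hE0 := (expSum_pos a k (k + 2 * r * (N + 1))).le
    have hsq : H ^ 2 * Real.exp (-(2 * γ)) ^ j = (H * Real.exp (-γ * j)) ^ 2 := by
      rw [mul_pow H, ← Real.exp_nat_mul, ← Real.exp_nat_mul]
      congr 2
      push_cast
      ring
    rw [hsq]
    refine pow_le_pow_left₀ (by positivity) ?_ 2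
    rw [hH, mul_assoc (2 * B) _ (Real.exp (-γ * j)),
      add_mul _ _ (Real.exp (-γ * j))]
    exact mul_le_mul_of_nonneg_left (add_le_add
      (t1.trans (mul_le_mul_of_nonneg_left g1 (by positivity)))
      (t2.trans (mul_le_mul_of_nonneg_left g2 (by positivity)))) (by linarith)
  refine (Finset.sum_le_sum hterm).trans ?_
  rw [← Finset.mul_sum]
  refine mul_le_mul_of_nonneg_left ?_ (sq_nonneg _)
  have href := Finset.sum_range_reflect (fun i => Real.exp (-(2 * γ)) ^ i) (n + 1)
  simp only [Nat.add_sub_cancel] at href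
  rw [href, ← tsum_geometric_of_lt_one (Real.exp_pos _).le hτ1]
  exact (summable_geometric_of_lt_one (Real.exp_pos _).le hτ1).sum_le_tsum _
    fun i _ => by positivity

end UniformBound

/-! ### Window bounds for stationary ergodic processes -/

section WindowBounds

variable {Ω α 𝒴 : Type*} [MeasurableSpace Ω] [MeasurableSpace α] [MeasurableSpace 𝒴]
variable {P : Measure Ω}

lemma iterate_shift {β : Type*} (i : ℕ) (u : ℕ → β) :
    (fun (u : ℕ → β) (n : ℕ) => u (n + 1))^[i] u = fun n => u (n + i) := by
  induction i generalizing u with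
  | zero => rfl
  | succ i ih =>
    rw [Function.iterate_succ_apply, ih]
    funext n
    rw [add_assoc]

/-- The window [j, k) is the difference of [j, n) and [k, n), both with right end n. Hence the error
is proportional to n - j and not to k - j. -/
lemma IsStationaryErgodic.exists_sum_Ico_le [IsProbabilityMeasure P] {U : ℕ → Ω → α}
    (hU : ∀ n, Measurable (U n))
    (hE : IsStationaryErgodic P U) {f : (ℕ → α) → ℝ}
    (hf : Integrable f (P.map fun ω n => U n ω)) {ε θ : ℝ} (hε : 0 < ε) (hθ : 0 < θ) :
    ∃ b : ℝ, 0 ≤ b ∧ ∀ n, P {ω | ¬ ∀ j k, j ≤ k → k ≤ n →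
      ∑ i ∈ Finset.Ico j k, f (fun m => U (m + i) ω)
        ≤ (∫ u, f u ∂(P.map fun ω n => U n ω)) * (k - j) + ε * (n - j) + b} ≤ ENNReal.ofReal θ := by
  have hm : Measurable fun ω n => U n ω := measurable_pi_lambda _ hU
  have := Measure.isProbabilityMeasure_map (μ := P) hm.aemeasurable
  obtain ⟨b, hb⟩ := exists_window_sum_bound hE hf (half_pos hε) hθ
  refine ⟨2 * |b|, by positivity, fun n => ?_⟩
  refine le_trans (measure_mono ?_) ((Measure.le_map_apply hm.aemeasurable _).trans (hb n))
  intro ω hω h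
  refine hω fun j k hjk hkn => ?_
  have h1 := h j (hjk.trans hkn)
  have h2 := h k hkn
  simp only [iterate_shift] at h1 h2
  have h3 := Finset.sum_Ico_consecutive (fun i => f (fun m => U (m + i) ω)) hjk hkn
  have hjk' : (j : ℝ) ≤ k := by exact_mod_cast hjk
  have h4 : ε / 2 * (n - k) ≤ ε / 2 * (n - j) := by gcongr
  have := le_abs_self b
  rw [abs_le] at h1 h2
  linarith [h1.2, h2.1]

lemma IsStationaryErgodic.map_add {U : ℕ → Ω → α} (hU : ∀ n, Measurable (U n))
    (hE : IsStationaryErgodic P U) (s : ℕ) :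
    P.map (fun ω n => U (n + s) ω) = P.map fun ω n => U n ω := by
  have h := (hE.toMeasurePreserving.iterate s).map_eq
  rw [Measure.map_map (hE.measurable.iterate s) (measurable_pi_lambda _ hU)] at h
  rw [← h]
  congr 1
  funext ω
  simp only [Function.comp_apply, iterate_shift]

/-- Ergodicity of blocks is assumed only for starting times divisible by r; stationarity transfers
it to every residue. -/
lemma IsStationaryErgodic.map_blockProc_add {Y : ℕ → Ω → 𝒴} (hY : ∀ n, Measurable (Y n))
    (hE : IsStationaryErgodic P Y) (r s : ℕ) :
    P.map (fun ω n => blockProc (fun m => Y (m + s)) r n ω)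
      = P.map fun ω n => blockProc Y r n ω := by
  have hb : Measurable fun (u : ℕ → 𝒴) (n : ℕ) (i : Fin r) => u (n * r + i) := by fun_prop
  have h := congrArg (Measure.map fun (u : ℕ → 𝒴) (n : ℕ) (i : Fin r) => u (n * r + i))
    (hE.map_add hY s)
  rwa [Measure.map_map hb (measurable_pi_lambda _ fun n => hY _),
    Measure.map_map hb (measurable_pi_lambda _ hY)] at h

lemma measurable_blockProc {Y : ℕ → Ω → 𝒴} (hY : ∀ n, Measurable (Y n)) (r n : ℕ) :
    Measurable (blockProc Y r n) := measurable_pi_lambda _ fun _ => hY _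

/-- For each residue s mod r, the window bound applies to the indicator of the complement of K along
the blocks of the process shifted by s; its mean is at most 1/3. A union over the r residues
follows. -/
lemma exists_bad_blocks_le [IsProbabilityMeasure P] {Y : ℕ → Ω → 𝒴} (hY : ∀ n, Measurable (Y n))
    (hE : IsStationaryErgodic P Y) {r : ℕ} (hr : 1 ≤ r)
    (hZ : IsStationaryErgodic P (blockProc Y r)) {K : Set (Fin r → 𝒴)} (hK : MeasurableSet K)
    (hPK : 2 / 3 < P {ω | blockProc Y r 0 ω ∈ K}) {ε θ : ℝ} (hε : 0 < ε) (hθ : 0 < θ) :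
    ∃ b : ℝ, 0 ≤ b ∧ ∀ n, P {ω | ¬ ∀ j N, j + N * r ≤ n →
      (∑ i ∈ Finset.range N,
        open Classical in if (fun l : Fin r => Y (j + i * r + l) ω) ∈ K then (0 : ℝ) else 1)
      ≤ N / 3 + ε * (n - j) + b} ≤ ENNReal.ofReal θ := by
  classical
  set f : (ℕ → Fin r → 𝒴) → ℝ := fun u => if u 0 ∈ K then 0 else 1 with hf
  have hr' : (0 : ℝ) < r := by exact_mod_cast hr
  have hf' : f = Set.indicator {u | u 0 ∈ K}ᶜ 1 := by
    funext u
    by_cases hu : u 0 ∈ K <;> simp [hf, hu]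
  have hms : MeasurableSet {u : ℕ → Fin r → 𝒴 | u 0 ∈ K} := measurable_pi_apply 0 hK
  have hZm : Measurable fun ω n => blockProc Y r n ω :=
    measurable_pi_lambda _ (measurable_blockProc hY r)
  set μ := P.map fun ω n => blockProc Y r n ω with hμ
  have : IsProbabilityMeasure μ := Measure.isProbabilityMeasure_map hZm.aemeasurable
  have hfi : Integrable f μ := by
    rw [hf']
    exact (integrable_const (1 : ℝ)).indicator hms.compl
  have hmean : ∫ u, f u ∂μ ≤ 1 / 3 := by
    rw [hf', integral_indicator_one hms.compl, measureReal_compl hms, probReal_univ]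
    have : 2 / 3 ≤ μ.real {u | u 0 ∈ K} := by
      have h1 : μ {u | u 0 ∈ K} = P {ω | blockProc Y r 0 ω ∈ K} := Measure.map_apply hZm hms
      rw [Measure.real, h1, show (2 / 3 : ℝ) = ENNReal.toReal (2 / 3) by simp]
      exact ENNReal.toReal_mono (measure_ne_top _ _) hPK.le
    linarith
  have hs : ∀ s : ℕ, ∃ b : ℝ, 0 ≤ b ∧ ∀ n, P {ω | ¬ ∀ j k, j ≤ k → k ≤ n →
      ∑ i ∈ Finset.Ico j k, f (fun m => blockProc (fun m => Y (m + s)) r (m + i) ω)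
        ≤ (∫ u, f u ∂μ) * (k - j) + ε * (n - j) + b} ≤ ENNReal.ofReal (θ / r) := by
    intro s
    have hl := hE.map_blockProc_add hY r s
    have := IsStationaryErgodic.exists_sum_Ico_le (P := P)
      (U := blockProc (fun m => Y (m + s)) r) (measurable_blockProc (fun _ => hY _) r)
      (f := f) (by rw [IsStationaryErgodic, hl]; exact hZ) (by rwa [hl]) hε
      (θ := θ / r) (by positivity)
    rwa [hl] at this
  choose b hb0 hb using hs
  refine ⟨∑ s ∈ Finset.range r, b s, Finset.sum_nonneg fun s _ => hb0 s, fun n => ?_⟩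
  have hsub : {ω | ¬ ∀ j N, j + N * r ≤ n →
      (∑ i ∈ Finset.range N, if (fun l : Fin r => Y (j + i * r + l) ω) ∈ K then (0 : ℝ) else 1)
      ≤ N / 3 + ε * (n - j) + ∑ s ∈ Finset.range r, b s}
      ⊆ ⋃ s ∈ Finset.range r, {ω | ¬ ∀ j k, j ≤ k → k ≤ (n - s) / r →
      ∑ i ∈ Finset.Ico j k, f (fun m => blockProc (fun m => Y (m + s)) r (m + i) ω)
        ≤ (∫ u, f u ∂μ) * (k - j) + ε * (((n - s) / r : ℕ) - j) + b s} := by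
    intro ω hω
    by_contra hcon
    simp only [Set.mem_iUnion, Set.mem_ofPred_eq, not_exists, not_not] at hcon
    refine hω fun j N hjN => ?_
    set s := j % r with hs
    set q := j / r with hq
    have hsr : s < r := Nat.mod_lt _ (by omega)
    have hj : r * q + s = j := Nat.div_add_mod j r
    set J := (n - s) / r with hJ
    have hqN : q + N ≤ J := by
      rw [hJ, Nat.le_div_iff_mul_le (by omega), add_mul, mul_comm q]
      omega
    have h1 := hcon s (Finset.mem_range.2 hsr) q (q + N) (by omega) hqN
    have h2 : ∑ i ∈ Finset.Ico q (q + N), f (fun m => blockProc (fun m => Y (m + s)) r (m + i) ω)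
        = ∑ i ∈ Finset.range N,
          if (fun l : Fin r => Y (j + i * r + l) ω) ∈ K then (0 : ℝ) else 1 := by
      rw [Finset.sum_Ico_eq_sum_range, Nat.add_sub_cancel_left]
      refine Finset.sum_congr rfl fun i _ => ?_
      have : blockProc (fun m => Y (m + s)) r (0 + (q + i)) ω
          = fun l : Fin r => Y (j + i * r + l) ω := by
        funext l
        simp only [blockProc]
        congr 1
        rw [← hj]
        ring
      simp only [hf, this]
    rw [h2] at h1
    -- The error is proportional to the number of blocks left before n, which is at most the number
    -- of times left.
    have h3 : (J : ℝ) - q ≤ n - j := by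
      have hJn : r * J ≤ n - s := Nat.mul_div_le _ _
      have hJq : r * (J - q) ≤ n - j := by
        rw [Nat.mul_sub]; omega
      have : J - q ≤ n - j := (Nat.le_mul_of_pos_left _ (by omega)).trans hJq
      have hq' : q ≤ J := by omega
      have hj' : j ≤ n := by omega
      rw [← Nat.cast_sub hq', ← Nat.cast_sub hj']
      exact_mod_cast this
    have h4 : ε * ((J : ℝ) - q) ≤ ε * (n - j) := mul_le_mul_of_nonneg_left h3 hε.le
    have h5 : b s ≤ ∑ s ∈ Finset.range r, b s :=
      Finset.single_le_sum (fun s _ => hb0 s) (Finset.mem_range.2 hsr)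
    have h6 : (∫ u, f u ∂μ) * (((q + N : ℕ) : ℝ) - q) ≤ N / 3 := by
      push_cast
      have : (0 : ℝ) ≤ N := Nat.cast_nonneg _
      nlinarith
    linarith
  refine (measure_mono hsub).trans ((measure_biUnion_finset_le _ _).trans
    ((Finset.sum_le_sum fun s _ => hb s _).trans_eq ?_))
  rw [Finset.sum_const, Finset.card_range, nsmul_eq_mul, ← ENNReal.ofReal_natCast,
    ← ENNReal.ofReal_mul hr'.le, mul_div_cancel₀ _ hr'.ne']

lemma WindowBound.mono {r n : ℕ} {c ε b b' : ℝ} {a : ℕ → ℝ} {S : Set ℕ}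
    (h : WindowBound r n c ε b a S) (hb : b ≤ b') : WindowBound r n c ε b' a S where
  sum_le j k hjk hk := (h.sum_le j k hjk hk).trans (by linarith)
  bad_le j N hj := (h.bad_le j N hj).trans (by linarith)

lemma exists_windowBound [IsProbabilityMeasure P] {Y : ℕ → Ω → 𝒴} (hY : ∀ n, Measurable (Y n))
    (hE : IsStationaryErgodic P Y) {r : ℕ} (hr : 1 ≤ r)
    (hZ : IsStationaryErgodic P (blockProc Y r)) {K : Set (Fin r → 𝒴)} (hK : MeasurableSet K)
    (hPK : 2 / 3 < P {ω | blockProc Y r 0 ω ∈ K}) {f : (ℕ → 𝒴) → ℝ}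
    (hf : Integrable f (P.map fun ω n => Y n ω)) {ε θ : ℝ} (hε : 0 < ε) (hθ : 0 < θ) :
    ∃ b : ℝ, 0 ≤ b ∧ ∀ n, P {ω | ¬ WindowBound r n (∫ u, f u ∂(P.map fun ω n => Y n ω)) ε b
      (fun i => f fun m => Y (m + i) ω) {i | (fun l : Fin r => Y (i + l) ω) ∈ K}}
      ≤ ENNReal.ofReal θ := by
  obtain ⟨b₁, hb₁, h₁⟩ := hE.exists_sum_Ico_le hY hf hε (half_pos hθ)
  obtain ⟨b₂, hb₂, h₂⟩ := exists_bad_blocks_le hY hE hr hZ hK hPK hε (half_pos hθ)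
  refine ⟨b₁ + b₂, by positivity, fun n => ?_⟩
  rw [← add_halves θ, ENNReal.ofReal_add (by positivity) (by positivity)]
  refine (measure_mono ?_).trans ((measure_union_le _ _).trans (add_le_add (h₁ n) (h₂ n)))
  intro ω hω
  by_contra hcon
  simp only [Set.mem_union, Set.mem_ofPred_eq, not_or, not_not] at hcon
  refine hω ⟨fun j k hjk hk => (hcon.1 j k hjk hk).trans (by linarith), fun j N hjN => ?_⟩
  exact (hcon.2 j N hjN).trans (by linarith)

end WindowBounds

/-! ### Random records -/

section Log

lemma le_coe_toReal_toENNReal {x : EReal} (hx : x.toENNReal ≠ ∞) :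
    x ≤ (x.toENNReal.toReal : EReal) := by
  have h : ((x.toENNReal : ℝ≥0∞) : EReal) = max 0 x := EReal.coe_toENNReal_eq_max
  rw [← ENNReal.ofReal_toReal hx, EReal.coe_ennreal_ofReal, max_eq_left ENNReal.toReal_nonneg] at h
  rw [h]
  exact le_max_right _ _

lemma le_exp_lnPos {t : ℝ≥0∞} (h : lnPos t ≠ ∞) :
    t ≤ ENNReal.ofReal (Real.exp (lnPos t).toReal) := by
  rw [← EReal.exp_coe]
  conv_lhs => rw [← ENNReal.exp_log t]
  exact EReal.exp_monotone (le_coe_toReal_toENNReal h)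

lemma exp_lnNeg_le {t : ℝ≥0∞} (h : lnNeg t ≠ ∞) :
    ENNReal.ofReal (Real.exp (-(lnNeg t).toReal)) ≤ t := by
  rw [← EReal.exp_coe]
  conv_rhs => rw [← ENNReal.exp_log t]
  refine EReal.exp_monotone ?_
  rw [EReal.coe_neg]
  exact EReal.neg_le_of_neg_le (le_coe_toReal_toENNReal h)

lemma pos_of_lnNeg_ne_top {t : ℝ≥0∞} (h : lnNeg t ≠ ∞) : 0 < t :=
  lt_of_lt_of_le (by simpa using Real.exp_pos _) (exp_lnNeg_le h)

end Log

/-! ### Measurability of the variances in the observations -/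

section Measurability

variable {Ω 𝒳 𝒴 : Type*} [MeasurableSpace Ω] [MeasurableSpace 𝒳] [MeasurableSpace 𝒴]
variable (M : HMM 𝒳 𝒴) (χ : Measure 𝒳) [SFinite χ] {y : Ω → ℕ → 𝒴}

lemma HMM.measurable_upred_prod (hy : ∀ i, Measurable fun ω => y ω i) (k : ℕ)
    {F : Ω × 𝒳 → ℝ≥0∞} (hF : Measurable F) :
    Measurable fun ω => M.upred χ (y ω) k fun x => F (ω, x) :=
  (M.measurable_ev_prod hy 0 k hF).lintegral_prod_right'

lemma HMM.measurable_varTerm (hy : ∀ i, Measurable fun ω => y ω i) (n : ℕ) {h : 𝒳 → ℝ}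
    (hh : Measurable h) (B : ℝ) (k : ℕ) : Measurable fun ω => M.varTerm χ (y ω) n h B k := by
  have hgn : Measurable fun p : Ω × 𝒳 => M.g p.2 (y p.1 n) :=
    M.measurable_g.comp (measurable_snd.prodMk ((hy n).comp measurable_fst))
  have hd : Measurable fun p : Ω × 𝒳 => M.dens (y p.1) n p.2 := hgn.ennreal_ofReal
  have hm : Measurable fun p : Ω × 𝒳 => M.densMul (y p.1) n h B p.2 :=
    (hgn.mul ((hh.comp measurable_snd).add_const B)).ennreal_ofReal
  have u1 : Measurable fun ω => M.upred χ (y ω) k 1 :=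
    M.measurable_upred_prod χ hy k (F := 1) measurable_one
  have ud := M.measurable_upred_prod χ hy n hd
  have um := M.measurable_upred_prod χ hy n hm
  have ed := M.measurable_ev_prod hy k (n - k) hd
  have em := M.measurable_ev_prod hy k (n - k) hm
  refine (u1.inv.mul (M.measurable_upred_prod χ hy k (F := fun p : Ω × 𝒳 => ENNReal.ofReal
    ((((M.ev (y p.1) k (n - k) (M.densMul (y p.1) n h B) p.2).toReal
      - (M.upred χ (y p.1) n (M.densMul (y p.1) n h B)).toReal
        / (M.upred χ (y p.1) n (M.dens (y p.1) n)).toReal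
        * (M.ev (y p.1) k (n - k) (M.dens (y p.1) n) p.2).toReal)
      / ((M.upred χ (y p.1) n (M.dens (y p.1) n)).toReal
        / (M.upred χ (y p.1) k 1).toReal)) ^ 2)) ?_)).ennreal_toReal
  refine Measurable.ennreal_ofReal (Measurable.pow_const (Measurable.div (Measurable.sub
    em.ennreal_toReal (Measurable.mul (Measurable.div ?_ ?_) ed.ennreal_toReal))
    (Measurable.div ?_ ?_)) 2)
  · exact (um.comp measurable_fst).ennreal_toReal
  · exact (ud.comp measurable_fst).ennreal_toReal
  · exact (ud.comp measurable_fst).ennreal_toReal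
  · exact (u1.comp measurable_fst).ennreal_toReal

end Measurability

/-! ### Almost sure bounds along the observed sequence -/

section RandomRecord

variable {Ω 𝒳 𝒴 : Type*} [MeasurableSpace Ω] [MeasurableSpace 𝒳] [MeasurableSpace 𝒴]

/-- A random variable that is almost surely finite is bounded with probability close to one. -/
lemma exists_measure_not_le_exp_le {P : Measure Ω} [IsFiniteMeasure P] {F : Ω → ℝ≥0∞}
    (hF : Measurable F) (hfin : ∀ᵐ ω ∂P, F ω ≠ ∞) {θ : ℝ} (hθ : 0 < θ) :
    ∃ b : ℝ, 0 ≤ b ∧ P {ω | ¬ F ω ≤ ENNReal.ofReal (Real.exp b)} ≤ ENNReal.ofReal θ := by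
  set s : ℕ → Set Ω := fun m => {ω | ¬ F ω ≤ ENNReal.ofReal (Real.exp m)} with hs
  have hsm : ∀ m, MeasurableSet (s m) := fun m => (measurableSet_le hF measurable_const).compl
  have hanti : Antitone s := fun m m' h ω hω hle => hω (hle.trans
    (ENNReal.ofReal_le_ofReal (Real.exp_le_exp.2 (by exact_mod_cast h))))
  have hlim := tendsto_measure_iInter_atTop (μ := P) (fun m => (hsm m).nullMeasurableSet) hanti
    ⟨0, measure_ne_top _ _⟩
  have hzero : P (⋂ m, s m) = 0 := by
    refine measure_mono_null (t := {ω | ¬ F ω ≠ ∞}) (fun ω hω hne => ?_) (ae_iff.1 hfin)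
    rw [Set.mem_iInter] at hω
    obtain ⟨m, hm⟩ := exists_nat_ge (F ω).toReal
    refine hω m ?_
    rw [← ENNReal.ofReal_toReal hne]
    exact ENNReal.ofReal_le_ofReal (by linarith [Real.add_one_le_exp (m : ℝ)])
  rw [hzero] at hlim
  obtain ⟨m, hm⟩ := (hlim.eventually_le_const (by simpa using hθ : 0 < ENNReal.ofReal θ)).exists
  exact ⟨m, Nat.cast_nonneg _, hm⟩

/-- The logarithmic bound of the density at time `0` and of the return mass to `D`. -/
def HMM.logBound (M : HMM 𝒳 𝒴) (r : ℕ) (D : Set 𝒳) (u : ℕ → 𝒴) : ℝ :=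
  (lnPos (⨆ x, ENNReal.ofReal (M.g x (u 0)))).toReal
    + (lnNeg (⨅ x ∈ D, M.L r (fun i => u i) x D)).toReal

lemma HMM.logBound_nonneg (M : HMM 𝒳 𝒴) (r : ℕ) (D : Set 𝒳) (u : ℕ → 𝒴) :
    0 ≤ M.logBound r D u := add_nonneg ENNReal.toReal_nonneg ENNReal.toReal_nonneg

variable {P : Measure Ω} {Y : ℕ → Ω → 𝒴} {M : HMM 𝒳 𝒴} {r : ℕ} {D : Set 𝒳}

lemma FiniteMean.of_map {α β : Type*} [MeasurableSpace α] [MeasurableSpace β] {μ : Measure α}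
    {φ : α → β} (hφ : Measurable φ) {f : β → ℝ≥0∞} (h : FiniteMean (μ.map φ) f) :
    FiniteMean μ fun a => f (φ a) :=
  ⟨h.1.comp_measurable hφ, by simpa only [← lintegral_map' h.1 hφ.aemeasurable] using h.2⟩

lemma FiniteMean.integrable {α : Type*} [MeasurableSpace α] {μ : Measure α} {f : α → ℝ≥0∞}
    (h : FiniteMean μ f) : Integrable (fun a => (f a).toReal) μ :=
  integrable_toReal_of_lintegral_ne_top h.1 h.2.ne

lemma FiniteMean.ae_ne_top {α : Type*} [MeasurableSpace α] {μ : Measure α} {f : α → ℝ≥0∞}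
    (h : FiniteMean μ f) : ∀ᵐ a ∂μ, f a ≠ ∞ :=
  (ae_lt_top' h.1 h.2.ne).mono fun _ => ne_of_lt

lemma finiteMean_lnPos (hY : ∀ n, Measurable (Y n))
    (h : FiniteMean (P.map (Y 0)) fun y => lnPos (⨆ x, ENNReal.ofReal (M.g x y))) :
    FiniteMean (P.map fun ω n => Y n ω)
      fun u => lnPos (⨆ x, ENNReal.ofReal (M.g x (u 0))) := by
  refine FiniteMean.of_map (φ := fun u : ℕ → 𝒴 => u 0)
    (f := fun y => lnPos (⨆ x, ENNReal.ofReal (M.g x y))) (measurable_pi_apply 0) ?_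
  rwa [Measure.map_map (measurable_pi_apply 0) (measurable_pi_lambda _ hY)]

lemma finiteMean_initLaw (hY : ∀ n, Measurable (Y n)) {ℓ : ℕ} {f : (Fin ℓ → 𝒴) → ℝ≥0∞}
    (h : FiniteMean (initLaw P Y ℓ) f) :
    FiniteMean (P.map fun ω n => Y n ω) fun u => f fun i => u i := by
  have hm : Measurable fun (u : ℕ → 𝒴) (i : Fin ℓ) => u i := by fun_prop
  refine FiniteMean.of_map (φ := fun (u : ℕ → 𝒴) (i : Fin ℓ) => u i) hm ?_
  rwa [Measure.map_map hm (measurable_pi_lambda _ hY)]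

lemma IsStationaryErgodic.ae_forall_shift (hY : ∀ n, Measurable (Y n))
    (hE : IsStationaryErgodic P Y) {p : (ℕ → 𝒴) → Prop} (hp : ∀ᵐ u ∂(P.map fun ω n => Y n ω), p u) :
    ∀ᵐ ω ∂P, ∀ i, p fun n => Y (n + i) ω := by
  refine ae_all_iff.2 fun i => ?_
  rw [← hE.map_add hY i] at hp
  exact ae_of_ae_map (measurable_pi_lambda _ fun n => hY _).aemeasurable hp

lemma HMM.g_le_logBound {u : ℕ → 𝒴} (h : lnPos (⨆ x, ENNReal.ofReal (M.g x (u 0))) ≠ ∞) (x : 𝒳) :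
    M.g x (u 0) ≤ Real.exp (M.logBound r D u) := by
  have h1 := (le_iSup (fun x => ENNReal.ofReal (M.g x (u 0))) x).trans (le_exp_lnPos h)
  rw [ENNReal.ofReal_le_ofReal_iff (Real.exp_pos _).le] at h1
  exact h1.trans (Real.exp_le_exp.2 (le_add_of_nonneg_right ENNReal.toReal_nonneg))

lemma HMM.logBound_le_return {u : ℕ → 𝒴}
    (h : lnNeg (⨅ x ∈ D, M.L r (fun i => u i) x D) ≠ ∞) {x : 𝒳} (hx : x ∈ D) :
    ENNReal.ofReal (Real.exp (-M.logBound r D u)) ≤ M.L r (fun i => u i) x D := by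
  refine le_trans ?_ ((exp_lnNeg_le h).trans (iInf₂_le x hx))
  refine ENNReal.ofReal_le_ofReal (Real.exp_le_exp.2 (neg_le_neg ?_))
  exact le_add_of_nonneg_left ENNReal.toReal_nonneg

/-- The function φ and the upper constant are absorbed into c(x) = t φ(x); only the ratio s/t is
left as a parameter. -/
lemma isDoeblinOn_of_le {κ : Kernel 𝒳 𝒳} {C : Set 𝒳} {lam : Measure 𝒳} [IsFiniteMeasure lam]
    {φ : 𝒳 → ℝ} (hφ : ∀ x, 0 < φ x) {s t e : ℝ} (he : 0 ≤ e) (ht : 0 < t) (hes : e ≤ s / t)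
    (h : ∀ A, MeasurableSet A → ∀ x ∈ C, ENNReal.ofReal (s * φ x) * lam A ≤ κ x (A ∩ C) ∧
      κ x (A ∩ C) ≤ ENNReal.ofReal (t * φ x) * lam A) :
    IsDoeblinOn κ C (ENNReal.ofReal e) := by
  refine ⟨lam, fun x => ENNReal.ofReal (t * φ x), inferInstance, fun x => ENNReal.ofReal_ne_top,
    fun x hx => ⟨Measure.le_iff.2 fun A hA => ?_, Measure.le_iff.2 fun A hA => ?_⟩⟩
  · rw [Measure.restrict_apply hA, Measure.smul_apply, smul_eq_mul, ← ENNReal.ofReal_mul he]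
    refine le_trans (mul_le_mul_left (ENNReal.ofReal_le_ofReal ?_) _) (h A hA x hx).1
    rw [← mul_assoc]
    exact mul_le_mul_of_nonneg_right ((le_div_iff₀ ht).1 hes) (hφ x).le
  · rw [Measure.restrict_apply hA, Measure.smul_apply, smul_eq_mul]
    exact (h A hA x hx).2

/-- The local Doeblin condition gives the bounds along almost every record. -/
lemma HMM.IsLocalDoeblinWith.record {C : Set 𝒳} {εl εu : (Fin r → 𝒴) → ℝ}
    (hC : M.IsLocalDoeblinWith r C εl εu) (hD : MeasurableSet D) (hne : D.Nonempty) (hr : 1 ≤ r)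
    {K : Set (Fin r → 𝒴)} {e η : ℝ} (he : 0 ≤ e)
    (heK : ENNReal.ofReal e ≤ ⨅ z ∈ K, ENNReal.ofReal (εl z / εu z))
    (hK : ∀ z ∈ K, (⨆ x ∈ Cᶜ, M.L r z x Set.univ)
      ≤ ENNReal.ofReal η * (⨆ x, M.L r z x Set.univ)) {y : ℕ → 𝒴}
    (hpos : ∀ i, lnPos (⨆ x, ENNReal.ofReal (M.g x (y i))) ≠ ∞)
    (hneg : ∀ i, lnNeg (⨅ x ∈ D, M.L r (fun j => y (j + i)) x D) ≠ ∞) :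
    M.Record y r C D (ENNReal.ofReal e) (ENNReal.ofReal η)
      (fun i => M.logBound r D fun m => y (m + i)) {i | (fun l : Fin r => y (i + l)) ∈ K} := by
  obtain ⟨hCm, hl, hu, lam, φ, hlam, hφ, -, hdoe⟩ := hC
  have hg : ∀ i x, M.g x (y i) ≤ Real.exp (M.logBound r D fun m => y (m + i)) := fun i x => by
    have := HMM.g_le_logBound (M := M) (r := r) (D := D) (u := fun m => y (m + i))
      (by simpa using hpos i) x
    simpa using this
  refine ⟨hCm, hD, hne, hr, fun i => M.logBound_nonneg _ _ _, hg, fun i x hx => ?_,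
    fun i hi => ?_, fun i hi x hx => ?_⟩
  · have := HMM.logBound_le_return (M := M) (u := fun m => y (m + i)) (hneg i) hx
    rw [← M.L_apply_eq_ev y i r hD]
    simpa only [add_comm i] using this
  · refine isDoeblinOn_of_le (hφ _) he (hu _) ?_ (hdoe fun l => y (i + l))
    have h1 := heK.trans (iInf₂_le (fun l : Fin r => y (i + l)) hi)
    rwa [ENNReal.ofReal_le_ofReal_iff (div_pos (hl _) (hu _)).le] at h1
  · have hx' : x ∈ Cᶜ := hx
    refine (le_iSup₂ (f := fun x (_ : x ∈ Cᶜ) => M.L r (fun l => y (i + l)) x Set.univ) x hx').trans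
      ((hK _ hi).trans (mul_le_mul_right (iSup_le fun x => ?_) _))
    rw [M.L_univ_eq_ev]
    exact M.ev_one_le_exp hg i r x

end RandomRecord

/-! ### Tightness of the asymptotic variances -/

section Tightness

variable {Ω 𝒳 𝒴 : Type*} [MeasurableSpace Ω] [MeasurableSpace 𝒳] [MeasurableSpace 𝒴]
variable {P : Measure Ω} {Y : ℕ → Ω → 𝒴} {M : HMM 𝒳 𝒴} {r : ℕ} {D : Set 𝒳} {χ : Measure 𝒳}

lemma HMM.upred_indicator_eq (hD : MeasurableSet D) (y : ℕ → 𝒴) (ℓ : ℕ) :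
    M.upred χ y ℓ (D.indicator 1) = χ.bind (M.L ℓ fun i => y i) D := by
  rw [Measure.bind_apply hD (Kernel.aemeasurable _), HMM.upred]
  refine lintegral_congr fun x => ?_
  rw [← M.L_apply_eq_ev y 0 ℓ hD]
  simp only [zero_add]

/-- Up to time r this is the class of initial distributions. For r < s < 2r, the mass in D at time s
- r is followed by a return to D in one block. -/
lemma HMM.upred_indicator_pos (hD : MeasurableSet D) {y : ℕ → 𝒴}
    (hneg : ∀ i, lnNeg (⨅ x ∈ D, M.L r (fun j => y (j + i)) x D) ≠ ∞)
    (hstart : ∀ ℓ ≤ r, lnNeg (χ.bind (M.L ℓ fun i => y i) D) ≠ ∞) {s : ℕ} (hs : s < 2 * r) :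
    0 < M.upred χ y s (D.indicator 1) := by
  have hle : ∀ ℓ ≤ r, 0 < M.upred χ y ℓ (D.indicator 1) := fun ℓ hℓ => by
    rw [HMM.upred_indicator_eq hD]
    exact pos_of_lnNeg_ne_top (hstart ℓ hℓ)
  have hmD : Measurable (D.indicator (1 : 𝒳 → ℝ≥0∞)) := measurable_one.indicator hD
  rcases le_or_gt s r with h | h
  · exact hle s h
  · set t := s - r with ht
    rw [show s = t + r by omega, M.upred_add _ _ _ _ hmD]
    set d := ENNReal.ofReal (Real.exp (-M.logBound r D fun m => y (m + t))) with hd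
    have hd0 : d ≠ 0 := by simpa [hd] using Real.exp_pos _
    refine lt_of_lt_of_le (ENNReal.mul_pos hd0 (hle t (by omega)).ne') ?_
    rw [← HMM.upred_const_mul t hmD]
    refine HMM.upred_mono t fun x => ?_
    by_cases hx : x ∈ D
    · have := HMM.logBound_le_return (M := M) (u := fun m => y (m + t)) (hneg t) hx
      rw [← M.L_apply_eq_ev y t r hD]
      simpa only [add_comm t, Set.indicator_of_mem hx, Pi.one_apply, mul_one] using this
    · simp [hx]

/-- The inverse predictor mass of D is almost surely finite, hence bounded up to small probability.
It supplies the starting values of the forward recursion. -/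
lemma exists_measure_upred_one_le [IsProbabilityMeasure P] [IsProbabilityMeasure χ]
    (hY : ∀ n, Measurable (Y n)) (hD : MeasurableSet D) (s : ℕ)
    (hpos : ∀ᵐ ω ∂P, ∀ i, lnPos (⨆ x, ENNReal.ofReal (M.g x (Y i ω))) ≠ ∞)
    (hs : ∀ᵐ ω ∂P, 0 < M.upred χ (fun n => Y n ω) s (D.indicator 1)) {θ : ℝ} (hθ : 0 < θ) :
    ∃ b : ℝ, 0 ≤ b ∧ P {ω | ¬ M.upred χ (fun n => Y n ω) s 1
      ≤ ENNReal.ofReal (Real.exp b) * M.upred χ (fun n => Y n ω) s (D.indicator 1)}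
      ≤ ENNReal.ofReal θ := by
  have hm1 : Measurable fun ω => M.upred χ (fun n => Y n ω) s 1 :=
    M.measurable_upred_prod χ (y := fun ω n => Y n ω) hY s (F := 1) measurable_one
  have hmD : Measurable fun ω => M.upred χ (fun n => Y n ω) s (D.indicator 1) :=
    M.measurable_upred_prod χ (y := fun ω n => Y n ω) hY s (F := fun p => D.indicator 1 p.2)
      ((measurable_one.indicator hD).comp measurable_snd)
  have htop : ∀ᵐ ω ∂P, M.upred χ (fun n => Y n ω) s 1 ≠ ∞ := by
    filter_upwards [hpos] with ω hω
    refine HMM.upred_one_ne_top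
      (G := fun i => (lnPos (⨆ x, ENNReal.ofReal (M.g x (Y i ω)))).toReal) (fun i x => ?_) s
    have := (le_iSup (fun x => ENNReal.ofReal (M.g x (Y i ω))) x).trans (le_exp_lnPos (hω i))
    rwa [ENNReal.ofReal_le_ofReal_iff (Real.exp_pos _).le] at this
  obtain ⟨b, hb, h⟩ := exists_measure_not_le_exp_le (hm1.div hmD)
    (by filter_upwards [htop, hs] with ω h1 h2 using ENNReal.div_ne_top h1 h2.ne') hθ
  refine ⟨b, hb, ?_⟩
  have hs' : P {ω | ¬ 0 < M.upred χ (fun n => Y n ω) s (D.indicator 1)} = 0 := ae_iff.1 hs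
  refine (measure_mono ?_).trans ((measure_union_le
    {ω | ¬ M.upred χ (fun n => Y n ω) s 1 / M.upred χ (fun n => Y n ω) s (D.indicator 1)
      ≤ ENNReal.ofReal (Real.exp b)}
    {ω | ¬ 0 < M.upred χ (fun n => Y n ω) s (D.indicator 1)}).trans
      (by rw [hs', add_zero]; exact h))
  intro ω hω
  by_contra hcon
  simp only [Set.mem_union, Set.mem_ofPred_eq, not_or, not_not] at hcon
  exact hω ((ENNReal.div_le_iff_le_mul (.inl hcon.2.ne')
    (.inr (by simpa using Real.exp_pos b))).1 hcon.1)

/-- The asymptotic variances of the bootstrap particle filter form a tight family. -/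
theorem HMM.isTightFamily_filtVar
    (M : HMM 𝒳 𝒴) (P : Measure Ω)
    [IsProbabilityMeasure P]
    (Y : ℕ → Ω → 𝒴) (hY : ∀ n, Measurable (Y n))
    (r : ℕ) (D : Set 𝒳) (hA1 : M.A1 P Y r D) (hA2 : M.A2 P Y)
    (χ : Measure 𝒳) (hχ : χ ∈ M.initClass P Y D r)
    (h : 𝒳 → ℝ) (hmeas : Measurable h) (hbdd : ∃ B : ℝ, ∀ x, |h x| ≤ B) :
    IsTightFamily P
      (fun (n : ℕ+) (ω : Ω) => M.filtVar χ (fun k => Y k ω) n h) := by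
  obtain ⟨hE, hr, K, hK, ⟨hZ, hPK⟩, hloc, hD, hret⟩ := hA1
  obtain ⟨hg, hsup⟩ := hA2
  obtain ⟨hχp, hstart⟩ := hχ
  obtain ⟨B, hB⟩ := hbdd
  have hm : Measurable fun ω n => Y n ω := measurable_pi_lambda _ hY
  have hfi : Integrable (M.logBound r D) (P.map fun ω n => Y n ω) :=
    (finiteMean_lnPos hY hsup).integrable.add (finiteMean_initLaw hY hret).integrable
  have hc : 0 ≤ ∫ u, M.logBound r D u ∂(P.map fun ω n => Y n ω) :=
    integral_nonneg fun u => M.logBound_nonneg r D u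
  have hpos : ∀ᵐ ω ∂P, ∀ i, lnPos (⨆ x, ENNReal.ofReal (M.g x (Y i ω))) ≠ ∞ := by
    filter_upwards [hE.ae_forall_shift hY (finiteMean_lnPos hY hsup).ae_ne_top] with ω hω i
    simpa using hω i
  have hneg : ∀ᵐ ω ∂P, ∀ i, lnNeg (⨅ x ∈ D, M.L r (fun j => Y (j + i) ω) x D) ≠ ∞ :=
    hE.ae_forall_shift hY (finiteMean_initLaw hY hret).ae_ne_top
  have hin : ∀ᵐ ω ∂P, ∀ ℓ, ℓ ≤ r → lnNeg (χ.bind (M.L ℓ fun i => Y i ω) D) ≠ ∞ := by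
    refine ae_all_iff.2 fun ℓ => ?_
    by_cases hℓ : ℓ ≤ r
    · have h1 := (finiteMean_initLaw (f := fun z => lnNeg (χ.bind (M.L ℓ z) D)) hY
        (hstart ℓ hℓ)).ae_ne_top
      filter_upwards [ae_of_ae_map hm.aemeasurable h1] with ω hω _ using hω
    · exact .of_forall fun ω h => absurd h hℓ
  have hup : ∀ᵐ ω ∂P, ∀ s, s < 2 * r → 0 < M.upred χ (fun n => Y n ω) s (D.indicator 1) := by
    filter_upwards [hneg, hin] with ω h1 h2 s hs
    exact HMM.upred_indicator_pos (y := fun n => Y n ω) hD h1 h2 hs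
  -- The mass of D at time 0 is almost surely positive, so D cannot be empty.
  have hne : D.Nonempty := by
    obtain ⟨ω, hω⟩ := hup.exists
    rw [Set.nonempty_iff_ne_empty]
    rintro rfl
    simpa [HMM.upred, HMM.ev] using hω 0 (by omega)
  -- The formula with unnormalized kernels is measurable in the observations, and it equals the
  -- variance wherever the densities at all observations are bounded.
  have hmeasV : ∀ n : ℕ, AEMeasurable (fun ω => M.filtVar χ (fun k => Y k ω) n h) P := fun n => by
    refine ⟨fun ω => ∑ k ∈ Finset.range (n + 1), M.varTerm χ (fun k => Y k ω) n h B k,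
      Finset.measurable_sum _ fun k _ =>
        M.measurable_varTerm χ (y := fun ω k => Y k ω) hY n hmeas B k, ?_⟩
    filter_upwards [hpos] with ω hω
    refine HMM.filtVar_eq hg
      (G := fun i => (lnPos (⨆ x, ENNReal.ofReal (M.g x (Y i ω)))).toReal) (fun i x => ?_) n
      hmeas hB
    have := (le_iSup (fun x => ENNReal.ofReal (M.g x (Y i ω))) x).trans (le_exp_lnPos (hω i))
    rwa [ENNReal.ofReal_le_ofReal_iff (Real.exp_pos _).le] at this
  refine ⟨fun n => hmeasV n, fun θ hθ => ?_⟩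
  set c := ∫ u, M.logBound r D u ∂(P.map fun ω n => Y n ω) with hcdef
  set Θ : ℝ := 2 * (1 + 3 * (12 * r * c + 1)) with hΘ
  -- Only now is C chosen: η = exp(-2Θ) is fixed by the mean c, while e and ε come after C.
  obtain ⟨C, εl, εu, hC, hCK, hI⟩ := hloc (Real.exp (-Θ) ^ 2) (by positivity)
  obtain ⟨e, he, he1, heK⟩ : ∃ e : ℝ, 0 < e ∧ e < 1 ∧
      ENNReal.ofReal e ≤ ⨅ z ∈ K, ENNReal.ofReal (εl z / εu z) := by
    obtain ⟨q, hq0, hq⟩ := ENNReal.lt_iff_exists_nnreal_btwn.1 hI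
    -- The cap at 1/2 keeps 1 - e² positive, as its logarithm is taken.
    refine ⟨min q (1 / 2), lt_min (by simpa using hq0) (by norm_num),
      (min_le_right _ _).trans_lt (by norm_num), ?_⟩
    exact (ENNReal.ofReal_le_ofReal (min_le_left _ _)).trans (by simpa using hq.le)
  obtain ⟨ε, hε, hbound⟩ := exists_forall_filtVar_le M hg hr hc he he1 hΘ.ge C D
  obtain ⟨b₁, hb₁, hw⟩ := exists_windowBound hY hE hr hZ hK hPK hfi hε (half_pos hθ)
  have hr' : (0 : ℝ) < r := by exact_mod_cast hr
  -- Half of the probability θ is spent on the window bounds; the other half is shared by the 2r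
  -- starting times.
  have hbase : ∀ s, ∃ b : ℝ, 0 ≤ b ∧ (s < 2 * r → P {ω | ¬ M.upred χ (fun n => Y n ω) s 1
      ≤ ENNReal.ofReal (Real.exp b) * M.upred χ (fun n => Y n ω) s (D.indicator 1)}
      ≤ ENNReal.ofReal (θ / 2 / (2 * r : ℕ))) := fun s => by
    by_cases hs : s < 2 * r
    · obtain ⟨b, hb, h⟩ := exists_measure_upred_one_le (M := M) (χ := χ) hY hD s hpos
        (hup.mono fun ω hω => hω s hs) (θ := θ / 2 / (2 * r : ℕ)) (by push_cast; positivity)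
      exact ⟨b, hb, fun _ => h⟩
    · exact ⟨0, le_rfl, fun h => absurd h hs⟩
  choose b₂ hb₂ hbase using hbase
  set b := b₁ + ∑ s ∈ Finset.range (2 * r), b₂ s with hb
  have hsum0 : 0 ≤ ∑ s ∈ Finset.range (2 * r), b₂ s := Finset.sum_nonneg fun s _ => hb₂ s
  obtain ⟨V, hV⟩ := hbound b (by positivity) B
  refine ⟨V, fun n => ?_⟩
  rw [Measure.map_apply_of_aemeasurable (hmeasV n) measurableSet_Icc.compl]
  set N₀ := {ω | ¬ ((∀ i, lnPos (⨆ x, ENNReal.ofReal (M.g x (Y i ω))) ≠ ∞) ∧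
    ∀ i, lnNeg (⨅ x ∈ D, M.L r (fun j => Y (j + i) ω) x D) ≠ ∞)} with hN₀
  have hPN₀ : P N₀ = 0 := ae_iff.1 (hpos.and hneg)
  set A₁ := {ω | ¬ WindowBound r (n + 2 * r) c ε b₁ (fun i => M.logBound r D fun m => Y (m + i) ω)
    {i | (fun l : Fin r => Y (i + l) ω) ∈ K}} with hA₁
  set A₂ : ℕ → Set Ω := fun s => {ω | ¬ M.upred χ (fun n => Y n ω) s 1
      ≤ ENNReal.ofReal (Real.exp (b₂ s)) * M.upred χ (fun n => Y n ω) s (D.indicator 1)} with hA₂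
  have hsub : (fun ω => M.filtVar χ (fun k => Y k ω) n h) ⁻¹' (Set.Icc (-V) V)ᶜ
      ⊆ N₀ ∪ A₁ ∪ ⋃ s ∈ Finset.range (2 * r), A₂ s := by
    intro ω hω
    by_contra hcon
    simp only [hN₀, hA₁, hA₂, Set.mem_union, Set.mem_ofPred_eq, Set.mem_iUnion, not_or, not_not,
      not_exists] at hcon
    obtain ⟨⟨⟨h1, h2⟩, h3⟩, h4⟩ := hcon
    refine hω (abs_le.1 (hV χ (fun k => Y k ω) _ _ n h
      (hC.record (y := fun k => Y k ω) hD hne hr he.le heK (fun z hz => (hCK z hz).1) h1 h2)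
      (h3.mono (by linarith)) (fun s hs => (h4 s (Finset.mem_range.2 hs)).trans ?_) hmeas hB))
    refine mul_le_mul_left (ENNReal.ofReal_le_ofReal (Real.exp_le_exp.2 ?_)) _
    have := Finset.single_le_sum (fun s _ => hb₂ s) (Finset.mem_range.2 hs)
    linarith
  have hA₂P : P (⋃ s ∈ Finset.range (2 * r), A₂ s) ≤ ENNReal.ofReal (θ / 2) := by
    refine (measure_biUnion_finset_le _ _).trans
      ((Finset.sum_le_sum fun s hs => hbase s (Finset.mem_range.1 hs)).trans_eq ?_)
    have h2r : ((2 * r : ℕ) : ℝ) ≠ 0 := by push_cast; positivity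
    rw [Finset.sum_const, Finset.card_range, nsmul_eq_mul, ← ENNReal.ofReal_natCast,
      ← ENNReal.ofReal_mul (Nat.cast_nonneg _), mul_div_cancel₀ _ h2r]
  calc P _ ≤ P N₀ + P A₁ + P (⋃ s ∈ Finset.range (2 * r), A₂ s) :=
        (measure_mono hsub).trans ((measure_union_le _ _).trans
          (add_le_add (measure_union_le _ _) le_rfl))
    _ ≤ 0 + ENNReal.ofReal (θ / 2) + ENNReal.ofReal (θ / 2) :=
        add_le_add (add_le_add hPN₀.le (hw _)) hA₂P
    _ = ENNReal.ofReal θ := by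
        rw [zero_add, ← ENNReal.ofReal_add (by positivity) (by positivity), add_halves]

end Tightness

end ParticleFilter

end

theorem mainTheorem2 {𝒳 𝒴 Ω : Type*} [MeasurableSpace 𝒳] [MeasurableSpace 𝒴] [MeasurableSpace Ω]
    (M : ParticleFilter.HMM 𝒳 𝒴) (P : MeasureTheory.Measure Ω)
    [MeasureTheory.IsProbabilityMeasure P]
    (Y : ℕ → Ω → 𝒴) (hY : ∀ n, Measurable (Y n))
    (r : ℕ) (D : Set 𝒳) (hA1 : M.A1 P Y r D) (hA2 : M.A2 P Y)
    (χ : MeasureTheory.Measure 𝒳) (hχ : χ ∈ M.initClass P Y D r)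
    (h : 𝒳 → ℝ) (hmeas : Measurable h) (hbdd : ∃ B : ℝ, ∀ x, |h x| ≤ B) :
    ParticleFilter.IsTightFamily P
      (fun (n : ℕ+) (ω : Ω) => M.filtVar χ (fun k => Y k ω) n h) :=
  M.isTightFamily_filtVar P Y hY r D hA1 hA2 χ hχ h hmeas hbdd
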